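/- **Model.** There are $n$ nodes, $f$ of which are Byzantine and $h=n-f$ of which are honest; honest nodes do not know which nodes are honest. Communication is asynchronous point-to-point message passing: in a (possibly randomized) algorithm, an honest node makes a local step when it starts and whenever a message is delivered to it (it knows the true sender); in each step it uses fresh private randomness, updates its state, sends finitely many messages, and may irrevocably output a vector. An attack $\textsc{Byz}$ controls the Byzantine nodes and the scheduling: based on everything that has happened in the system so far (but not on future random choices of the honest nodes) it decides which pending message to deliver next and which messages the Byzantine nodes send to whom. It cannot alter or forge messages of honest nodes, and (almost surely) each message between honest nodes is eventually delivered. For a finite family $x=(x^{(j)})_j$ in $\mathbb R^d$ let $\Delta_2(x)=\max_{j,k}\|x^{(j)}-x^{(k)}\|_2$ and let $\bar x$ be its average. An algorithm $\textsc{Avg}$ (for given $n,f,d$) *achieves Byzantine $C$-averaging agreement* if for every input $N\in\mathbb N$, every set of $h=n-f$ honest nodes, every family $x\in\mathbb R^{d\cdot h}$ of inputs of the honest nodes and every attack, almost surely all honest nodes output a vector, and the family $y$ of outputs of the honest nodes satisfies $$\mathbb E\,\Delta_2(y)^2\le \frac{\Delta_2(x)^2}{4^N}\qquad\text{and}\qquad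 \mathbb E\,\|\bar y-\bar x\|_2^2\le C^2\Delta_2(x)^2 .$$ It *achieves Byzantine averaging agreement* if it does so for some constant $C$. **The algorithm RB-TM.** Let $\varepsilon>0$, $\tilde\varepsilon=\varepsilon/(1+\varepsilon)$ and $q=n-f$. On input $N$, each node starts from its input vector and performs $$T(N)=\left\lceil \frac{(N+1)\ln 2+\ln\sqrt h}{\tilde\varepsilon}\right\rceil$$ iterations, after which it outputs its vector (and keeps answering the messages of others). In each iteration: 1. The node sends its current vector to all nodes by Bracha's reliable broadcast: a node echoes to all the first vector received from a given origin for a given iteration; it sends to all, once per origin and iteration, a "ready" message for a vector for which it has received echoes from more than $(n+f)/2$ nodes or ready messages from at least $f+1$ nodes; it *collects* a vector from an origin once it has received ready messages for it from at least $2f+1$ nodes. 2. Once it has collected the vectors of at least $q$ nodes in this iteration, it reports to all nodes the set of these nodes. A node is a *witness* once its report, of at least $q$ nodes, has been received and the vectors of all reported nodes have been collected. 3. Once there are at least $q$ witnesses, let $Q$ be the set of nodes whose vectors $w^{(k)}$ have been collected in this iteration. For each coordinate $i$ the node discards the elements of $Q$ with the $f$ smallest and the $f$ largest values $w^{(k)}[i]$,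 and its $i$-th coordinate becomes $\frac{1}{|Q|-2f}\sum_k w^{(k)}[i]$ over the remaining $k\in Q$. **Theorem.** (i) Let $n\ge 1$ and let $\varepsilon>0$ be such that $n\ge(3+\varepsilon)f$. Then RB-TM achieves Byzantine $\frac{4f}{\sqrt h}$-averaging agreement in every dimension $d$. (ii) This is optimal in terms of Byzantine resilience: if $n\le 3f$, $h=n-f\ge 2$ and $d\ge1$, then no (possibly randomized) algorithm achieves Byzantine averaging agreement. -/

import Mathlib

open scoped ENNReal
open MeasureTheory

universe u

namespace ByzAvg

/-- Parameter vectors: `ℝ^d` with the Euclidean norm. -/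
abbrev Vec (d : ℕ) : Type := EuclideanSpace ℝ (Fin d)

/-! ### Asynchronous message passing with Byzantine nodes -/

/-- A (possibly randomized) distributed protocol for `n` nodes, in the asynchronous message passing
model. Every node knows its own identifier and its own input vector. It makes one local step when it
starts and one each time a message is delivered to it; the receiver knows who sent the message. In
each local step it uses one fresh private coin of law `coinLaw`, updates its state and sends finitely
many messages `(destination, content)`, possibly to itself. A node may output a vector. -/
structure Protocol (n d : ℕ) where
  Msg : Type u
  State : Type u
  Coin : Type u
  [coinSpace : MeasurableSpace Coin]
  coinLaw : ProbabilityMeasure Coin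
  init : Fin n → Vec d → Coin → State × List (Fin n × Msg)
  step : Fin n → State → Fin n → Msg → Coin → State × List (Fin n × Msg)
  output : State → Option (Vec d)

attribute [instance] Protocol.coinSpace

/-- An algorithm takes the precision parameter `N` as an input. -/
abbrev Algorithm (n d : ℕ) : Type (u + 1) := ℕ → Protocol.{u} n d

/-- A message in the network, with its authenticated source. -/
structure Packet (n : ℕ) (M : Type u) where
  src : Fin n
  dst : Fin n
  msg : M

namespace Protocol

variable {n d : ℕ}

/-- What the model records about one honest node: its state, the number of local steps it has made
(hence of coins it has used), and its irrevocable output. -/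
structure Local (A : Protocol.{u} n d) where
  state : A.State
  clock : ℕ
  decided : Option (Vec d)

/-- A global configuration when `H` is the set of honest nodes: the honest nodes, the list of all
messages that honest nodes have sent so far (in order of sending), and the positions in this list of
those that have been delivered. -/
structure Config (A : Protocol.{u} n d) (H : Finset (Fin n)) where
  loc : H → A.Local
  sent : List (Packet n A.Msg)
  delivered : Finset ℕ

/-- What the adversary can do next: deliver the `k`-th message sent by honest nodes, let a Byzantine
node `src` send `m` to an honest node `dst`, or nothing. -/
inductive Action (A : Protocol.{u} n d) where
  | deliver (k : ℕ)
  | inject (src dst : Fin n) (m : A.Msg)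
  | idle

/-- An attack: based on the current configuration and on all earlier ones (most recent first), the
adversary chooses the next action. It sees all states and messages, but no future coin. -/
abbrev Attack (A : Protocol.{u} n d) (H : Finset (Fin n)) : Type u :=
  A.Config H → List (A.Config H) → A.Action

/-- Coin tapes of the honest nodes: `ω j k` is the coin of the `k`-th local step of node `j`. -/
abbrev Tapes (A : Protocol.{u} n d) (H : Finset (Fin n)) : Type u := H → ℕ → A.Coin

/-- All coins are independent, of law `coinLaw`. -/
noncomputable def tapeLaw (A : Protocol.{u} n d) (H : Finset (Fin n)) : Measure (A.Tapes H) :=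
  Measure.pi fun _ : H => Measure.infinitePi fun _ : ℕ => (A.coinLaw : Measure A.Coin)

variable (A : Protocol.{u} n d) {H : Finset (Fin n)}

/-- Address messages produced by node `j`. -/
def packets (j : Fin n) (l : List (Fin n × A.Msg)) : List (Packet n A.Msg) :=
  l.map fun p => ⟨j, p.1, p.2⟩

/-- The honest node `j` starts. -/
def start (x : H → Vec d) (ω : A.Tapes H) (j : H) : A.State × List (Fin n × A.Msg) :=
  A.init j (x j) (ω j 0)

/-- The initial configuration. -/
def initialConfig (x : H → Vec d) (ω : A.Tapes H) : A.Config H where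
  loc j := ⟨(A.start x ω j).1, 1, A.output (A.start x ω j).1⟩
  sent := (List.finRange n).flatMap fun j =>
    if hj : j ∈ H then A.packets j (A.start x ω ⟨j, hj⟩).2 else []
  delivered := ∅

/-- The honest node `j` receives `m` from `src` and makes a local step. -/
def receive (ω : A.Tapes H) (c : A.Config H) (j : H) (src : Fin n) (m : A.Msg) : A.Config H :=
  let l := c.loc j
  let r := A.step j l.state src m (ω j l.clock)
  { loc := Function.update c.loc j ⟨r.1, l.clock + 1, l.decided <|> A.output r.1⟩
    sent := c.sent ++ A.packets j r.2
    delivered := c.delivered }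

/-- The effect of an action. Messages sent by honest nodes are delivered unaltered and at most once,
and the adversary cannot send a message in the name of an honest node: actions that do not comply
have no effect. -/
def perform (ω : A.Tapes H) (c : A.Config H) : A.Action → A.Config H
  | .deliver k =>
      match c.sent[k]? with
      | none => c
      | some p =>
          if h : p.dst ∈ H ∧ k ∉ c.delivered then
            { A.receive ω c ⟨p.dst, h.1⟩ p.src p.msg with delivered := insert k c.delivered }
          else c
  | .inject src dst m =>
      if h : dst ∈ H ∧ src ∉ H then A.receive ω c ⟨dst, h.1⟩ src m else c
  | .idle => c

/-- The configuration after `t` actions, together with all earlier configurations. -/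
def history (x : H → Vec d) (byz : A.Attack H) (ω : A.Tapes H) :
    ℕ → A.Config H × List (A.Config H)
  | 0 => (A.initialConfig x ω, [])
  | t + 1 =>
      let p := history x byz ω t
      (A.perform ω p.1 (byz p.1 p.2), p.1 :: p.2)

/-- The configuration after `t` actions. -/
def run (x : H → Vec d) (byz : A.Attack H) (ω : A.Tapes H) (t : ℕ) : A.Config H :=
  (A.history x byz ω t).1

/-- Every message from an honest node to an honest node is eventually delivered. -/
def Fair (x : H → Vec d) (byz : A.Attack H) (ω : A.Tapes H) : Prop :=
  ∀ (t k : ℕ) (p : Packet n A.Msg), (A.run x byz ω t).sent[k]? = some p → p.dst ∈ H →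
    ∃ t', k ∈ (A.run x byz ω t').delivered

/-- The honest node `j` eventually outputs `v`. -/
def Decides (x : H → Vec d) (byz : A.Attack H) (ω : A.Tapes H) (j : H) (v : Vec d) : Prop :=
  ∃ t, ((A.run x byz ω t).loc j).decided = some v

open Classical in
/-- The vectors output by the honest nodes (`0` for a node that never outputs anything). -/
noncomputable def outputs (x : H → Vec d) (byz : A.Attack H) (ω : A.Tapes H) : H → Vec d :=
  fun j => if h : ∃ v, A.Decides x byz ω j v then h.choose else 0

end Protocol

/-! ### Averaging agreement -/

/-- The `ℓ₂` diameter of a finite vector family. -/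
noncomputable def diam₂ {ι : Type*} {d : ℕ} (x : ι → Vec d) : ℝ := Metric.diam (Set.range x)

/-- The average of a finite vector family. -/
noncomputable def mean {ι : Type*} [Fintype ι] {d : ℕ} (x : ι → Vec d) : Vec d :=
  (Fintype.card ι : ℝ)⁻¹ • ∑ j, x j

/-- The expectation of a nonnegative random variable. For a measurable `X` this is `∫⁻ ω, X ω ∂P`;
neither protocols nor attacks are required to be measurable, and in general it is the upper
integral. -/
noncomputable def expectation {Ω : Type*} [MeasurableSpace Ω] (P : Measure Ω) (X : Ω → ℝ≥0∞) : ℝ≥0∞ :=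
  ⨅ (g : Ω → ℝ≥0∞) (_ : Measurable g) (_ : X ≤ g), ∫⁻ ω, g ω ∂P

/-- Byzantine `C`-averaging agreement among `n` nodes, `f` of which are Byzantine: for every `N`,
every set `H` of `h = n - f` honest nodes, every family of input vectors and every attack under which, almost surely,
messages between honest nodes are eventually delivered, all honest nodes output a vector, and the
family of these vectors has the two required properties. -/
def AchievesAveragingAgreement {n d : ℕ} (f : ℕ) (A : Algorithm.{u} n d) (C : ℝ) : Prop :=
  ∀ (N : ℕ) (H : Finset (Fin n)), H.card + f = n →
    ∀ (x : H → Vec d) (byz : (A N).Attack H),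
      (∀ᵐ ω ∂(A N).tapeLaw H, (A N).Fair x byz ω) →
        (∀ᵐ ω ∂(A N).tapeLaw H, ∀ j : H, ∃ v, (A N).Decides x byz ω j v) ∧
        expectation ((A N).tapeLaw H)
            (fun ω => ENNReal.ofReal (diam₂ ((A N).outputs x byz ω) ^ 2)) ≤
          ENNReal.ofReal (diam₂ x ^ 2 / 4 ^ N) ∧
        expectation ((A N).tapeLaw H)
            (fun ω => ENNReal.ofReal (‖mean ((A N).outputs x byz ω) - mean x‖ ^ 2)) ≤
          ENNReal.ofReal (C ^ 2 * diam₂ x ^ 2)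

/-- The algorithm solves averaging agreement. -/
def SolvesAveragingAgreement {n d : ℕ} (f : ℕ) (A : Algorithm.{u} n d) : Prop :=
  ∃ C : ℝ, AchievesAveragingAgreement f A C

/-! ### Coordinate-wise trimmed mean -/

/-- The position (from `0`) of `k` when the elements of `Q` are sorted by increasing value of `a`,
ties being broken by the identifiers. -/
noncomputable def rank {n : ℕ} (Q : Finset (Fin n)) (a : Fin n → ℝ) (k : Fin n) : ℕ := by
  classical exact (Q.filter fun l => a l < a k ∨ (a l = a k ∧ l < k)).card

/-- The elements of `Q` that remain when those with the `f` smallest and the `f` largest values are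
discarded. -/
noncomputable def trim {n : ℕ} (f : ℕ) (Q : Finset (Fin n)) (a : Fin n → ℝ) : Finset (Fin n) :=
  Q.filter fun k => f ≤ rank Q a k ∧ rank Q a k + f < Q.card

/-- The coordinate-wise trimmed mean of the vectors `w k`, `k ∈ Q`. -/
noncomputable def trimmedMean {n d : ℕ} (f : ℕ) (Q : Finset (Fin n)) (w : Fin n → Vec d) : Vec d :=
  WithLp.toLp 2 fun i =>
    (∑ k ∈ trim f Q (fun l => w l i), w k i) / ((Q.card : ℝ) - 2 * (f : ℝ))

/-! ### The algorithm RB-TM -/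

namespace RBTM

/-- Messages: the three kinds of messages of Bracha's reliable broadcast of the vector `v` that node
`origin` proposes for iteration `r`, and the report of the set `S` of nodes whose vectors for
iteration `r` the sender has collected. -/
inductive Msg (n d : ℕ) : Type where
  | initial (r : ℕ) (v : Vec d)
  | echo (origin : Fin n) (r : ℕ) (v : Vec d)
  | ready (origin : Fin n) (r : ℕ) (v : Vec d)
  | report (r : ℕ) (S : Finset (Fin n))

/-- The state of a node: the set of messages `(sender, content)` received so far; the broadcasts
`(origin, iteration)` for which it has sent an echo, and those for which it has sent a ready message;
the vectors `collected origin r` whose reliable broadcast it has completed; its current iteration and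
vector; and whether it has sent its report for the current iteration. -/
structure State (n d : ℕ) : Type where
  received : Set (Fin n × Msg n d)
  echoed : Set (Fin n × ℕ)
  readied : Set (Fin n × ℕ)
  collected : Fin n → ℕ → Option (Vec d)
  iter : ℕ
  vec : Vec d
  reported : Prop

variable {n d : ℕ}

namespace State

/-- The number of distinct nodes from which `m` was received. -/
noncomputable def count (s : State n d) (m : Msg n d) : ℕ :=
  Set.ncard {k : Fin n | (k, m) ∈ s.received}

/-- The nodes whose vectors for iteration `r` have been collected. -/
def quorum (s : State n d) (r : ℕ) : Finset (Fin n) :=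
  Finset.univ.filter fun k => (s.collected k r).isSome

/-- The witnesses of iteration `r`: the nodes that reported at least `n - f` nodes whose vectors have
all been collected. -/
def witnesses (f : ℕ) (s : State n d) (r : ℕ) : Set (Fin n) :=
  {k | ∃ S : Finset (Fin n), (k, Msg.report r S) ∈ s.received ∧ n - f ≤ S.card ∧ S ⊆ s.quorum r}

end State

/-- A rule updates the state and produces messages, each of which is sent to all nodes. -/
abbrev Rule (n d : ℕ) : Type := State n d → State n d × List (Msg n d)

/-- Apply two rules, one after the other. -/
def Rule.andThen (R R' : Rule n d) : Rule n d := fun s =>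
  ((R' (R s).1).1, (R s).2 ++ (R' (R s).1).2)

/-- Record the message `m` from `src`. -/
def recordRule (src : Fin n) (m : Msg n d) : Rule n d := fun s =>
  ({ s with received := insert (src, m) s.received }, [])

open Classical in
/-- Reliable broadcast: echo the first vector that `src` sends for iteration `r`. -/
noncomputable def echoRule (src : Fin n) : Msg n d → Rule n d
  | .initial r v => fun s =>
      if (src, r) ∈ s.echoed then (s, [])
      else ({ s with echoed := insert (src, r) s.echoed }, [.echo src r v])
  | _ => fun s => (s, [])

open Classical in
/-- Reliable broadcast: send a ready message, once per broadcast, after having received the same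
vector in echoes from more than `(n + f) / 2` nodes, or in ready messages from `f + 1` nodes. -/
noncomputable def tryReady (f : ℕ) (o : Fin n) (r : ℕ) (v : Vec d) : Rule n d := fun s =>
  if (o, r) ∉ s.readied ∧
      (n + f < 2 * s.count (.echo o r v) ∨ f + 1 ≤ s.count (.ready o r v)) then
    ({ s with readied := insert (o, r) s.readied }, [.ready o r v])
  else (s, [])

open Classical in
/-- Reliable broadcast: complete the broadcast, once, after ready messages from `2 f + 1` nodes. -/
noncomputable def tryCollect (f : ℕ) (o : Fin n) (r : ℕ) (v : Vec d) : Rule n d := fun s =>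
  if s.collected o r = none ∧ 2 * f + 1 ≤ s.count (.ready o r v) then
    ({ s with collected := fun o' r' => if o' = o ∧ r' = r then some v else s.collected o' r' }, [])
  else (s, [])

/-- The rules of reliable broadcast that the receipt of an echo or a ready message can trigger. -/
noncomputable def broadcastRule (f : ℕ) : Msg n d → Rule n d
  | .echo o r v => tryReady f o r v
  | .ready o r v => (tryReady f o r v).andThen (tryCollect f o r v)
  | _ => fun s => (s, [])

open Classical in
/-- Witness mechanism: once `n - f` vectors have been collected in the current iteration, report to
all nodes from whom. -/
noncomputable def reportRule (f T : ℕ) : Rule n d := fun s =>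
  if s.iter < T ∧ ¬ s.reported ∧ n - f ≤ (s.quorum s.iter).card then
    ({ s with reported := True }, [.report s.iter (s.quorum s.iter)])
  else (s, [])

/-- The trimmed mean of the vectors collected in the current iteration. -/
noncomputable def State.nextVec (f : ℕ) (s : State n d) : Vec d :=
  trimmedMean f (s.quorum s.iter) fun k => (s.collected k s.iter).getD 0

open Classical in
/-- Once there are `n - f` witnesses in the current iteration, replace the vector by the trimmed mean
of all collected vectors, and begin the next iteration, if any, by broadcasting the new vector. -/
noncomputable def advanceRule (f T : ℕ) : Rule n d := fun s =>
  if s.iter < T ∧ s.reported ∧ n - f ≤ (s.witnesses f s.iter).ncard then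
    ({ s with iter := s.iter + 1, vec := s.nextVec f, reported := False },
      if s.iter + 1 < T then [.initial (s.iter + 1) (s.nextVec f)] else [])
  else (s, [])

/-- What a node does when it receives `m` from `src`. -/
noncomputable def onReceive (f T : ℕ) (src : Fin n) (m : Msg n d) : Rule n d :=
  (recordRule src m).andThen <| (echoRule src m).andThen <| (broadcastRule f m).andThen <|
    (reportRule f T).andThen (advanceRule f T)

/-- Send each message to all nodes. -/
def toAll (l : List (Msg n d)) : List (Fin n × Msg n d) :=
  l.flatMap fun m => (List.finRange n).map fun k => (k, m)

/-- The protocol with `T` iterations of the trimmed mean. It is deterministic. A node that has made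
its `T` iterations outputs its vector, and keeps on serving the other nodes. -/
noncomputable def protocol (n f d T : ℕ) : Protocol.{0} n d where
  Msg := Msg n d
  State := State n d
  Coin := Unit
  coinLaw := ⟨Measure.dirac (), inferInstance⟩
  init _ x _ := (⟨∅, ∅, ∅, fun _ _ => none, 0, x, False⟩, toAll [.initial 0 x])
  step _ s src m _ := ((onReceive f T src m s).1, toAll (onReceive f T src m s).2)
  output s := if T ≤ s.iter then some s.vec else none

/-- The number of iterations, `⌈((N + 1) ln 2 + ln √h) / (ε / (1 + ε))⌉` with `h = n - f`. -/
noncomputable def iterations (n f : ℕ) (ε : ℝ) (N : ℕ) : ℕ :=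
  ⌈(((N : ℝ) + 1) * Real.log 2 + Real.log √((n : ℝ) - (f : ℝ))) / (ε / (1 + ε))⌉₊

end RBTM

/-- RB-TM. -/
noncomputable def rbtm (n f d : ℕ) (ε : ℝ) : Algorithm.{0} n d :=
  fun N => RBTM.protocol n f d (RBTM.iterations n f ε N)

end ByzAvg

/-! (i) `RB-TM` tosses no coins, so its space of tapes has one point and only a single fair run has
to be studied. Write `h = n - f`, and note that `3 f < n`.

Two sets of more than `(n + f) / 2` echoing nodes share more than `f` nodes, hence an honest one,
and an honest node echoes a single vector per broadcast. So all honest nodes that collect a vector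
of a given origin and iteration collect the same one, even if the origin is Byzantine. If one of
them collects it, then all do: `f + 1` honest ready messages make every honest node send a ready
message, and `n - f ≥ 2 f + 1`. Two sets of `n - f` witnesses share an honest witness, whose report
lies in both collected sets. An iteration thus amounts to trimmed means of one common family `w`
over sets `Q j` with `n - f ≤ |Q j ∩ Q k|` (`Exec.exists_trajectory`).

The rest is coordinatewise. The values left by trimming lie in the range of the honest values.
Trimming is monotone in the set, so two nodes average at most `n - 2 f` values each, with all of
`trim (Q j ∩ Q k)` in common. The range therefore shrinks by the factor `f / (n - 2 f) ≤ 1 / (1 +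
ε)` (`scalarTrimmedMean_sub_le`). A trimmed mean differs from the honest mean by at most `2 f / h`
times the range (`abs_scalarTrimmedMean_sub_mean_le`). Only the first iteration contributes to the
drift, as later ones stay in the interval reached by then. The squared coordinate ranges sum to at
most `4 h Δ₂²`. This explains the `√h` in the number of iterations and the constant `4 f / √h`.

(ii) If `n ≤ 3 f`, split the nodes into nonempty `P`, `Q` of at most `f` elements and `R` of `f`
elements. In a world whose honest nodes are `P` and part of `R`, all with input `0`, while the other
nodes are silent, both required bounds vanish, so all output `0`. In the same way `Q` and part of
`R` output `v` on the common input `v`. Now let `P ∪ Q` be honest, with inputs `0` on `P` and `v` on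
`Q`. The Byzantine nodes `R` play the first world towards `P` and the second towards `Q`, and
messages between `P` and `Q` wait until all have decided (`splitAttack_decides`). The outputs keep
their distance, which contradicts the contraction for `N = 1`. An attack has no coins of its own, so
those of the simulated nodes are fixed beforehand by Fubini (`exists_tape_off`). -/

namespace ByzAvg

/-! ### Runs of an arbitrary protocol: packets keep their positions, and decisions are permanent. -/

namespace Protocol

variable {n d : ℕ} (A : Protocol.{u} n d) {H : Finset (Fin n)}

theorem perform_deliver (ω : A.Tapes H) (c : A.Config H) {k : ℕ} {p : Packet n A.Msg}
    (hp : c.sent[k]? = some p) (hd : p.dst ∈ H) (hk : k ∉ c.delivered) :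
    A.perform ω c (.deliver k) =
      { A.receive ω c ⟨p.dst, hd⟩ p.src p.msg with delivered := insert k c.delivered } := by
  simp [perform, hp, hd, hk]

theorem perform_inject (ω : A.Tapes H) (c : A.Config H) {src dst : Fin n} (m : A.Msg)
    (hd : dst ∈ H) (hs : src ∉ H) :
    A.perform ω c (.inject src dst m) = A.receive ω c ⟨dst, hd⟩ src m := by
  simp [perform, hd, hs]

/-- Every later induction on time splits a step in this way: nothing happens, a Byzantine message
arrives, or a packet of the network arrives. -/
theorem perform_cases (ω : A.Tapes H) (c : A.Config H) (a : A.Action) :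
    A.perform ω c a = c ∨
    (∃ (j : H) (src : Fin n) (m : A.Msg), src ∉ H ∧
      A.perform ω c a = A.receive ω c j src m) ∨
    ∃ (k : ℕ) (p : Packet n A.Msg) (hd : p.dst ∈ H), c.sent[k]? = some p ∧ k ∉ c.delivered ∧
      a = .deliver k ∧ A.perform ω c a =
        { A.receive ω c ⟨p.dst, hd⟩ p.src p.msg with delivered := insert k c.delivered } := by
  cases a with
  | deliver k =>
    cases hp : c.sent[k]? with
    | none => left; simp [perform, hp]
    | some p =>
      by_cases h : p.dst ∈ H ∧ k ∉ c.delivered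
      · right; right
        exact ⟨k, p, h.1, hp, h.2, rfl, A.perform_deliver ω c hp h.1 h.2⟩
      · left; simp only [perform, hp, h, dif_neg, not_false_eq_true]
  | inject src dst m =>
    by_cases h : dst ∈ H ∧ src ∉ H
    · right; left
      exact ⟨⟨dst, h.1⟩, src, m, h.2, A.perform_inject ω c m h.1 h.2⟩
    · left; simp only [perform, h, dif_neg, not_false_eq_true]
  | idle => left; rfl

theorem perform_sent (ω : A.Tapes H) (c : A.Config H) (a : A.Action) :
    ∃ l, (A.perform ω c a).sent = c.sent ++ l := by
  rcases A.perform_cases ω c a with h | ⟨j, src, m, -, h⟩ | ⟨k, p, hd, -, -, -, h⟩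
  · exact ⟨[], by rw [h, List.append_nil]⟩
  · rw [h]; exact ⟨_, rfl⟩
  · rw [h]; exact ⟨_, rfl⟩

theorem receive_loc_self (ω : A.Tapes H) (c : A.Config H) (j : H) (src : Fin n) (m : A.Msg) :
    (A.receive ω c j src m).loc j =
      ⟨(A.step j (c.loc j).state src m (ω j (c.loc j).clock)).1, (c.loc j).clock + 1,
        (c.loc j).decided <|>
          A.output (A.step j (c.loc j).state src m (ω j (c.loc j).clock)).1⟩ :=
  Function.update_self _ _ _

theorem receive_loc_of_ne (ω : A.Tapes H) (c : A.Config H) {i j : H} (h : i ≠ j) (src : Fin n)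
    (m : A.Msg) : (A.receive ω c j src m).loc i = c.loc i :=
  Function.update_of_ne h _ _

theorem receive_decided (ω : A.Tapes H) (c : A.Config H) (i : H) (src : Fin n) (m : A.Msg)
    {j : H} {v : Vec d} (hv : (c.loc j).decided = some v) :
    ((A.receive ω c i src m).loc j).decided = some v := by
  simp only [receive]
  by_cases h : j = i
  · subst h; simp [hv]
  · simp [Function.update_of_ne h, hv]

theorem perform_decided (ω : A.Tapes H) (c : A.Config H) (a : A.Action)
    {j : H} {v : Vec d} (hv : (c.loc j).decided = some v) :
    ((A.perform ω c a).loc j).decided = some v := by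
  rcases A.perform_cases ω c a with h | ⟨i, src, m, -, h⟩ | ⟨k, p, hd, -, -, -, h⟩ <;> rw [h]
  · exact hv
  · exact A.receive_decided ω c i src m hv
  · exact A.receive_decided ω c ⟨p.dst, hd⟩ p.src p.msg hv

variable (x : H → Vec d) (byz : A.Attack H) (ω : A.Tapes H)

/-- The action chosen at time `t`. -/
def actionAt (t : ℕ) : A.Action := byz (A.history x byz ω t).1 (A.history x byz ω t).2

theorem run_zero : A.run x byz ω 0 = A.initialConfig x ω := rfl

theorem run_succ (t : ℕ) :
    A.run x byz ω (t + 1) = A.perform ω (A.run x byz ω t) (A.actionAt x byz ω t) := rfl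

theorem run_sent_prefix {s t : ℕ} (hst : s ≤ t) :
    (A.run x byz ω s).sent <+: (A.run x byz ω t).sent := by
  induction t, hst using Nat.le_induction with
  | base => exact List.prefix_rfl
  | succ t _ ih =>
    obtain ⟨l, hl⟩ := A.perform_sent ω (A.run x byz ω t) (A.actionAt x byz ω t)
    rw [run_succ, hl]
    exact ih.trans (List.prefix_append _ _)

theorem run_sent_getElem? {s t : ℕ} (hst : s ≤ t) {k : ℕ} {p : Packet n A.Msg}
    (hp : (A.run x byz ω s).sent[k]? = some p) : (A.run x byz ω t).sent[k]? = some p := by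
  obtain ⟨l, hl⟩ := A.run_sent_prefix x byz ω hst
  have hk : k < (A.run x byz ω s).sent.length := (List.getElem?_eq_some_iff.mp hp).1
  rw [← hl, List.getElem?_append_left hk, hp]

theorem run_decided_mono {s t : ℕ} (hst : s ≤ t) {j : H} {v : Vec d}
    (hv : ((A.run x byz ω s).loc j).decided = some v) :
    ((A.run x byz ω t).loc j).decided = some v := by
  induction t, hst using Nat.le_induction with
  | base => exact hv
  | succ t _ ih => exact A.perform_decided _ _ _ ih

/-- Needed for the simulation: a packet that has just been appended cannot yet be marked as
delivered. -/
theorem perform_delivered_lt (c : A.Config H) (a : A.Action)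
    (hc : ∀ k ∈ c.delivered, k < c.sent.length) :
    ∀ k ∈ (A.perform ω c a).delivered, k < (A.perform ω c a).sent.length := by
  rcases A.perform_cases ω c a with h | ⟨j, src, m, -, h⟩ | ⟨k, p, hd, hp, -, -, h⟩ <;> rw [h]
  · exact hc
  · intro k hk
    have := hc k hk
    simp only [receive, List.length_append]
    omega
  · intro k' hk'
    have hk : k < c.sent.length := (List.getElem?_eq_some_iff.mp hp).1
    simp only [receive, List.length_append]
    rcases Finset.mem_insert.mp hk' with rfl | hk'
    · omega
    · have := hc k' hk'
      omega

theorem run_delivered_lt (t : ℕ) :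
    ∀ k ∈ (A.run x byz ω t).delivered, k < (A.run x byz ω t).sent.length := by
  induction t with
  | zero => intro k hk; simp [run_zero, initialConfig] at hk
  | succ t ih => exact A.perform_delivered_lt ω _ _ ih

theorem Decides.unique {x : H → Vec d} {byz : A.Attack H} {ω : A.Tapes H} {j : H} {v w : Vec d}
    (hv : A.Decides x byz ω j v) (hw : A.Decides x byz ω j w) : v = w := by
  obtain ⟨s, hs⟩ := hv
  obtain ⟨t, ht⟩ := hw
  have h1 := A.run_decided_mono x byz ω (le_max_left s t) hs
  have h2 := A.run_decided_mono x byz ω (le_max_right s t) ht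
  rw [h1] at h2
  exact Option.some.inj h2

theorem outputs_eq {x : H → Vec d} {byz : A.Attack H} {ω : A.Tapes H} {j : H} {v : Vec d}
    (hv : A.Decides x byz ω j v) : A.outputs x byz ω j = v := by
  have h : ∃ v, A.Decides x byz ω j v := ⟨v, hv⟩
  rw [outputs, dif_pos h]
  exact h.choose_spec.unique A hv

theorem mem_packets {j : Fin n} {l : List (Fin n × A.Msg)} {p : Packet n A.Msg} :
    p ∈ A.packets j l ↔ p.src = j ∧ (p.dst, p.msg) ∈ l := by
  obtain ⟨s, t, m⟩ := p
  simp only [packets, List.mem_map, Packet.mk.injEq, Prod.exists]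
  constructor
  · rintro ⟨a, b, h, rfl, rfl, rfl⟩; exact ⟨rfl, h⟩
  · rintro ⟨rfl, h⟩; exact ⟨t, m, h, rfl, rfl, rfl⟩

theorem mem_initial_sent {p : Packet n A.Msg} :
    p ∈ (A.initialConfig x ω).sent ↔
      ∃ h : p.src ∈ H, (p.dst, p.msg) ∈ (A.start x ω ⟨p.src, h⟩).2 := by
  simp only [initialConfig, List.mem_flatMap, List.mem_finRange, true_and]
  constructor
  · rintro ⟨j, hj⟩
    split_ifs at hj with h
    · obtain ⟨rfl, h2⟩ := A.mem_packets.mp hj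
      exact ⟨h, h2⟩
    · simp at hj
  · rintro ⟨h, hm⟩
    refine ⟨p.src, ?_⟩
    rw [dif_pos h]
    exact A.mem_packets.mpr ⟨rfl, hm⟩

end Protocol

end ByzAvg

/-! ### Safety of `RB-TM`: a local invariant kept by every rule. -/

namespace ByzAvg

namespace RBTM

variable {n d : ℕ}

/-- More than `(n + f) / 2` nodes vouch, by `auth`, for an echo of the given broadcast. -/
def EchoQuorum (f : ℕ) (auth : Fin n → Msg n d → Prop) (o : Fin n) (r : ℕ) (v : Vec d) : Prop :=
  n + f < 2 * {i | auth i (.echo o r v)}.ncard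

/-- At least `2 f + 1` nodes vouch, by `auth`, for a ready message of the given broadcast. -/
def ReadyQuorum (f : ℕ) (auth : Fin n → Msg n d → Prop) (o : Fin n) (r : ℕ) (v : Vec d) : Prop :=
  2 * f + 1 ≤ {i | auth i (.ready o r v)}.ncard

/-- The vector `v` is a trimmed mean of broadcast vectors of iteration `r`, taken after `n - f`
witnesses of the set of origins have reported. -/
def IsUpdate (f : ℕ) (auth : Fin n → Msg n d → Prop) (r : ℕ) (v : Vec d) : Prop :=
  ∃ (Q : Finset (Fin n)) (w : Fin n → Vec d), v = trimmedMean f Q w ∧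
    (∀ o ∈ Q, ReadyQuorum f auth o r (w o)) ∧
    n - f ≤ {i | ∃ S : Finset (Fin n), auth i (.report r S) ∧ n - f ≤ S.card ∧ S ⊆ Q}.ncard

/-- What holds at any time for the state `s` of an honest node with input `x` which has sent the set
`B` of messages to all nodes; `auth i m` holds if `i` is Byzantine or sends `m` at some time. -/
structure LocalInv (H : Finset (Fin n)) (f T : ℕ) (auth : Fin n → Msg n d → Prop) (x : Vec d)
    (s : State n d) (B : Set (Msg n d)) : Prop where
  received : ∀ i m, (i, m) ∈ s.received →
    auth i m ∧ (i ∈ H → ∀ o r v, m = .ready o r v → EchoQuorum f auth o r v)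
  echo_flag : ∀ o r v, .echo o r v ∈ B → (o, r) ∈ s.echoed
  echoed : ∀ o r, (o, r) ∈ s.echoed → ∃ v, .echo o r v ∈ B
  echo_unique : ∀ o r v v', .echo o r v ∈ B → .echo o r v' ∈ B → v = v'
  echo_auth : ∀ o r v, .echo o r v ∈ B → auth o (.initial r v)
  ready_quorum : ∀ o r v, .ready o r v ∈ B → EchoQuorum f auth o r v
  readied : ∀ o r, (o, r) ∈ s.readied → ∃ v, .ready o r v ∈ B
  collected : ∀ o r v, s.collected o r = some v → ReadyQuorum f auth o r v
  initial_le : ∀ r v, .initial r v ∈ B → r ≤ s.iter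
  initial_iter : ∀ v, .initial s.iter v ∈ B → v = s.vec
  initial_unique : ∀ r v v', .initial r v ∈ B → .initial r v' ∈ B → v = v'
  initial_mem : s.iter < T → .initial s.iter s.vec ∈ B
  report_flag : ∀ r S, .report r S ∈ B → r < s.iter ∨ r = s.iter ∧ s.reported
  report_unique : ∀ r S S', .report r S ∈ B → .report r S' ∈ B → S = S'
  report_card : ∀ r S, .report r S ∈ B → n - f ≤ S.card
  report_subset : ∀ r S, .report r S ∈ B → S ⊆ s.quorum r
  reported : ∀ r, r < s.iter ∨ r = s.iter ∧ s.reported → ∃ S, .report r S ∈ B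
  vec_zero : s.iter = 0 → s.vec = x
  vec_succ : ∀ r, s.iter = r + 1 → IsUpdate f auth r s.vec
  iter_le : s.iter ≤ T

/-- A rule keeps a property of the state and of the set of messages sent to all nodes. -/
def Rule.Keeps (R : Rule n d) (P : State n d → Set (Msg n d) → Prop) : Prop :=
  ∀ s B, P s B → P (R s).1 (B ∪ {m | m ∈ (R s).2})

theorem Rule.Keeps.andThen {R R' : Rule n d} {P : State n d → Set (Msg n d) → Prop}
    (h : R.Keeps P) (h' : R'.Keeps P) : (R.andThen R').Keeps P := by
  intro s B hs
  have := h' _ _ (h s B hs)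
  have e : B ∪ {m | m ∈ ((R.andThen R') s).2} =
      B ∪ {m | m ∈ (R s).2} ∪ {m | m ∈ (R' (R s).1).2} := by
    ext m; simp [Rule.andThen, or_assoc]
  rw [e]
  exact this

theorem Rule.keeps_nop (P : State n d → Set (Msg n d) → Prop) :
    Rule.Keeps (fun s => (s, [])) P := by
  intro s B hs; simpa using hs

theorem State.mem_quorum {s : State n d} {r : ℕ} {k : Fin n} :
    k ∈ s.quorum r ↔ ∃ v, s.collected k r = some v := by
  simp [State.quorum, Option.isSome_iff_exists]

section LocalInv

variable {H : Finset (Fin n)} {f T : ℕ} {auth : Fin n → Msg n d → Prop} {x : Vec d}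

theorem LocalInv.count_le {s : State n d} {B : Set (Msg n d)}
    (h : LocalInv H f T auth x s B) (m : Msg n d) : s.count m ≤ {i | auth i m}.ncard :=
  Set.ncard_le_ncard (fun i hi => (h.received i m hi).1) (Set.toFinite _)

/-- Only `f` nodes are Byzantine. All quorum arguments end with this pigeonhole. -/
theorem exists_mem_of_card_lt (hH : H.card + f = n) {K : Set (Fin n)} (hK : f < K.ncard) :
    ∃ i ∈ K, i ∈ H := by
  classical
  by_contra hcon
  push Not at hcon
  have h1 : K ⊆ ((Hᶜ : Finset (Fin n)) : Set (Fin n)) := fun i hi => by simpa using hcon i hi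
  have h2 := Set.ncard_le_ncard h1 (Set.toFinite _)
  rw [Set.ncard_coe_finset, Finset.card_compl, Fintype.card_fin] at h2
  omega

/-- Among `f + 1` senders of ready messages one is honest, and the invariant `received` already
provides an echo quorum behind its message. Amplification of ready messages thus never starts
without echoes. -/
theorem LocalInv.echoQuorum {s : State n d} {B : Set (Msg n d)} (hH : H.card + f = n)
    (h : LocalInv H f T auth x s B) {o : Fin n} {r : ℕ} {v : Vec d}
    (hc : n + f < 2 * s.count (.echo o r v) ∨ f + 1 ≤ s.count (.ready o r v)) :
    EchoQuorum f auth o r v := by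
  rcases hc with hc | hc
  · have := h.count_le (.echo o r v)
    unfold EchoQuorum
    omega
  · obtain ⟨i, hi, hiH⟩ := exists_mem_of_card_lt hH (Nat.lt_of_succ_le hc)
    exact (h.received i _ hi).2 hiH o r v rfl

theorem keeps_recordRule {src : Fin n} {m : Msg n d} (hm : auth src m)
    (hr : src ∈ H → ∀ o r v, m = .ready o r v → EchoQuorum f auth o r v) :
    (recordRule src m).Keeps (LocalInv H f T auth x) := by
  intro s B h
  simp only [recordRule, List.not_mem_nil, Set.ofPred_false, Set.union_empty]
  refine { h with received := ?_ }
  intro i m' hi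
  rcases Set.mem_insert_iff.mp hi with hi | hi
  · obtain ⟨rfl, rfl⟩ := Prod.mk.inj hi
    exact ⟨hm, hr⟩
  · exact h.received i m' hi

theorem keeps_echoRule {src : Fin n} {m : Msg n d} (hm : auth src m) :
    (echoRule src m).Keeps (LocalInv H f T auth x) := by
  intro s B h
  cases m with
  | initial r v =>
    simp only [echoRule]
    split_ifs with hs
    · simpa using h
    · have hB : B ∪ {m | m ∈ [Msg.echo src r v]} = insert (.echo src r v) B := by
        ext; simp [or_comm]
      simp only [hB]
      constructor
      case received => exact h.received
      case echo_flag =>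
        intro o r' v' hv
        rcases Set.mem_insert_iff.mp hv with hv | hv
        · cases hv; exact Set.mem_insert _ _
        · exact Set.mem_insert_of_mem _ (h.echo_flag _ _ _ hv)
      case echoed =>
        intro o r' hv
        rcases Set.mem_insert_iff.mp hv with hv | hv
        · cases hv; exact ⟨v, Set.mem_insert _ _⟩
        · obtain ⟨w, hw⟩ := h.echoed _ _ hv
          exact ⟨w, Set.mem_insert_of_mem _ hw⟩
      case echo_unique =>
        intro o r' v' v'' h1 h2
        rcases Set.mem_insert_iff.mp h1 with h1 | h1 <;>
          rcases Set.mem_insert_iff.mp h2 with h2 | h2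
        · cases h1; cases h2; rfl
        · cases h1; exact absurd (h.echo_flag _ _ _ h2) hs
        · cases h2; exact absurd (h.echo_flag _ _ _ h1) hs
        · exact h.echo_unique _ _ _ _ h1 h2
      case echo_auth =>
        intro o r' v' hv
        rcases Set.mem_insert_iff.mp hv with hv | hv
        · cases hv; exact hm
        · exact h.echo_auth _ _ _ hv
      case vec_zero => exact h.vec_zero
      case vec_succ => exact h.vec_succ
      case iter_le => exact h.iter_le
      all_goals simp only [Set.mem_insert_iff, reduceCtorEq, false_or]
      case ready_quorum => exact h.ready_quorum
      case readied => exact h.readied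
      case collected => exact h.collected
      case initial_le => exact h.initial_le
      case initial_iter => exact h.initial_iter
      case initial_unique => exact h.initial_unique
      case initial_mem => exact h.initial_mem
      case report_flag => exact h.report_flag
      case report_unique => exact h.report_unique
      case report_card => exact h.report_card
      case report_subset => exact h.report_subset
      case reported => exact h.reported
  | _ => simpa [echoRule] using h

theorem keeps_tryReady (hH : H.card + f = n) (o : Fin n) (r : ℕ) (v : Vec d) :
    (tryReady f o r v).Keeps (LocalInv H f T auth x) := by
  intro s B h
  simp only [tryReady]
  split_ifs with hs
  · have hB : B ∪ {m | m ∈ [Msg.ready o r v]} = insert (.ready o r v) B := by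
      ext; simp [or_comm]
    simp only [hB]
    constructor
    case received => exact h.received
    case ready_quorum =>
      intro o' r' v' hv
      rcases Set.mem_insert_iff.mp hv with hv | hv
      · cases hv; exact h.echoQuorum hH hs.2
      · exact h.ready_quorum _ _ _ hv
    case readied =>
      intro o' r' hv
      rcases Set.mem_insert_iff.mp hv with hv | hv
      · cases hv; exact ⟨v, Set.mem_insert _ _⟩
      · obtain ⟨w, hw⟩ := h.readied _ _ hv
        exact ⟨w, Set.mem_insert_of_mem _ hw⟩
    case vec_zero => exact h.vec_zero
    case vec_succ => exact h.vec_succ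
    case iter_le => exact h.iter_le
    all_goals simp only [Set.mem_insert_iff, reduceCtorEq, false_or]
    case echo_flag => exact h.echo_flag
    case echoed => exact h.echoed
    case echo_unique => exact h.echo_unique
    case echo_auth => exact h.echo_auth
    case collected => exact h.collected
    case initial_le => exact h.initial_le
    case initial_iter => exact h.initial_iter
    case initial_unique => exact h.initial_unique
    case initial_mem => exact h.initial_mem
    case report_flag => exact h.report_flag
    case report_unique => exact h.report_unique
    case report_card => exact h.report_card
    case report_subset => exact h.report_subset
    case reported => exact h.reported
  · simpa using h

theorem keeps_tryCollect (o : Fin n) (r : ℕ) (v : Vec d) :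
    (tryCollect f o r v).Keeps (LocalInv H f T auth x) := by
  intro s B h
  simp only [tryCollect]
  split_ifs with hs
  · simp only [List.not_mem_nil, Set.ofPred_false, Set.union_empty]
    refine { h with collected := ?_, report_subset := ?_ }
    · intro o' r' v' hv
      simp only at hv
      split_ifs at hv with heq
      · obtain ⟨rfl, rfl⟩ := heq
        cases hv
        exact hs.2.trans (h.count_le _)
      · exact h.collected _ _ _ hv
    · intro r' S hS k hk
      obtain ⟨w, hw⟩ := State.mem_quorum.mp (h.report_subset r' S hS hk)
      rw [State.mem_quorum]
      by_cases heq : k = o ∧ r' = r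
      · exact ⟨v, by simp [heq]⟩
      · exact ⟨w, by simp [heq, hw]⟩
  · simpa using h

theorem keeps_broadcastRule (hH : H.card + f = n) (m : Msg n d) :
    (broadcastRule f m).Keeps (LocalInv H f T auth x) := by
  cases m with
  | echo o r v => exact keeps_tryReady hH o r v
  | ready o r v => exact (keeps_tryReady hH o r v).andThen (keeps_tryCollect o r v)
  | initial => exact Rule.keeps_nop _
  | report => exact Rule.keeps_nop _

theorem keeps_reportRule : (reportRule f T).Keeps (LocalInv H f T auth x) := by
  intro s B h
  simp only [reportRule]
  split_ifs with hs
  · have hB : B ∪ {m | m ∈ [Msg.report s.iter (s.quorum s.iter)]} =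
        insert (.report s.iter (s.quorum s.iter)) B := by
      ext; simp [or_comm]
    simp only [hB]
    -- An earlier report for this iteration would have set the flag `reported`.
    have hnew : ∀ S, Msg.report s.iter S ∉ B := fun S hS => by
      rcases h.report_flag _ _ hS with h1 | h1
      · exact lt_irrefl _ h1
      · exact hs.2.1 h1.2
    constructor
    case received => exact h.received
    case vec_zero => exact h.vec_zero
    case vec_succ => exact h.vec_succ
    case iter_le => exact h.iter_le
    case collected => exact h.collected
    case report_flag =>
      intro r S hS
      rcases Set.mem_insert_iff.mp hS with hS | hS
      · cases hS; exact Or.inr ⟨rfl, trivial⟩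
      · exact (h.report_flag _ _ hS).imp_right fun h1 => ⟨h1.1, trivial⟩
    case report_unique =>
      intro r S S' h1 h2
      rcases Set.mem_insert_iff.mp h1 with h1 | h1 <;>
        rcases Set.mem_insert_iff.mp h2 with h2 | h2
      · cases h1; cases h2; rfl
      · cases h1; exact absurd h2 (hnew _)
      · cases h2; exact absurd h1 (hnew _)
      · exact h.report_unique _ _ _ h1 h2
    case report_card =>
      intro r S hS
      rcases Set.mem_insert_iff.mp hS with hS | hS
      · cases hS; exact hs.2.2
      · exact h.report_card _ _ hS
    case report_subset =>
      intro r S hS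
      rcases Set.mem_insert_iff.mp hS with hS | hS
      · cases hS; exact subset_rfl
      · exact h.report_subset _ _ hS
    case reported =>
      intro r hr
      rcases hr with hr | ⟨rfl, -⟩
      · obtain ⟨S, hS⟩ := h.reported r (Or.inl hr)
        exact ⟨S, Set.mem_insert_of_mem _ hS⟩
      · exact ⟨_, Set.mem_insert _ _⟩
    all_goals simp only [Set.mem_insert_iff, reduceCtorEq, false_or]
    case echo_flag => exact h.echo_flag
    case echoed => exact h.echoed
    case echo_unique => exact h.echo_unique
    case echo_auth => exact h.echo_auth
    case readied => exact h.readied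
    case ready_quorum => exact h.ready_quorum
    case initial_le => exact h.initial_le
    case initial_iter => exact h.initial_iter
    case initial_unique => exact h.initial_unique
    case initial_mem => exact h.initial_mem
  · simpa using h

/-- This translates what a node knows locally into facts about all messages ever sent, so that
updates of different nodes can be compared. -/
theorem LocalInv.isUpdate {s : State n d} {B : Set (Msg n d)} (h : LocalInv H f T auth x s B)
    (hw : n - f ≤ (s.witnesses f s.iter).ncard) : IsUpdate f auth s.iter (s.nextVec f) := by
  refine ⟨s.quorum s.iter, fun k => (s.collected k s.iter).getD 0, rfl, ?_, ?_⟩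
  · intro o ho
    obtain ⟨v, hv⟩ := State.mem_quorum.mp ho
    simpa only [hv, Option.getD_some] using h.collected _ _ _ hv
  · refine hw.trans (Set.ncard_le_ncard ?_ (Set.toFinite _))
    rintro i ⟨S, hS, h1, h2⟩
    exact ⟨S, (h.received _ _ hS).1, h1, h2⟩

theorem keeps_advanceRule : (advanceRule f T).Keeps (LocalInv H f T auth x) := by
  intro s B h
  simp only [advanceRule]
  split_ifs with hs hT
  · have hB : B ∪ {m | m ∈ [Msg.initial (s.iter + 1) (s.nextVec f)]} =
        insert (.initial (s.iter + 1) (s.nextVec f)) B := by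
      ext; simp [or_comm]
    simp only [hB]
    -- No node broadcasts for an iteration that it has not reached.
    have hnew : ∀ v, Msg.initial (s.iter + 1) v ∉ B := fun v hv => by
      have := h.initial_le _ _ hv
      omega
    constructor
    case received => exact h.received
    case collected => exact h.collected
    case vec_zero => intro h0; simp at h0
    case vec_succ =>
      intro r hr
      obtain rfl : s.iter = r := by simpa using hr
      exact h.isUpdate hs.2.2
    case iter_le => exact hT.le
    case initial_le =>
      intro r v hv
      rcases Set.mem_insert_iff.mp hv with hv | hv
      · cases hv; exact le_rfl
      · exact (h.initial_le _ _ hv).trans (Nat.le_succ _)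
    case initial_iter =>
      intro v hv
      rcases Set.mem_insert_iff.mp hv with hv | hv
      · cases hv; rfl
      · exact absurd hv (hnew v)
    case initial_unique =>
      intro r v v' h1 h2
      rcases Set.mem_insert_iff.mp h1 with h1 | h1 <;>
        rcases Set.mem_insert_iff.mp h2 with h2 | h2
      · cases h1; cases h2; rfl
      · cases h1; exact absurd h2 (hnew _)
      · cases h2; exact absurd h1 (hnew _)
      · exact h.initial_unique _ _ _ h1 h2
    case initial_mem => intro _; exact Set.mem_insert _ _
    all_goals simp only [Set.mem_insert_iff, reduceCtorEq, false_or]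
    case report_flag =>
      intro r S hS
      left
      rcases h.report_flag _ _ hS with h1 | h1
      · omega
      · omega
    case reported =>
      intro r hr
      apply h.reported r
      rcases hr with hr | hr
      · rcases Nat.lt_succ_iff_lt_or_eq.mp hr with hr | hr
        · exact Or.inl hr
        · exact Or.inr ⟨hr, hs.2.1⟩
      · exact hr.2.elim
    case echo_flag => exact h.echo_flag
    case echoed => exact h.echoed
    case echo_unique => exact h.echo_unique
    case echo_auth => exact h.echo_auth
    case readied => exact h.readied
    case ready_quorum => exact h.ready_quorum
    case report_unique => exact h.report_unique
    case report_card => exact h.report_card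
    case report_subset => exact h.report_subset
  · simp only [List.not_mem_nil, Set.ofPred_false, Set.union_empty]
    refine { h with
      initial_le := ?_, initial_iter := ?_, initial_mem := ?_, report_flag := ?_, reported := ?_
      vec_zero := ?_, vec_succ := ?_, iter_le := ?_ }
    · intro r v hv
      exact (h.initial_le _ _ hv).trans (Nat.le_succ _)
    · intro v hv
      have := h.initial_le _ _ hv
      simp at this
    · intro h1; exact absurd h1 hT
    · intro r S hS
      left
      rcases h.report_flag _ _ hS with h1 | h1
      · exact Nat.lt_succ_of_lt h1
      · exact Nat.lt_succ_of_le h1.1.le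
    · intro r hr
      apply h.reported r
      rcases hr with hr | hr
      · rcases Nat.lt_succ_iff_lt_or_eq.mp hr with hr | hr
        · exact Or.inl hr
        · exact Or.inr ⟨hr, hs.2.1⟩
      · exact hr.2.elim
    · intro h0; simp at h0
    · intro r hr
      obtain rfl : s.iter = r := by simpa using hr
      exact h.isUpdate hs.2.2
    · exact hs.1
  · simpa using h

theorem keeps_onReceive (hH : H.card + f = n) {src : Fin n} {m : Msg n d} (hm : auth src m)
    (hr : src ∈ H → ∀ o r v, m = .ready o r v → EchoQuorum f auth o r v) :
    (onReceive f T src m).Keeps (LocalInv H f T auth x) :=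
  (keeps_recordRule hm hr).andThen <| (keeps_echoRule hm).andThen <|
    (keeps_broadcastRule hH m).andThen <| keeps_reportRule.andThen keeps_advanceRule

theorem localInv_init : LocalInv H f T auth x ⟨∅, ∅, ∅, fun _ _ => none, 0, x, False⟩
    {.initial 0 x} := by
  constructor <;> simp
  rintro _ v v' - rfl - rfl
  rfl

end LocalInv

end RBTM

end ByzAvg

/-! ### Progress of a single node: states only grow, and every enabled rule is applied at the next
local step. -/

namespace ByzAvg

namespace RBTM

variable {n d : ℕ}

/-- The state `s'` can come later than the state `s`. -/
structure State.Le (s s' : State n d) : Prop where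
  received : s.received ⊆ s'.received
  echoed : s.echoed ⊆ s'.echoed
  readied : s.readied ⊆ s'.readied
  collected : ∀ o r v, s.collected o r = some v → s'.collected o r = some v
  iter : s.iter ≤ s'.iter
  vec : s.iter = s'.iter → s.vec = s'.vec ∧ (s.reported → s'.reported)

theorem State.Le.refl (s : State n d) : s.Le s :=
  ⟨subset_rfl, subset_rfl, subset_rfl, fun _ _ _ h => h, le_rfl, fun _ => ⟨rfl, id⟩⟩

theorem State.Le.trans {s s' s'' : State n d} (h : s.Le s') (h' : s'.Le s'') : s.Le s'' :=
  ⟨h.received.trans h'.received, h.echoed.trans h'.echoed, h.readied.trans h'.readied,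
    fun o r v hv => h'.collected o r v (h.collected o r v hv), h.iter.trans h'.iter,
    fun e => by
      have e1 : s.iter = s'.iter := le_antisymm h.iter (h'.iter.trans e.ge)
      have e2 : s'.iter = s''.iter := e1.symm.trans e
      exact ⟨(h.vec e1).1.trans (h'.vec e2).1, fun hr => (h'.vec e2).2 ((h.vec e1).2 hr)⟩⟩

theorem State.Le.quorum {s s' : State n d} (h : s.Le s') (r : ℕ) : s.quorum r ⊆ s'.quorum r := by
  intro k hk
  obtain ⟨v, hv⟩ := State.mem_quorum.mp hk
  exact State.mem_quorum.mpr ⟨v, h.collected _ _ _ hv⟩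

theorem State.Le.witnesses {s s' : State n d} (h : s.Le s') (f r : ℕ) :
    s.witnesses f r ⊆ s'.witnesses f r := by
  rintro k ⟨S, h1, h2, h3⟩
  exact ⟨S, h.received h1, h2, h3.trans (h.quorum r)⟩

/-- A rule leads to later states only. -/
def Rule.Advances (R : Rule n d) : Prop := ∀ s : State n d, s.Le (R s).1

theorem Rule.Advances.andThen {R R' : Rule n d} (h : R.Advances) (h' : R'.Advances) :
    (R.andThen R').Advances := fun s => (h s).trans (h' _)

theorem Rule.advances_nop : Rule.Advances (fun s : State n d => (s, [])) := fun s => .refl s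

theorem advances_recordRule (src : Fin n) (m : Msg n d) : (recordRule src m).Advances := fun s =>
  { State.Le.refl s with received := Set.subset_insert _ _ }

theorem advances_echoRule (src : Fin n) (m : Msg n d) : (echoRule src m).Advances := by
  intro s
  cases m with
  | initial r v =>
    simp only [echoRule]
    split_ifs
    · exact .refl s
    · exact { State.Le.refl s with echoed := Set.subset_insert _ _ }
  | _ => exact .refl s

theorem advances_tryReady (f : ℕ) (o : Fin n) (r : ℕ) (v : Vec d) :
    (tryReady f o r v).Advances := by
  intro s
  simp only [tryReady]
  split_ifs
  · exact { State.Le.refl s with readied := Set.subset_insert _ _ }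
  · exact .refl s

theorem advances_tryCollect (f : ℕ) (o : Fin n) (r : ℕ) (v : Vec d) :
    (tryCollect f o r v).Advances := by
  intro s
  simp only [tryCollect]
  split_ifs with hs
  · refine { State.Le.refl s with collected := ?_ }
    intro o' r' v' hv
    have : ¬ (o' = o ∧ r' = r) := by
      rintro ⟨rfl, rfl⟩
      rw [hs.1] at hv
      cases hv
    simp [this, hv]
  · exact .refl s

theorem advances_broadcastRule (f : ℕ) (m : Msg n d) : (broadcastRule f m).Advances := by
  cases m with
  | echo o r v => exact advances_tryReady f o r v
  | ready o r v => exact (advances_tryReady f o r v).andThen (advances_tryCollect f o r v)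
  | initial => exact Rule.advances_nop
  | report => exact Rule.advances_nop

theorem advances_reportRule (f T : ℕ) : (reportRule (n := n) (d := d) f T).Advances := by
  intro s
  simp only [reportRule]
  split_ifs
  · exact { State.Le.refl s with vec := fun _ => ⟨rfl, fun _ => trivial⟩ }
  · exact .refl s

theorem advances_advanceRule (f T : ℕ) : (advanceRule (n := n) (d := d) f T).Advances := by
  intro s
  simp only [advanceRule]
  split_ifs <;> first
    | exact .refl s
    | exact { State.Le.refl s with
        iter := Nat.le_succ _
        vec := fun h => absurd h (Nat.ne_of_lt (Nat.lt_succ_self _)) }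

theorem advances_onReceive (f T : ℕ) (src : Fin n) (m : Msg n d) :
    (onReceive f T src m).Advances :=
  (advances_recordRule src m).andThen <| (advances_echoRule src m).andThen <|
    (advances_broadcastRule f m).andThen <|
      (advances_reportRule f T).andThen (advances_advanceRule f T)

/-! ### Reliable broadcast reacts to all received messages -/

/-- The reliable broadcast has reacted to all received messages. -/
structure Reactive (f : ℕ) (s : State n d) : Prop where
  echoed : ∀ o r v, (o, .initial r v) ∈ s.received → (o, r) ∈ s.echoed
  readied : ∀ o r v, n + f < 2 * s.count (.echo o r v) ∨ f + 1 ≤ s.count (.ready o r v) →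
    (o, r) ∈ s.readied
  collected : ∀ o r v, 2 * f + 1 ≤ s.count (.ready o r v) → s.collected o r ≠ none

theorem count_recordRule_of_ne {src : Fin n} {m m' : Msg n d} (h : m' ≠ m) (s : State n d) :
    (recordRule src m s).1.count m' = s.count m' := by
  simp [State.count, recordRule, h]

theorem tryReady_fst (f : ℕ) (o : Fin n) (r : ℕ) (v : Vec d) (s : State n d) :
    (tryReady f o r v s).1.received = s.received ∧ (tryReady f o r v s).1.echoed = s.echoed ∧
    (tryReady f o r v s).1.collected = s.collected ∧
    (tryReady f o r v s).1.count = s.count ∧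
    (n + f < 2 * s.count (.echo o r v) ∨ f + 1 ≤ s.count (.ready o r v) →
      (o, r) ∈ (tryReady f o r v s).1.readied) := by
  simp only [tryReady]
  split_ifs with h
  · exact ⟨rfl, rfl, rfl, rfl, fun _ => Set.mem_insert _ _⟩
  · refine ⟨rfl, rfl, rfl, rfl, fun h1 => ?_⟩
    by_contra h2
    exact h ⟨h2, h1⟩

theorem tryCollect_fst (f : ℕ) (o : Fin n) (r : ℕ) (v : Vec d) (s : State n d) :
    (tryCollect f o r v s).1.received = s.received ∧ (tryCollect f o r v s).1.echoed = s.echoed ∧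
    (tryCollect f o r v s).1.readied = s.readied ∧
    (tryCollect f o r v s).1.count = s.count ∧
    (2 * f + 1 ≤ s.count (.ready o r v) → (tryCollect f o r v s).1.collected o r ≠ none) := by
  simp only [tryCollect]
  split_ifs with h
  · exact ⟨rfl, rfl, rfl, rfl, by simp⟩
  · refine ⟨rfl, rfl, rfl, rfl, fun h1 h2 => h ⟨h2, h1⟩⟩

theorem State.Le.collected_ne_none {s s' : State n d} (h : s.Le s') {o : Fin n} {r : ℕ}
    (hs : s.collected o r ≠ none) : s'.collected o r ≠ none := by
  obtain ⟨v, hv⟩ := Option.ne_none_iff_exists'.mp hs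
  rw [h.collected _ _ _ hv]
  exact Option.some_ne_none v

/-- Receiving `m` changes only the count of `m`, and the rules triggered by `m` test again exactly
the thresholds in which this count occurs. All other thresholds are inherited from `s`. -/
theorem reactive_broadcast {f : ℕ} {s : State n d} (h : Reactive f s) (src : Fin n)
    (m : Msg n d) :
    Reactive f
      (((recordRule src m).andThen ((echoRule src m).andThen (broadcastRule f m))) s).1 := by
  set s₁ := (recordRule src m s).1 with hs₁
  have hc : ∀ m', m' ≠ m → s₁.count m' = s.count m' := fun m' h' => count_recordRule_of_ne h' s
  have hrec : ∀ i m', m' ≠ m → (i, m') ∈ s₁.received → (i, m') ∈ s.received := by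
    intro i m' hm' hi
    rcases Set.mem_insert_iff.mp hi with hi | hi
    · exact absurd (Prod.mk.inj hi).2 hm'
    · exact hi
  cases m with
  | initial r v =>
    have h₁ : ∀ o r' v', (o, Msg.initial r' v') ∈ s₁.received → (o, r') ∈ s.echoed ∨
        (o, r') = (src, r) := by
      intro o r' v' hi
      rcases Set.mem_insert_iff.mp hi with hi | hi
      · right
        obtain ⟨rfl, h2⟩ := Prod.mk.inj hi
        cases h2; rfl
      · exact Or.inl (h.echoed _ _ _ hi)
    change Reactive f (echoRule src (.initial r v) s₁).1
    simp only [echoRule]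
    split_ifs with hs
    · refine ⟨?_, ?_, ?_⟩
      · intro o r' v' hi
        rcases h₁ _ _ _ hi with h2 | h2
        · exact h2
        · rw [h2]; exact hs
      · intro o r' v' h2
        rw [hc _ (by simp), hc _ (by simp)] at h2
        exact h.readied _ _ _ h2
      · intro o r' v' h2
        rw [hc _ (by simp)] at h2
        exact h.collected _ _ _ h2
    · refine ⟨?_, ?_, ?_⟩
      · intro o r' v' hi
        rcases h₁ _ _ _ hi with h2 | h2
        · exact Set.mem_insert_of_mem _ h2
        · rw [h2]; exact Set.mem_insert _ _
      · intro o r' v' h2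
        change n + f < 2 * s₁.count _ ∨ f + 1 ≤ s₁.count _ at h2
        rw [hc _ (by simp), hc _ (by simp)] at h2
        exact h.readied _ _ _ h2
      · intro o r' v' h2
        change 2 * f + 1 ≤ s₁.count _ at h2
        rw [hc _ (by simp)] at h2
        exact h.collected _ _ _ h2
  | echo o r v =>
    change Reactive f (tryReady f o r v s₁).1
    obtain ⟨e1, e2, e3, e4, e5⟩ := tryReady_fst f o r v s₁
    refine ⟨?_, ?_, ?_⟩
    · intro o' r' v' hi
      rw [e1] at hi
      rw [e2]
      exact h.echoed _ _ _ (hrec _ _ (by simp) hi)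
    · intro o' r' v' h2
      rw [e4] at h2
      -- Only the broadcast named by the message can have crossed a threshold now.
      by_cases heq : o' = o ∧ r' = r ∧ v' = v
      · obtain ⟨rfl, rfl, rfl⟩ := heq
        exact e5 h2
      · rw [hc _ (by simpa using heq), hc _ (by simp)] at h2
        exact (advances_tryReady f o r v s₁).readied (h.readied _ _ _ h2)
    · intro o' r' v' h2
      rw [e4, hc _ (by simp)] at h2
      rw [e3]
      exact h.collected _ _ _ h2
  | ready o r v =>
    change Reactive f (tryCollect f o r v (tryReady f o r v s₁).1).1
    obtain ⟨e1, e2, e3, e4, e5⟩ := tryReady_fst f o r v s₁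
    set s₂ := (tryReady f o r v s₁).1
    obtain ⟨g1, g2, g3, g4, g5⟩ := tryCollect_fst f o r v s₂
    refine ⟨?_, ?_, ?_⟩
    · intro o' r' v' hi
      rw [g1, e1] at hi
      rw [g2, e2]
      exact h.echoed _ _ _ (hrec _ _ (by simp) hi)
    · intro o' r' v' h2
      rw [g4, e4] at h2
      rw [g3]
      by_cases heq : o' = o ∧ r' = r ∧ v' = v
      · obtain ⟨rfl, rfl, rfl⟩ := heq
        exact e5 h2
      · rw [hc _ (by simp), hc (.ready _ _ _) (by simpa using heq)] at h2
        exact (advances_tryReady f o r v s₁).readied (h.readied _ _ _ h2)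
    · intro o' r' v' h2
      rw [g4] at h2
      by_cases heq : o' = o ∧ r' = r ∧ v' = v
      · obtain ⟨rfl, rfl, rfl⟩ := heq
        exact g5 h2
      · rw [e4, hc _ (by simpa using heq)] at h2
        refine (advances_tryCollect f o r v s₂).collected_ne_none ?_
        rw [e3]
        exact h.collected _ _ _ h2
  | report r S =>
    change Reactive f s₁
    refine ⟨?_, ?_, ?_⟩
    · intro o r' v' hi
      exact h.echoed _ _ _ (hrec _ _ (by simp) hi)
    · intro o r' v' h2
      rw [hc _ (by simp), hc _ (by simp)] at h2
      exact h.readied _ _ _ h2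
    · intro o r' v' h2
      rw [hc _ (by simp)] at h2
      exact h.collected _ _ _ h2

theorem Reactive.reportRule {f : ℕ} (T : ℕ) {s : State n d} (h : Reactive f s) :
    Reactive f (RBTM.reportRule f T s).1 := by
  simp only [RBTM.reportRule]
  split_ifs
  · exact ⟨h.echoed, h.readied, h.collected⟩
  · exact h

theorem Reactive.advanceRule {f : ℕ} (T : ℕ) {s : State n d} (h : Reactive f s) :
    Reactive f (RBTM.advanceRule f T s).1 := by
  simp only [RBTM.advanceRule]
  split_ifs <;> first | exact h | exact ⟨h.echoed, h.readied, h.collected⟩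

theorem Reactive.onReceive {f : ℕ} (T : ℕ) {s : State n d} (h : Reactive f s) (src : Fin n)
    (m : Msg n d) : Reactive f (onReceive f T src m s).1 :=
  ((reactive_broadcast h src m).reportRule T).advanceRule T

theorem reactive_init (f : ℕ) (x : Vec d) :
    Reactive f (⟨∅, ∅, ∅, fun _ _ => none, 0, x, False⟩ : State n d) := by
  constructor <;> simp [State.count]

/-! ### Reports and updates are made as soon as possible -/

/-- The node can report. -/
def State.CanReport (f T : ℕ) (s : State n d) : Prop :=
  s.iter < T ∧ ¬ s.reported ∧ n - f ≤ (s.quorum s.iter).card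

/-- The node can update its vector. -/
def State.CanAdvance (f T : ℕ) (s : State n d) : Prop :=
  s.iter < T ∧ s.reported ∧ n - f ≤ (s.witnesses f s.iter).ncard

theorem reportRule_of_can {f T : ℕ} {s : State n d} (h : s.CanReport f T) :
    reportRule f T s = ({ s with reported := True }, [.report s.iter (s.quorum s.iter)]) :=
  if_pos h

theorem reportRule_of_not {f T : ℕ} {s : State n d} (h : ¬ s.CanReport f T) :
    reportRule f T s = (s, []) := if_neg h

theorem advanceRule_of_can {f T : ℕ} {s : State n d} (h : s.CanAdvance f T) :
    advanceRule f T s = ({ s with iter := s.iter + 1, vec := s.nextVec f, reported := False },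
      if s.iter + 1 < T then [.initial (s.iter + 1) (s.nextVec f)] else []) := if_pos h

theorem advanceRule_of_not {f T : ℕ} {s : State n d} (h : ¬ s.CanAdvance f T) :
    advanceRule f T s = (s, []) := if_neg h

/-- The first part of the reaction to a message, before the report. -/
noncomputable def beforeReport (f : ℕ) (src : Fin n) (m : Msg n d) : Rule n d :=
  (recordRule src m).andThen ((echoRule src m).andThen (broadcastRule f m))

theorem onReceive_fst (f T : ℕ) (src : Fin n) (m : Msg n d) (s : State n d) :
    (onReceive f T src m s).1 =
      (advanceRule f T (reportRule f T (beforeReport f src m s).1).1).1 := rfl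

theorem onReceive_snd (f T : ℕ) (src : Fin n) (m : Msg n d) (s : State n d) (m' : Msg n d) :
    m' ∈ (onReceive f T src m s).2 ↔
      m' ∈ (beforeReport f src m s).2 ∨ m' ∈ (reportRule f T (beforeReport f src m s).1).2 ∨
      m' ∈ (advanceRule f T (reportRule f T (beforeReport f src m s).1).1).2 := by
  simp [onReceive, beforeReport, Rule.andThen, or_assoc]

theorem advances_beforeReport (f : ℕ) (src : Fin n) (m : Msg n d) :
    (beforeReport f src m).Advances :=
  (advances_recordRule src m).andThen <| (advances_echoRule src m).andThen <|
    advances_broadcastRule f m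

theorem beforeReport_frame (f : ℕ) (src : Fin n) (m : Msg n d) (s : State n d) :
    (beforeReport f src m s).1.iter = s.iter ∧
      (beforeReport f src m s).1.reported = s.reported := by
  cases m with
  | initial r v =>
    change (echoRule src (.initial r v) (recordRule src _ s).1).1.iter = _ ∧
      (echoRule src (.initial r v) (recordRule src _ s).1).1.reported = _
    simp only [echoRule]
    split_ifs <;> exact ⟨rfl, rfl⟩
  | echo o r v =>
    change (tryReady f o r v (recordRule src _ s).1).1.iter = _ ∧
      (tryReady f o r v (recordRule src _ s).1).1.reported = _
    simp only [tryReady]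
    split_ifs <;> exact ⟨rfl, rfl⟩
  | ready o r v =>
    change (tryCollect f o r v (tryReady f o r v (recordRule src _ s).1).1).1.iter = _ ∧
      (tryCollect f o r v (tryReady f o r v (recordRule src _ s).1).1).1.reported = _
    simp only [tryReady, tryCollect]
    split_ifs <;> exact ⟨rfl, rfl⟩
  | report r S => exact ⟨rfl, rfl⟩

theorem not_canReport_reportRule (f T : ℕ) (s : State n d) :
    ¬ (reportRule f T s).1.CanReport f T := by
  by_cases hs : s.CanReport f T
  · rw [reportRule_of_can hs]
    exact fun h' => h'.2.1 trivial
  · rw [reportRule_of_not hs]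
    exact hs

/-- If a node can act again right after a local step, then it has just begun an iteration. -/
theorem initial_of_can {f T : ℕ} {src : Fin n} {m : Msg n d} {s : State n d}
    (h : (onReceive f T src m s).1.CanReport f T ∨ (onReceive f T src m s).1.CanAdvance f T) :
    s.iter < (onReceive f T src m s).1.iter ∧
      ∃ v, .initial (onReceive f T src m s).1.iter v ∈ (onReceive f T src m s).2 := by
  rw [onReceive_fst] at h ⊢
  simp only [onReceive_snd]
  set s₁ := (reportRule f T (beforeReport f src m s).1).1 with hs₁
  by_cases hc : s₁.CanAdvance f T
  · rw [advanceRule_of_can hc] at h ⊢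
    have hT : s₁.iter + 1 < T := by
      rcases h with h | h <;> exact h.1
    have hle : s.iter ≤ s₁.iter :=
      ((advances_beforeReport f src m).andThen (advances_reportRule f T) s).iter
    refine ⟨Nat.lt_succ_of_le hle, s₁.nextVec f, ?_⟩
    right; right
    simp [hT]
  · rw [advanceRule_of_not hc] at h
    rcases h with h | h
    · exact absurd h (not_canReport_reportRule f T _)
    · exact absurd h hc

/-- The flag `reported` is cleared only when the iteration number increases, which is the first
alternative. -/
theorem onReceive_reports {f T : ℕ} (src : Fin n) (m : Msg n d) {s : State n d}
    (hT : s.iter < T) (hq : n - f ≤ (s.quorum s.iter).card) :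
    s.iter < (onReceive f T src m s).1.iter ∨
      s.iter = (onReceive f T src m s).1.iter ∧ (onReceive f T src m s).1.reported := by
  rw [onReceive_fst]
  obtain ⟨e1, e2⟩ := beforeReport_frame f src m s
  have hle := advances_beforeReport f src m s
  set s₀ := (beforeReport f src m s).1
  set s₁ := (reportRule f T s₀).1 with hs₁
  have h1 : s₁.iter = s.iter ∧ s₁.reported := by
    by_cases hc : s₀.CanReport f T
    · rw [hs₁, reportRule_of_can hc]; exact ⟨e1, trivial⟩
    · rw [hs₁, reportRule_of_not hc]
      refine ⟨e1, ?_⟩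
      by_contra hr
      refine hc ⟨by rw [e1]; exact hT, hr, ?_⟩
      rw [e1]
      exact hq.trans (Finset.card_le_card (hle.quorum _))
  have h2 := advances_advanceRule f T s₁
  rcases h2.iter.lt_or_eq with h3 | h3
  · left; omega
  · exact Or.inr ⟨h1.1.symm.trans h3, (h2.vec h3).2 h1.2⟩

/-- The first rules keep witnesses, iteration and flag, and the report rule is idle because the node
has reported. So `advanceRule` is still enabled when its turn comes. -/
theorem onReceive_advances {f T : ℕ} (src : Fin n) (m : Msg n d) {s : State n d}
    (hs : s.CanAdvance f T) : s.iter < (onReceive f T src m s).1.iter := by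
  rw [onReceive_fst]
  obtain ⟨e1, e2⟩ := beforeReport_frame f src m s
  have hle := advances_beforeReport f src m s
  set s₀ := (beforeReport f src m s).1
  have h0 : s₀.CanAdvance f T := by
    refine ⟨by rw [e1]; exact hs.1, by rw [e2]; exact hs.2.1, ?_⟩
    rw [e1]
    exact hs.2.2.trans (Set.ncard_le_ncard (hle.witnesses _ _) (Set.toFinite _))
  have hc : ¬ s₀.CanReport f T := fun h => h.2.1 h0.2.1
  rw [reportRule_of_not hc, advanceRule_of_can h0]
  change s.iter < s₀.iter + 1
  omega

/-- No iteration is skipped, so each has a time at which its vector can be observed. -/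
theorem onReceive_iter_le (f T : ℕ) (src : Fin n) (m : Msg n d) (s : State n d) :
    (onReceive f T src m s).1.iter ≤ s.iter + 1 := by
  rw [onReceive_fst]
  obtain ⟨e1, e2⟩ := beforeReport_frame f src m s
  set s₀ := (beforeReport f src m s).1
  have h1 : (reportRule f T s₀).1.iter = s.iter := by
    simp only [reportRule]
    split_ifs <;> exact e1
  set s₁ := (reportRule f T s₀).1
  simp only [advanceRule]
  split_ifs <;> simp [h1]

end RBTM

end ByzAvg

/-! ### Consistency and liveness in a fair execution. -/

namespace ByzAvg

/-- This allows the vectors collected by the individual nodes to be replaced by one common family.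
-/
theorem trimmedMean_congr {n d : ℕ} (f : ℕ) {Q : Finset (Fin n)} {w w' : Fin n → Vec d}
    (h : ∀ k ∈ Q, w k = w' k) : trimmedMean f Q w = trimmedMean f Q w' := by
  have hr : ∀ i : Fin d, ∀ k ∈ Q, rank Q (fun l => w l i) k = rank Q (fun l => w' l i) k := by
    intro i k hk
    unfold rank
    congr 1
    refine Finset.filter_congr fun l hl => ?_
    simp only [h l hl, h k hk]
  have ht : ∀ i : Fin d, trim f Q (fun l => w l i) = trim f Q (fun l => w' l i) := by
    intro i
    unfold trim
    refine Finset.filter_congr fun k hk => ?_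
    rw [hr i k hk]
  unfold trimmedMean
  congr 1
  funext i
  rw [ht i]
  congr 1
  refine Finset.sum_congr rfl fun k hk => ?_
  rw [h k (Finset.mem_filter.mp hk).1]

namespace RBTM

open Filter

variable {n d : ℕ} {H : Finset (Fin n)}

/-- At time `t` node `j` makes a local step on receipt of `m` from `src`. -/
structure Receives (f T : ℕ) (st : ℕ → H → State n d) (B : ℕ → H → Set (Msg n d)) (t : ℕ) (j : H)
    (src : Fin n) (m : Msg n d) : Prop where
  auth : ∀ h : src ∈ H, m ∈ B t ⟨src, h⟩
  state : st (t + 1) j = (onReceive f T src m (st t j)).1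
  sent : B (t + 1) j = B t j ∪ {m' | m' ∈ (onReceive f T src m (st t j)).2}

/-- A fair execution of the protocol: `st t j` is the state of the honest node `j` at time `t`, and
`B t j` is the set of messages that it has sent to all nodes. -/
structure Exec (H : Finset (Fin n)) (f T : ℕ) (x : H → Vec d) where
  st : ℕ → H → State n d
  B : ℕ → H → Set (Msg n d)
  st_zero : ∀ j, st 0 j = ⟨∅, ∅, ∅, fun _ _ => none, 0, x j, False⟩
  B_zero : ∀ j, B 0 j = {.initial 0 (x j)}
  step : ∀ t j, (st (t + 1) j = st t j ∧ B (t + 1) j = B t j) ∨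
    ∃ src m, Receives f T st B t j src m
  fair : ∀ t (i : H) m, m ∈ B t i → ∀ j, ∃ t', ((i : Fin n), m) ∈ (st t' j).received
  live : ∀ t (i j : H) m, m ∈ B (t + 1) i → m ∉ B t i →
    ∃ t' > t, Receives f T st B t' j i m

namespace Exec

variable {f T : ℕ} {x : H → Vec d} (E : Exec H f T x)

/-- `i` is Byzantine or sends `m` at some time. -/
def Auth (i : Fin n) (m : Msg n d) : Prop := ∀ h : i ∈ H, ∃ t, m ∈ E.B t ⟨i, h⟩

/-- The induction treats all nodes at once: a ready message received from an honest node is backed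
by an echo quorum because of the invariant of its sender. -/
theorem localInv (hH : H.card + f = n) (t : ℕ) :
    ∀ j, LocalInv H f T E.Auth (x j) (E.st t j) (E.B t j) := by
  induction t with
  | zero => intro j; rw [E.st_zero, E.B_zero]; exact localInv_init
  | succ t ih =>
    intro j
    rcases E.step t j with ⟨h1, h2⟩ | ⟨src, m, h⟩
    · rw [h1, h2]; exact ih j
    · rw [h.state, h.sent]
      refine keeps_onReceive hH (fun hs => ⟨t, h.auth hs⟩) ?_ _ _ (ih j)
      rintro hs o r v rfl
      exact (ih ⟨src, hs⟩).ready_quorum _ _ _ (h.auth hs)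

theorem reactive (t : ℕ) (j : H) : Reactive f (E.st t j) := by
  induction t with
  | zero => rw [E.st_zero]; exact reactive_init f _
  | succ t ih =>
    rcases E.step t j with ⟨h1, -⟩ | ⟨src, m, h⟩
    · rw [h1]; exact ih
    · rw [h.state]; exact ih.onReceive T src m

theorem st_mono {s t : ℕ} (hst : s ≤ t) (j : H) : (E.st s j).Le (E.st t j) := by
  induction t, hst using Nat.le_induction with
  | base => exact .refl _
  | succ t _ ih =>
    rcases E.step t j with ⟨h1, -⟩ | ⟨src, m, h⟩
    · rw [h1]; exact ih
    · rw [h.state]; exact ih.trans (advances_onReceive f T src m _)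

theorem B_mono {s t : ℕ} (hst : s ≤ t) (j : H) : E.B s j ⊆ E.B t j := by
  induction t, hst using Nat.le_induction with
  | base => exact subset_rfl
  | succ t _ ih =>
    rcases E.step t j with ⟨-, h1⟩ | ⟨src, m, h⟩
    · rw [h1]; exact ih
    · rw [h.sent]; exact ih.trans Set.subset_union_left

/-- The uniqueness clauses of `LocalInv` concern a single time. Sent messages accumulate, so any two
of them can be seen together. -/
theorem Auth.common {E : Exec H f T x} {i : Fin n} {m m' : Msg n d} (h : E.Auth i m)
    (h' : E.Auth i m') (hi : i ∈ H) : ∃ t, m ∈ E.B t ⟨i, hi⟩ ∧ m' ∈ E.B t ⟨i, hi⟩ := by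
  obtain ⟨s, hs⟩ := h hi
  obtain ⟨t, ht⟩ := h' hi
  exact ⟨max s t, E.B_mono (le_max_left _ _) _ hs, E.B_mono (le_max_right _ _) _ ht⟩

theorem exists_iter_eq {r t : ℕ} {j : H} (h : r ≤ (E.st t j).iter) :
    ∃ t', (E.st t' j).iter = r := by
  induction t with
  | zero =>
    rw [E.st_zero] at h
    exact ⟨0, by rw [E.st_zero]; exact (Nat.le_zero.mp h).symm⟩
  | succ t ih =>
    by_cases h' : r ≤ (E.st t j).iter
    · exact ih h'
    · refine ⟨t + 1, le_antisymm ?_ h⟩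
      rcases E.step t j with ⟨h1, -⟩ | ⟨src, m, h1⟩
      · rw [h1] at h; exact absurd h h'
      · rw [h1.state]
        have := onReceive_iter_le f T src m (E.st t j)
        omega

section Consistency

variable (hH : H.card + f = n)
include hH

/-- The two quorums have more than `n + f` members in all, so they share more than `f` nodes. One of
these is honest and has echoed only once. -/
theorem echoQuorum_unique {o : Fin n} {r : ℕ} {v v' : Vec d}
    (h : EchoQuorum f E.Auth o r v) (h' : EchoQuorum f E.Auth o r v') : v = v' := by
  unfold EchoQuorum at h h'
  have h1 := Set.ncard_union_add_ncard_inter {i | E.Auth i (.echo o r v)}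
    {i | E.Auth i (.echo o r v')} (Set.toFinite _) (Set.toFinite _)
  have h2 : ({i | E.Auth i (.echo o r v)} ∪ {i | E.Auth i (.echo o r v')}).ncard ≤ n := by
    refine (Set.ncard_le_ncard (Set.subset_univ _) (Set.toFinite _)).trans ?_
    rw [Set.ncard_univ, Nat.card_eq_fintype_card, Fintype.card_fin]
  obtain ⟨i, ⟨hi, hi'⟩, hiH⟩ := exists_mem_of_card_lt hH
    (K := {i | E.Auth i (.echo o r v)} ∩ {i | E.Auth i (.echo o r v')}) (by omega)
  obtain ⟨t, ht, ht'⟩ := Auth.common hi hi' hiH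
  exact (E.localInv hH t ⟨i, hiH⟩).echo_unique _ _ _ _ ht ht'

theorem echoQuorum_of_auth {i o : Fin n} (hi : i ∈ H) {r : ℕ} {v : Vec d}
    (h : E.Auth i (.ready o r v)) : EchoQuorum f E.Auth o r v := by
  obtain ⟨t, ht⟩ := h hi
  exact (E.localInv hH t ⟨i, hi⟩).ready_quorum _ _ _ ht

theorem echoQuorum_of_readyQuorum {o : Fin n} {r : ℕ} {v : Vec d}
    (h : ReadyQuorum f E.Auth o r v) : EchoQuorum f E.Auth o r v := by
  unfold ReadyQuorum at h
  obtain ⟨i, hi, hiH⟩ := exists_mem_of_card_lt hH (K := {i | E.Auth i (.ready o r v)}) (by omega)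
  exact E.echoQuorum_of_auth hH hiH hi

theorem readyQuorum_unique {o : Fin n} {r : ℕ} {v v' : Vec d}
    (h : ReadyQuorum f E.Auth o r v) (h' : ReadyQuorum f E.Auth o r v') : v = v' :=
  E.echoQuorum_unique hH (E.echoQuorum_of_readyQuorum hH h) (E.echoQuorum_of_readyQuorum hH h')

/-- A completed broadcast rests on an honest echo, and honest nodes echo only what came from the
origin itself. Hence no vector can be attributed falsely to an honest origin. -/
theorem auth_of_readyQuorum {o : Fin n} {r : ℕ} {v : Vec d}
    (h : ReadyQuorum f E.Auth o r v) : E.Auth o (.initial r v) := by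
  have h1 := E.echoQuorum_of_readyQuorum hH h
  unfold EchoQuorum at h1
  obtain ⟨i, hi, hiH⟩ := exists_mem_of_card_lt hH (K := {i | E.Auth i (.echo o r v)}) (by omega)
  obtain ⟨t, ht⟩ := hi hiH
  exact (E.localInv hH t ⟨i, hiH⟩).echo_auth _ _ _ ht

theorem initial_unique {i : H} {r : ℕ} {v v' : Vec d}
    (h : E.Auth i (.initial r v)) (h' : E.Auth i (.initial r v')) : v = v' := by
  obtain ⟨t, ht, ht'⟩ := Auth.common h h' i.2
  exact (E.localInv hH t i).initial_unique _ _ _ ht ht'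

theorem report_unique {i : Fin n} (hi : i ∈ H) {r : ℕ} {S S' : Finset (Fin n)}
    (h : E.Auth i (.report r S)) (h' : E.Auth i (.report r S')) : S = S' := by
  obtain ⟨t, ht, ht'⟩ := Auth.common h h' hi
  exact (E.localInv hH t ⟨i, hi⟩).report_unique _ _ _ ht ht'

end Consistency

section Liveness

theorem eventually_received {i : H} {m : Msg n d} (h : E.Auth i m) :
    ∀ᶠ t in atTop, ∀ j, ((i : Fin n), m) ∈ (E.st t j).received := by
  rw [eventually_all]
  intro j
  obtain ⟨t, ht⟩ := h i.2
  obtain ⟨t', ht'⟩ := E.fair t i m ht j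
  filter_upwards [eventually_ge_atTop t'] with s hs
  exact (E.st_mono hs j).received ht'

theorem eventually_count {K : Set (Fin n)} {m : Msg n d} (hK : ∀ i ∈ K, i ∈ H ∧ E.Auth i m) :
    ∀ᶠ t in atTop, ∀ j, K.ncard ≤ (E.st t j).count m := by
  have h : ∀ᶠ t in atTop, ∀ i : K, ∀ j, ((i : Fin n), m) ∈ (E.st t j).received := by
    rw [eventually_all]
    rintro ⟨i, hi⟩
    exact E.eventually_received (i := ⟨i, (hK i hi).1⟩) (hK i hi).2
  filter_upwards [h] with t ht j
  exact Set.ncard_le_ncard (fun i hi => ht ⟨i, hi⟩ j) (Set.toFinite _)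

theorem eventually_count_all (hH : H.card + f = n) {m : Msg n d} (h : ∀ i : H, E.Auth i m) :
    ∀ᶠ t in atTop, ∀ j, n - f ≤ (E.st t j).count m := by
  have := E.eventually_count (K := (H : Set (Fin n))) (m := m) fun i hi => ⟨hi, h ⟨i, hi⟩⟩
  rw [Set.ncard_coe_finset] at this
  have e : H.card = n - f := by omega
  rwa [e] at this

variable (hH : H.card + f = n) (hf : 3 * f < n)
include hH hf

/-- Each honest ready message has an echo quorum behind it, so all of them carry the same vector.
There are `n - f ≥ 2 f + 1` of them, enough for every node to collect. -/
theorem eventually_collected_of_readied {o : Fin n} {r : ℕ}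
    (h : ∀ j, ∃ t, (o, r) ∈ (E.st t j).readied) :
    ∀ᶠ t in atTop, ∀ j, (E.st t j).collected o r ≠ none := by
  have h1 : ∀ j : H, ∃ v, E.Auth j (.ready o r v) := by
    intro j
    obtain ⟨t, ht⟩ := h j
    obtain ⟨v, hv⟩ := (E.localInv hH t j).readied _ _ ht
    exact ⟨v, fun _ => ⟨t, hv⟩⟩
  by_cases hne : Nonempty H
  · obtain ⟨j₀⟩ := hne
    obtain ⟨v, hv⟩ := h1 j₀
    have h2 : ∀ j : H, E.Auth j (.ready o r v) := by
      intro j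
      obtain ⟨v', hv'⟩ := h1 j
      rwa [E.echoQuorum_unique hH (E.echoQuorum_of_auth hH j₀.2 hv)
        (E.echoQuorum_of_auth hH j.2 hv')]
    filter_upwards [E.eventually_count_all hH h2] with t ht j
    exact (E.reactive t j).collected _ _ v (by have := ht j; omega)
  · exact Eventually.of_forall fun t j => absurd ⟨j⟩ hne

/-- Totality of reliable broadcast. Of `2 f + 1` ready messages at least `f + 1` are honest and
reach everyone, which makes every honest node send one. -/
theorem eventually_collected_of_readyQuorum {o : Fin n} {r : ℕ} {v : Vec d}
    (h : ReadyQuorum f E.Auth o r v) :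
    ∀ᶠ t in atTop, ∀ j, (E.st t j).collected o r ≠ none := by
  apply E.eventually_collected_of_readied hH hf
  have h1 := E.eventually_count (K := {i | E.Auth i (.ready o r v)} ∩ H)
    (m := .ready o r v) fun i hi => ⟨hi.2, hi.1⟩
  have h2 : f + 1 ≤ ({i | E.Auth i (.ready o r v)} ∩ (H : Set (Fin n))).ncard := by
    have h3 := Set.ncard_inter_add_ncard_sdiff_eq_ncard {i | E.Auth i (.ready o r v)}
      (H : Set (Fin n)) (Set.toFinite _)
    have h4 : ({i | E.Auth i (.ready o r v)} \ (H : Set (Fin n))).ncard ≤ f := by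
      by_contra hcon
      obtain ⟨i, hi, hiH⟩ := exists_mem_of_card_lt hH (not_le.mp hcon)
      exact hi.2 hiH
    unfold ReadyQuorum at h
    omega
  obtain ⟨t, ht⟩ := h1.exists
  exact fun j => ⟨t, (E.reactive t j).readied _ _ v (Or.inr (h2.trans (ht j)))⟩

/-- Validity of reliable broadcast. All honest nodes echo `v`, since an honest origin sends nothing
else in this iteration, and `2 (n - f) > n + f` because `3 f < n`. -/
theorem eventually_collected_of_initial {i : H} {r : ℕ} {v : Vec d}
    (h : E.Auth i (.initial r v)) :
    ∀ᶠ t in atTop, ∀ j, (E.st t j).collected i r ≠ none := by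
  apply E.eventually_collected_of_readied hH hf
  obtain ⟨t, ht⟩ := (E.eventually_received h).exists
  have h1 : ∀ j : H, E.Auth j (.echo i r v) := by
    intro j
    obtain ⟨v', hv'⟩ := (E.localInv hH t j).echoed _ _ ((E.reactive t j).echoed _ _ _ (ht j))
    rw [E.initial_unique hH h ((E.localInv hH t j).echo_auth _ _ _ hv')]
    exact fun _ => ⟨t, hv'⟩
  obtain ⟨t', ht'⟩ := (E.eventually_count_all hH h1).exists
  exact fun j => ⟨t', (E.reactive t' j).readied _ _ v (Or.inl (by have := ht' j; omega))⟩

/-- A local step applies the report and update rules once, so a node may be able to act again right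
after it, and must then be woken up. In that case it has just begun an iteration, and its own
broadcast, addressed also to itself, is still to be delivered. -/
theorem exists_receives_of_can (t : ℕ) (j : H)
    (h : (E.st t j).CanReport f T ∨ (E.st t j).CanAdvance f T) :
    ∃ t' ≥ t, ∃ src m, Receives f T E.st E.B t' j src m := by
  induction t with
  | zero =>
    rw [E.st_zero] at h
    rcases h with h | h
    · have := h.2.2
      simp [State.quorum] at this
      omega
    · exact h.2.1.elim
  | succ t ih =>
    by_cases hr : ∃ src m, Receives f T E.st E.B t j src m
    · obtain ⟨src, m, hr⟩ := hr
      rw [hr.state] at h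
      obtain ⟨h1, v, hv⟩ := initial_of_can h
      obtain ⟨t', ht', h2⟩ := E.live t j j (.initial _ v)
        (by rw [hr.sent]; exact Or.inr hv)
        -- The broadcast is new at this step, as required by `live`, because its iteration number
        -- has only just been reached.
        (fun h3 => absurd ((E.localInv hH t j).initial_le _ _ h3) (not_le.mpr h1))
      exact ⟨t', ht', _, _, h2⟩
    · rcases E.step t j with ⟨h1, -⟩ | h1
      · rw [h1] at h
        obtain ⟨t', ht', src, m, h2⟩ := ih h
        refine ⟨t', ?_, src, m, h2⟩
        rcases ht'.lt_or_eq with h3 | h3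
        · exact h3
        · subst h3; exact absurd ⟨src, m, h2⟩ hr
      · exact absurd h1 hr

theorem exists_report {r : ℕ} (hr : r < T) {t : ℕ} {j : H} (ht : r ≤ (E.st t j).iter)
    (hq : n - f ≤ ((E.st t j).quorum r).card) :
    ∃ t', r < (E.st t' j).iter ∨ r = (E.st t' j).iter ∧ (E.st t' j).reported := by
  rcases ht.lt_or_eq with h1 | h1
  · exact ⟨t, Or.inl h1⟩
  by_cases h2 : (E.st t j).reported
  · exact ⟨t, Or.inr ⟨h1, h2⟩⟩
  obtain ⟨t', ht', src, m, h3⟩ := E.exists_receives_of_can hH hf t j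
    (Or.inl ⟨h1 ▸ hr, h2, h1 ▸ hq⟩)
  have hle := E.st_mono ht' j
  rcases (ht.trans hle.iter).lt_or_eq with h4 | h4
  · exact ⟨t', Or.inl h4⟩
  · refine ⟨t' + 1, ?_⟩
    rw [h3.state]
    have := onReceive_reports (f := f) (T := T) src m (s := E.st t' j) (h4 ▸ hr)
      (by rw [← h4]; exact hq.trans (Finset.card_le_card (hle.quorum r)))
    rwa [← h4] at this

theorem exists_advance {r : ℕ} (hr : r < T) {t : ℕ} {j : H}
    (ht : r < (E.st t j).iter ∨ r = (E.st t j).iter ∧ (E.st t j).reported)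
    (hw : n - f ≤ ((E.st t j).witnesses f r).ncard) : ∃ t', r < (E.st t' j).iter := by
  rcases ht with h1 | ⟨h1, h2⟩
  · exact ⟨t, h1⟩
  obtain ⟨t', ht', src, m, h3⟩ := E.exists_receives_of_can hH hf t j
    (Or.inr ⟨h1 ▸ hr, h2, h1 ▸ hw⟩)
  have hle := E.st_mono ht' j
  rcases (h1.le.trans hle.iter).lt_or_eq with h4 | h4
  · exact ⟨t', h4⟩
  · refine ⟨t' + 1, ?_⟩
    rw [h3.state]
    have := onReceive_advances (f := f) (T := T) src m (s := E.st t' j)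
      ⟨h4 ▸ hr, (hle.vec (h1.symm.trans h4)).2 h2, by
        rw [← h4]; exact hw.trans (Set.ncard_le_ncard (hle.witnesses f r) (Set.toFinite _))⟩
    omega

/-- If all honest nodes reach iteration `r`, validity lets everyone collect all honest vectors and
report. By totality every reported vector is collected everywhere, so all honest nodes become
witnesses for all, and there are `n - f` of them. -/
theorem exists_iter_ge {r : ℕ} (hr : r ≤ T) : ∀ j, ∃ t, r ≤ (E.st t j).iter := by
  induction r with
  | zero => exact fun j => ⟨0, Nat.zero_le _⟩
  | succ r ih =>
    have hrT : r < T := hr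
    have ih := ih hrT.le
    have h1 : ∀ᶠ t in atTop, ∀ i j : H, (E.st t j).collected i r ≠ none := by
      rw [eventually_all]
      intro i
      obtain ⟨t, ht⟩ := ih i
      obtain ⟨t', ht'⟩ := E.exists_iter_eq ht
      have h2 := (E.localInv hH t' i).initial_mem (by omega)
      rw [ht'] at h2
      exact E.eventually_collected_of_initial hH hf (fun _ => ⟨t', h2⟩)
    have h2 : ∀ j : H, ∃ t, r < (E.st t j).iter ∨ r = (E.st t j).iter ∧ (E.st t j).reported := by
      intro j
      obtain ⟨t, ht⟩ := ih j
      obtain ⟨t', ht', ht''⟩ := (h1.and (eventually_ge_atTop t)).exists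
      refine E.exists_report hH hf hrT (ht.trans (E.st_mono ht'' j).iter) ?_
      have h3 : H ⊆ (E.st t' j).quorum r := fun i hi => by
        rw [State.mem_quorum, ← Option.ne_none_iff_exists']
        exact ht' ⟨i, hi⟩ j
      have := Finset.card_le_card h3
      omega
    have h3 : ∀ᶠ t in atTop, ∀ i j : H, (i : Fin n) ∈ (E.st t j).witnesses f r := by
      rw [eventually_all]
      intro i
      obtain ⟨t, ht⟩ := h2 i
      obtain ⟨S, hS⟩ := (E.localInv hH t i).reported _ ht
      have h4 : ∀ᶠ s in atTop, ∀ k : S, ∀ j, (E.st s j).collected k r ≠ none := by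
        rw [eventually_all]
        rintro ⟨k, hk⟩
        obtain ⟨v, hv⟩ := State.mem_quorum.mp ((E.localInv hH t i).report_subset _ _ hS hk)
        exact E.eventually_collected_of_readyQuorum hH hf
          ((E.localInv hH t i).collected _ _ _ hv)
      filter_upwards [h4, E.eventually_received (i := i) (m := .report r S) fun _ => ⟨t, hS⟩]
        with s hs hs' j
      refine ⟨S, hs' j, (E.localInv hH t i).report_card _ _ hS, fun k hk => ?_⟩
      rw [State.mem_quorum, ← Option.ne_none_iff_exists']
      exact hs ⟨k, hk⟩ j
    intro j
    obtain ⟨t, ht⟩ := h2 j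
    obtain ⟨t', ht', ht''⟩ := (h3.and (eventually_ge_atTop t)).exists
    have hle := E.st_mono ht'' j
    refine E.exists_advance hH hf hrT (t := t') ?_ ?_
    · rcases ht with h4 | ⟨h4, h5⟩
      · exact Or.inl (h4.trans_le hle.iter)
      · rcases (h4.le.trans hle.iter).lt_or_eq with h6 | h6
        · exact Or.inl h6
        · exact Or.inr ⟨h6, (hle.vec (h4.symm.trans h6)).2 h5⟩
    · have h4 : (H : Set (Fin n)) ⊆ (E.st t' j).witnesses f r := fun i hi => ht' ⟨i, hi⟩ j
      have := Set.ncard_le_ncard h4 (Set.toFinite _)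
      rw [Set.ncard_coe_finset] at this
      omega

/-- The vectors of the honest nodes in the successive iterations. -/
theorem exists_trajectory : ∃ X : ℕ → H → Vec d, X 0 = x ∧
    (∀ r < T, ∃ (w : Fin n → Vec d) (Q : H → Finset (Fin n)), (∀ k : H, w k = X r k) ∧
      (∀ j, X (r + 1) j = trimmedMean f (Q j) w) ∧ ∀ j k, n - f ≤ (Q j ∩ Q k).card) ∧
    ∀ j, ∃ t, (E.st t j).iter = T ∧ (E.st t j).vec = X T j := by
  classical
  have h1 : ∀ r j, ∃ t, r ≤ T → (E.st t j).iter = r := by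
    intro r j
    by_cases hr : r ≤ T
    · obtain ⟨t, ht⟩ := E.exists_iter_ge hH hf hr j
      obtain ⟨t', ht'⟩ := E.exists_iter_eq ht
      exact ⟨t', fun _ => ht'⟩
    · exact ⟨0, fun h => absurd h hr⟩
  choose τ hτ using h1
  refine ⟨fun r j => (E.st (τ r j) j).vec, ?_, ?_, ?_⟩
  · funext j
    exact (E.localInv hH _ j).vec_zero (hτ 0 j (Nat.zero_le _))
  · intro r hr
    have h2 : ∀ j, IsUpdate f E.Auth r (E.st (τ (r + 1) j) j).vec := fun j =>
      (E.localInv hH _ j).vec_succ r (hτ (r + 1) j hr)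
    choose Q w' hv hQ hw using h2
    -- The common family. If the broadcast of an honest node never gathers a ready quorum, `w` falls
    -- back on its actual vector, so that `w` agrees with `X r` on all of `H`. The value `0` is
    -- never used in an update.
    let w : Fin n → Vec d := fun o =>
      if h : ∃ v, ReadyQuorum f E.Auth o r v then h.choose
      else if h : o ∈ H then (E.st (τ r ⟨o, h⟩) ⟨o, h⟩).vec else 0
    refine ⟨w, Q, ?_, ?_, ?_⟩
    · intro k
      by_cases h : ∃ v, ReadyQuorum f E.Auth k r v
      · simp only [w, dif_pos h]
        refine E.initial_unique hH (i := k) (r := r) (E.auth_of_readyQuorum hH h.choose_spec)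
          fun _ => ⟨τ r k, ?_⟩
        have h3 := (E.localInv hH (τ r k) k).initial_mem (by rw [hτ r k hr.le]; exact hr)
        rwa [hτ r k hr.le] at h3
      · simp only [w, dif_neg h, dif_pos k.2]
    · intro j
      change (E.st (τ (r + 1) j) j).vec = _
      rw [hv j]
      refine trimmedMean_congr f fun o ho => ?_
      have h : ∃ v, ReadyQuorum f E.Auth o r v := ⟨_, hQ j o ho⟩
      simp only [w, dif_pos h]
      exact E.readyQuorum_unique hH (hQ j o ho) h.choose_spec
    · intro j k
      have h3 := Set.ncard_union_add_ncard_inter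
        {i | ∃ S : Finset (Fin n), E.Auth i (.report r S) ∧ n - f ≤ S.card ∧ S ⊆ Q j}
        {i | ∃ S : Finset (Fin n), E.Auth i (.report r S) ∧ n - f ≤ S.card ∧ S ⊆ Q k}
        (Set.toFinite _) (Set.toFinite _)
      have h4 := Set.ncard_le_ncard (Set.subset_univ
        ({i | ∃ S : Finset (Fin n), E.Auth i (.report r S) ∧ n - f ≤ S.card ∧ S ⊆ Q j} ∪
        {i | ∃ S : Finset (Fin n), E.Auth i (.report r S) ∧ n - f ≤ S.card ∧ S ⊆ Q k}))
        (Set.toFinite _)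
      rw [Set.ncard_univ, Nat.card_eq_fintype_card, Fintype.card_fin] at h4
      have h5 := hw j
      have h6 := hw k
      -- Two sets of `n - f` witnesses share at least `n - 2 f > f` nodes. An honest one among them
      -- made a single report, contained in both `Q j` and `Q k`.
      obtain ⟨i, ⟨⟨S, hS, hc, hSj⟩, ⟨S', hS', -, hSk⟩⟩, hi⟩ := exists_mem_of_card_lt hH (K :=
        {i | ∃ S : Finset (Fin n), E.Auth i (.report r S) ∧ n - f ≤ S.card ∧ S ⊆ Q j} ∩
        {i | ∃ S : Finset (Fin n), E.Auth i (.report r S) ∧ n - f ≤ S.card ∧ S ⊆ Q k}) (by omega)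
      obtain rfl := E.report_unique hH hi hS hS'
      exact hc.trans (Finset.card_le_card (Finset.subset_inter hSj hSk))
  · intro j
    exact ⟨τ T j, hτ T j le_rfl, rfl⟩

end Liveness

end Exec

end RBTM

end ByzAvg

/-! ### Fair runs of the protocol as executions. -/

namespace ByzAvg

namespace RBTM

variable {n d : ℕ} {H : Finset (Fin n)} {f T : ℕ}

theorem mem_received_onReceive (src : Fin n) (m : Msg n d) (s : State n d) :
    (src, m) ∈ (onReceive f T src m s).1.received := by
  have h : (((echoRule src m).andThen <| (broadcastRule f m).andThen <|
      (reportRule f T).andThen (advanceRule f T))).Advances :=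
    (advances_echoRule src m).andThen <| (advances_broadcastRule f m).andThen <|
      (advances_reportRule f T).andThen (advances_advanceRule f T)
  exact (h (recordRule src m s).1).received (Set.mem_insert _ _)

theorem mem_toAll {l : List (Msg n d)} {k : Fin n} {m : Msg n d} :
    (k, m) ∈ toAll l ↔ m ∈ l := by
  simp [toAll]

variable (x : H → Vec d) (byz : (protocol n f d T).Attack H) (ω : (protocol n f d T).Tapes H)

/-- The state of node `j` at time `t`. -/
noncomputable def stateAt (t : ℕ) (j : H) : State n d :=
  (((protocol n f d T).run x byz ω t).loc j).state

/-- The messages that node `j` has sent until time `t`. -/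
def sentBy (t : ℕ) (j : H) : Set (Msg n d) :=
  {m | ∃ k, (⟨j, k, m⟩ : Packet n (Msg n d)) ∈ ((protocol n f d T).run x byz ω t).sent}

theorem mem_receive_sent (c : (protocol n f d T).Config H) (j : H) (src : Fin n) (m : Msg n d)
    (p : Packet n (Msg n d)) : p ∈ ((protocol n f d T).receive ω c j src m).sent ↔
      p ∈ c.sent ∨ p.src = j ∧ p.msg ∈ (onReceive f T src m (c.loc j).state).2 := by
  have h := (protocol n f d T).mem_packets (j := (j : Fin n))
    (l := toAll (onReceive f T src m (c.loc j).state).2) (p := p)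
  have h2 := mem_toAll (l := (onReceive f T src m (c.loc j).state).2) (k := p.dst) (m := p.msg)
  exact List.mem_append.trans (or_congr_right (h.trans (and_congr_right fun _ => h2)))

theorem receive_state_self (c : (protocol n f d T).Config H) (j : H) (src : Fin n)
    (m : Msg n d) : (((protocol n f d T).receive ω c j src m).loc j).state =
      (onReceive f T src m (c.loc j).state).1 :=
  congrArg Protocol.Local.state ((protocol n f d T).receive_loc_self ω c j src m)

theorem receive_decided_self (c : (protocol n f d T).Config H) (j : H) (src : Fin n)
    (m : Msg n d) : (((protocol n f d T).receive ω c j src m).loc j).decided =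
      ((c.loc j).decided <|>
        (protocol n f d T).output (onReceive f T src m (c.loc j).state).1) :=
  congrArg Protocol.Local.decided ((protocol n f d T).receive_loc_self ω c j src m)

theorem receive_loc_of_ne (c : (protocol n f d T).Config H) {i j : H} (h : i ≠ j) (src : Fin n)
    (m : Msg n d) : ((protocol n f d T).receive ω c j src m).loc i = c.loc i :=
  (protocol n f d T).receive_loc_of_ne ω c h src m

theorem receives_of_receive {t : ℕ} {j : H} {src : Fin n} {m : Msg n d}
    (hs : ∀ h : src ∈ H, m ∈ sentBy x byz ω t ⟨src, h⟩)
    (hl : ((protocol n f d T).run x byz ω (t + 1)).loc =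
      ((protocol n f d T).receive ω ((protocol n f d T).run x byz ω t) j src m).loc)
    (hp : ((protocol n f d T).run x byz ω (t + 1)).sent =
      ((protocol n f d T).receive ω ((protocol n f d T).run x byz ω t) j src m).sent) :
    Receives f T (stateAt x byz ω) (sentBy x byz ω) t j src m ∧
    ∀ i, i ≠ j → stateAt x byz ω (t + 1) i = stateAt x byz ω t i ∧
      sentBy x byz ω (t + 1) i = sentBy x byz ω t i := by
  refine ⟨⟨hs, ?_, ?_⟩, ?_⟩
  · unfold stateAt
    rw [hl, receive_state_self]
  · ext m'
    simp only [sentBy, Set.mem_ofPred_eq, Set.mem_union, hp, mem_receive_sent, true_and]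
    constructor
    · rintro ⟨k, h | h⟩
      · exact Or.inl ⟨k, h⟩
      · exact Or.inr h
    · rintro (⟨k, h⟩ | h)
      · exact ⟨k, Or.inl h⟩
      · exact ⟨j, Or.inr h⟩
  · intro i hi
    constructor
    · unfold stateAt
      rw [hl, receive_loc_of_ne ω _ hi]
    · ext m'
      have hi' : (i : Fin n) ≠ j := fun h => hi (Subtype.ext h)
      simp only [sentBy, Set.mem_ofPred_eq, hp, mem_receive_sent, hi', false_and, or_false]

theorem mem_sentBy_of_mem {t : ℕ} {p : Packet n (Msg n d)}
    (hp : p ∈ ((protocol n f d T).run x byz ω t).sent) (h : p.src ∈ H) :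
    p.msg ∈ sentBy x byz ω t ⟨p.src, h⟩ := ⟨p.dst, hp⟩

theorem step_receives (t : ℕ) (j : H) :
    (stateAt x byz ω (t + 1) j = stateAt x byz ω t j ∧
      sentBy x byz ω (t + 1) j = sentBy x byz ω t j) ∨
    ∃ src m, Receives f T (stateAt x byz ω) (sentBy x byz ω) t j src m := by
  rcases (protocol n f d T).perform_cases ω ((protocol n f d T).run x byz ω t)
    ((protocol n f d T).actionAt x byz ω t) with h | ⟨i, src, m, hs, h⟩ | ⟨k, p, hd, hp, -, -, h⟩
  · left
    unfold stateAt sentBy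
    rw [Protocol.run_succ, h]
    exact ⟨rfl, rfl⟩
  · have h1 := receives_of_receive x byz ω (t := t) (j := i) (src := src) (m := m)
      (fun h => absurd h hs) (by rw [Protocol.run_succ, h]) (by rw [Protocol.run_succ, h])
    by_cases hj : j = i
    · subst hj; exact Or.inr ⟨src, m, h1.1⟩
    · exact Or.inl (h1.2 j hj)
  · have h1 := receives_of_receive x byz ω (t := t) (j := ⟨p.dst, hd⟩) (src := p.src) (m := p.msg)
      (fun h => mem_sentBy_of_mem x byz ω (List.mem_of_getElem? hp) h)
      (by rw [Protocol.run_succ, h]) (by rw [Protocol.run_succ, h])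
    by_cases hj : j = ⟨p.dst, hd⟩
    · subst hj; exact Or.inr ⟨p.src, p.msg, h1.1⟩
    · exact Or.inl (h1.2 j hj)

/-- `Fair` speaks of positions marked as delivered. This recovers the local step at which the mark
was set. -/
theorem exists_receives_of_delivered {k t : ℕ}
    (hk : k ∈ ((protocol n f d T).run x byz ω t).delivered) :
    ∃ (s : ℕ) (p : Packet n (Msg n d)) (hd : p.dst ∈ H),
      ((protocol n f d T).run x byz ω s).sent[k]? = some p ∧
      Receives f T (stateAt x byz ω) (sentBy x byz ω) s ⟨p.dst, hd⟩ p.src p.msg := by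
  induction t with
  | zero => simp [Protocol.run_zero, Protocol.initialConfig] at hk
  | succ t ih =>
    by_cases hk' : k ∈ ((protocol n f d T).run x byz ω t).delivered
    · exact ih hk'
    rcases (protocol n f d T).perform_cases ω ((protocol n f d T).run x byz ω t)
      ((protocol n f d T).actionAt x byz ω t) with
      h | ⟨i, src, m, hs, h⟩ | ⟨k₁, p, hd, hp, -, -, h⟩
    · rw [Protocol.run_succ, h] at hk; exact absurd hk hk'
    · rw [Protocol.run_succ, h] at hk; exact absurd hk hk'
    · have hk₁ := hk
      rw [Protocol.run_succ, h] at hk₁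
      rcases Finset.mem_insert.mp hk₁ with rfl | hk₁
      · refine ⟨t, p, hd, hp, ?_⟩
        exact (receives_of_receive x byz ω (t := t) (j := ⟨p.dst, hd⟩) (src := p.src) (m := p.msg)
          (fun h => mem_sentBy_of_mem x byz ω (List.mem_of_getElem? hp) h)
          (by rw [Protocol.run_succ, h]) (by rw [Protocol.run_succ, h])).1
      · exact absurd hk₁ hk'

theorem mem_initial_sent_iff (p : Packet n (Msg n d)) :
    p ∈ ((protocol n f d T).initialConfig x ω).sent ↔
      ∃ h : p.src ∈ H, p.msg = .initial 0 (x ⟨p.src, h⟩) := by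
  refine ((protocol n f d T).mem_initial_sent x ω (p := p)).trans (exists_congr fun h => ?_)
  exact mem_toAll.trans List.mem_singleton

theorem sentBy_zero (j : H) : sentBy x byz ω 0 j = {.initial 0 (x j)} := by
  ext m
  simp only [sentBy, Protocol.run_zero, Set.mem_ofPred_eq, Set.mem_singleton_iff]
  constructor
  · rintro ⟨k, hk⟩
    exact ((mem_initial_sent_iff x ω _).mp hk).2
  · rintro rfl
    exact ⟨j, (mem_initial_sent_iff x ω _).mpr ⟨j.2, rfl⟩⟩

/-- Packets are created only in batches addressed to all nodes, so a packet with one destination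
implies those with the others. -/
theorem sent_to_all {t : ℕ} {j : H} {m : Msg n d} (h : m ∈ sentBy x byz ω t j) (k : Fin n) :
    (⟨j, k, m⟩ : Packet n (Msg n d)) ∈ ((protocol n f d T).run x byz ω t).sent := by
  induction t with
  | zero =>
    rw [sentBy_zero] at h
    obtain rfl := h
    exact (mem_initial_sent_iff x ω _).mpr ⟨j.2, rfl⟩
  | succ t ih =>
    obtain ⟨k', hk'⟩ := h
    have aux : ∀ (i : H) (src : Fin n) (m' : Msg n d),
        (⟨j, k', m⟩ : Packet n (Msg n d)) ∈ ((protocol n f d T).receive ω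
          ((protocol n f d T).run x byz ω t) i src m').sent →
        (⟨j, k, m⟩ : Packet n (Msg n d)) ∈ ((protocol n f d T).receive ω
          ((protocol n f d T).run x byz ω t) i src m').sent := by
      intro i src m' h1
      rw [mem_receive_sent] at h1 ⊢
      exact h1.imp_left fun h2 => ih ⟨k', h2⟩
    rw [Protocol.run_succ] at hk' ⊢
    rcases (protocol n f d T).perform_cases ω ((protocol n f d T).run x byz ω t)
      ((protocol n f d T).actionAt x byz ω t) with
      h | ⟨i, src, m', hs, h⟩ | ⟨k₁, p, hd, hp, -, -, h⟩ <;> rw [h] at hk' ⊢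
    · exact ih ⟨k', hk'⟩
    · exact aux _ _ _ hk'
    · exact aux _ _ _ hk'

/-- A fair run of the protocol as an execution. -/
noncomputable def execOfFair (hfair : (protocol n f d T).Fair x byz ω) : Exec H f T x where
  st := stateAt x byz ω
  B := sentBy x byz ω
  st_zero _ := rfl
  B_zero := sentBy_zero x byz ω
  step := step_receives x byz ω
  fair t i m hm j := by
    obtain ⟨k, hk⟩ := List.mem_iff_getElem?.mp (sent_to_all x byz ω hm j)
    obtain ⟨t', ht'⟩ := hfair t k _ hk j.2
    obtain ⟨s, p, hd, hp, hr⟩ := exists_receives_of_delivered x byz ω ht'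
    have h1 := (protocol n f d T).run_sent_getElem? x byz ω (le_max_left s t) hp
    have h2 := (protocol n f d T).run_sent_getElem? x byz ω (le_max_right s t) hk
    obtain rfl := Option.some.inj (h1.symm.trans h2)
    refine ⟨s + 1, ?_⟩
    have h3 := hr.state
    change stateAt x byz ω (s + 1) j = _ at h3
    rw [h3]
    exact mem_received_onReceive _ _ _
  live t i j m hm hm' := by
    obtain ⟨k, hk⟩ := List.mem_iff_getElem?.mp (sent_to_all x byz ω hm j)
    obtain ⟨t', ht'⟩ := hfair (t + 1) k _ hk j.2
    obtain ⟨s, p, hd, hp, hr⟩ := exists_receives_of_delivered x byz ω ht'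
    have h1 := (protocol n f d T).run_sent_getElem? x byz ω (le_max_left s (t + 1)) hp
    have h2 := (protocol n f d T).run_sent_getElem? x byz ω (le_max_right s (t + 1)) hk
    obtain rfl := Option.some.inj (h1.symm.trans h2)
    refine ⟨s, ?_, hr⟩
    -- A packet delivered no later than time `t` had been sent by then, whereas `m` is first sent at
    -- time `t + 1`.
    by_contra hs
    exact hm' ⟨j, List.mem_of_getElem?
      ((protocol n f d T).run_sent_getElem? x byz ω (not_lt.mp hs) hp)⟩

/-- The vector is frozen once the last iteration is over. Hence the irrevocable first output always
agrees with the output computed from the current state. -/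
theorem vec_eq_of_final {s : State n d} (hs : T ≤ s.iter) (src : Fin n) (m : Msg n d) :
    T ≤ (onReceive f T src m s).1.iter ∧ (onReceive f T src m s).1.vec = s.vec := by
  have hle := advances_onReceive f T src m s
  refine ⟨hs.trans hle.iter, ((hle.vec ?_).1).symm⟩
  rw [onReceive_fst]
  obtain ⟨e1, -⟩ := beforeReport_frame f src m s
  have h1 : ¬ (beforeReport f src m s).1.CanReport f T := fun h => by
    have := h.1; omega
  rw [reportRule_of_not h1]
  have h2 : ¬ (beforeReport f src m s).1.CanAdvance f T := fun h => by
    have := h.1; omega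
  rw [advanceRule_of_not h2]
  exact e1.symm

theorem decided_eq (t : ℕ) (j : H) : (((protocol n f d T).run x byz ω t).loc j).decided =
    (protocol n f d T).output (((protocol n f d T).run x byz ω t).loc j).state := by
  induction t with
  | zero => rfl
  | succ t ih =>
    have aux : ∀ (i : H) (src : Fin n) (m : Msg n d),
        (((protocol n f d T).receive ω ((protocol n f d T).run x byz ω t) i src m).loc j).decided =
        (protocol n f d T).output (((protocol n f d T).receive ω
          ((protocol n f d T).run x byz ω t) i src m).loc j).state := by
      intro i src m
      by_cases hi : j = i
      · subst hi
        rw [receive_state_self, receive_decided_self, ih]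
        generalize (((protocol n f d T).run x byz ω t).loc j).state = s
        change State n d at s
        simp only [protocol]
        by_cases hs : T ≤ s.iter
        · obtain ⟨h1, h2⟩ := vec_eq_of_final (f := f) hs src m
          simp [hs, h1, h2]
        · simp [hs]
      · rw [receive_loc_of_ne ω _ hi, ih]
    rw [Protocol.run_succ]
    rcases (protocol n f d T).perform_cases ω ((protocol n f d T).run x byz ω t)
      ((protocol n f d T).actionAt x byz ω t) with
      h | ⟨i, src, m', hs, h⟩ | ⟨k₁, p, hd, hp, -, -, h⟩ <;> rw [h]
    · exact ih
    · exact aux _ _ _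
    · exact aux _ _ _

/-- In a fair run all honest nodes output their last vectors. -/
theorem exists_trajectory_of_fair (hH : H.card + f = n) (hf : 3 * f < n)
    (hfair : (protocol n f d T).Fair x byz ω) : ∃ X : ℕ → H → Vec d, X 0 = x ∧
    (∀ r < T, ∃ (w : Fin n → Vec d) (Q : H → Finset (Fin n)), (∀ k : H, w k = X r k) ∧
      (∀ j, X (r + 1) j = trimmedMean f (Q j) w) ∧ ∀ j k, n - f ≤ (Q j ∩ Q k).card) ∧
    ∀ j, (protocol n f d T).Decides x byz ω j (X T j) := by
  obtain ⟨X, h1, h2, h3⟩ := (execOfFair x byz ω hfair).exists_trajectory hH hf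
  refine ⟨X, h1, h2, fun j => ?_⟩
  obtain ⟨t, ht, hv⟩ := h3 j
  refine ⟨t, ?_⟩
  change (stateAt x byz ω t j).iter = T at ht
  change (stateAt x byz ω t j).vec = X T j at hv
  rw [decided_eq, ← hv]
  change (if T ≤ (stateAt x byz ω t j).iter then some (stateAt x byz ω t j).vec else none) = _
  rw [if_pos (ge_of_eq ht)]

end RBTM

end ByzAvg

namespace ByzAvg

/-! ### The trimmed mean of numbers -/

section Trim

variable {n : ℕ} {f : ℕ} {Q Q' : Finset (Fin n)} {a : Fin n → ℝ}

/-- The position of `k` in the order by value, ties being broken by the identifiers. -/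
def key (a : Fin n → ℝ) (k : Fin n) : Lex (ℝ × Fin n) := toLex (a k, k)

theorem rank_eq (Q : Finset (Fin n)) (a : Fin n → ℝ) (k : Fin n) :
    rank Q a k = (Q.filter fun l => key a l < key a k).card := by
  classical
  unfold rank
  congr 1
  refine Finset.filter_congr fun l _ => ?_
  rw [key, key, Prod.Lex.toLex_lt_toLex]

theorem rank_lt_rank {k l : Fin n} (hk : k ∈ Q) (h : key a k < key a l) :
    rank Q a k < rank Q a l := by
  rw [rank_eq, rank_eq]
  refine Finset.card_lt_card ⟨fun m hm => ?_, fun hsub => ?_⟩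
  · rw [Finset.mem_filter] at hm ⊢
    exact ⟨hm.1, hm.2.trans h⟩
  · exact lt_irrefl _ (Finset.mem_filter.mp (hsub (Finset.mem_filter.mpr ⟨hk, h⟩))).2

theorem key_injective (a : Fin n → ℝ) : Function.Injective (key a) := fun k l h => by
  have := congrArg (fun p => (ofLex p).2) h
  simpa [key] using this

theorem rank_injOn (Q : Finset (Fin n)) (a : Fin n → ℝ) : Set.InjOn (rank Q a) Q := by
  intro k hk l hl h
  rcases lt_trichotomy (key a k) (key a l) with h1 | h1 | h1
  · exact absurd h (rank_lt_rank hk h1).ne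
  · exact key_injective a h1
  · exact absurd h (rank_lt_rank hl h1).ne'

theorem le_of_rank_le {k l : Fin n} (hl : l ∈ Q) (h : rank Q a k ≤ rank Q a l) : a k ≤ a l := by
  have h1 : key a k ≤ key a l := by
    by_contra hcon
    exact absurd (rank_lt_rank hl (not_le.mp hcon)) (not_lt.mpr h)
  rcases Prod.Lex.toLex_le_toLex.mp h1 with h2 | h2
  · exact h2.le
  · exact h2.1.le

/-- Breaking ties makes `rank` a bijection from `Q` to an initial segment, so sets defined by ranks
are counted as sets of integers. -/
theorem image_rank (Q : Finset (Fin n)) (a : Fin n → ℝ) :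
    Q.image (rank Q a) = Finset.range Q.card := by
  refine Finset.eq_of_subset_of_card_le ?_ ?_
  · intro m hm
    obtain ⟨k, hk, rfl⟩ := Finset.mem_image.mp hm
    rw [Finset.mem_range, rank_eq]
    exact Finset.card_lt_card (Finset.filter_ssubset.mpr ⟨k, hk, lt_irrefl _⟩)
  · rw [Finset.card_image_of_injOn (rank_injOn Q a), Finset.card_range]

theorem card_filter_rank (Q : Finset (Fin n)) (a : Fin n → ℝ) (p : ℕ → Prop) [DecidablePred p] :
    (Q.filter fun k => p (rank Q a k)).card = ((Finset.range Q.card).filter p).card := by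
  rw [← image_rank Q a, Finset.filter_image, Finset.card_image_of_injOn]
  exact (rank_injOn Q a).mono (Finset.coe_subset.mpr (Finset.filter_subset _ _))

theorem card_trim (hQ : 2 * f ≤ Q.card) : (trim f Q a).card + 2 * f = Q.card := by
  unfold trim
  rw [card_filter_rank Q a (fun m => f ≤ m ∧ m + f < Q.card)]
  have : (Finset.range Q.card).filter (fun m => f ≤ m ∧ m + f < Q.card) =
      Finset.Ico f (Q.card - f) := by
    ext m
    simp only [Finset.mem_filter, Finset.mem_range, Finset.mem_Ico]
    omega
  rw [this, Nat.card_Ico]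
  omega

/-- Enlarging the set can only increase both the number of elements below `k` and the number above
it. So an element with `f` on each side keeps them. -/
theorem trim_mono (h : Q ⊆ Q') : trim f Q a ⊆ trim f Q' a := by
  intro k hk
  obtain ⟨hkQ, h1, h2⟩ := Finset.mem_filter.mp hk
  refine Finset.mem_filter.mpr ⟨h hkQ, ?_, ?_⟩
  · refine h1.trans ?_
    rw [rank_eq, rank_eq]
    exact Finset.card_le_card (Finset.filter_subset_filter _ h)
  · have h3 : (Q'.filter fun l => key a l < key a k) ∪ (Q.filter fun l => ¬ key a l < key a k)
        ⊆ Q' := Finset.union_subset (Finset.filter_subset _ _) ((Finset.filter_subset _ _).trans h)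
    have h4 := Finset.card_le_card h3
    rw [Finset.card_union_of_disjoint] at h4
    · have h5 := Finset.card_filter_add_card_filter_not (s := Q) (fun l => key a l < key a k)
      rw [rank_eq] at h2 ⊢
      omega
    · rw [Finset.disjoint_left]
      intro l hl hl'
      exact (Finset.mem_filter.mp hl').2 (Finset.mem_filter.mp hl).2

/-- `U` consists of the discarded largest elements. What follows uses only that `f` elements outside
the remaining set dominate it. -/
theorem exists_upper (hQ : 2 * f ≤ Q.card) : ∃ U : Finset (Fin n), U.card = f ∧
    Disjoint (trim f Q a) U ∧ ∀ k ∈ trim f Q a, ∀ l ∈ U, a k ≤ a l := by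
  refine ⟨Q.filter fun k => Q.card ≤ rank Q a k + f, ?_, ?_, ?_⟩
  · rw [card_filter_rank Q a (fun m => Q.card ≤ m + f)]
    have : (Finset.range Q.card).filter (fun m => Q.card ≤ m + f) =
        Finset.Ico (Q.card - f) Q.card := by
      ext m
      simp only [Finset.mem_filter, Finset.mem_range, Finset.mem_Ico]
      omega
    rw [this, Nat.card_Ico]
    omega
  · rw [Finset.disjoint_left]
    intro k hk hk'
    have h1 := (Finset.mem_filter.mp hk).2.2
    have h2 := (Finset.mem_filter.mp hk').2
    omega
  · intro k hk l hl
    have h1 := (Finset.mem_filter.mp hk).2.2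
    obtain ⟨hl, h2⟩ := Finset.mem_filter.mp hl
    exact le_of_rank_le hl (by omega)

theorem exists_lower (hQ : 2 * f ≤ Q.card) : ∃ D : Finset (Fin n), D.card = f ∧
    Disjoint (trim f Q a) D ∧ ∀ k ∈ trim f Q a, ∀ l ∈ D, a l ≤ a k := by
  refine ⟨Q.filter fun k => rank Q a k < f, ?_, ?_, ?_⟩
  · rw [card_filter_rank Q a (fun m => m < f)]
    have : (Finset.range Q.card).filter (fun m => m < f) = Finset.range f := by
      ext m
      simp only [Finset.mem_filter, Finset.mem_range]
      omega
    rw [this, Finset.card_range]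
  · rw [Finset.disjoint_left]
    intro k hk hk'
    have h1 := (Finset.mem_filter.mp hk).2.1
    have h2 := (Finset.mem_filter.mp hk').2
    omega
  · intro k hk l hl
    have h1 := (Finset.mem_filter.mp hk).2.1
    obtain ⟨_, h2⟩ := Finset.mem_filter.mp hl
    exact le_of_rank_le (Finset.mem_filter.mp hk).1 (by omega)

variable {H R U : Finset (Fin n)}

theorem exists_le_of_dominated (hH : H.card + f = n) (hU : U.card = f) (hRU : Disjoint R U)
    (hle : ∀ k ∈ R, ∀ l ∈ U, a k ≤ a l) {k : Fin n} (hk : k ∈ R) : ∃ l ∈ H, a k ≤ a l := by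
  classical
  by_contra! hcon
  -- Otherwise `k` and the `f` elements above it would be `f + 1` Byzantine nodes.
  have h1 : insert k U ⊆ Hᶜ := by
    intro l hl
    rw [Finset.mem_compl]
    intro hlH
    rcases Finset.mem_insert.mp hl with rfl | hl
    · exact lt_irrefl _ (hcon l hlH)
    · exact absurd (hle k hk l hl) (not_le.mpr (hcon l hlH))
  have h2 := Finset.card_le_card h1
  rw [Finset.card_insert_of_notMem (Finset.disjoint_left.mp hRU hk), Finset.card_compl,
    Fintype.card_fin] at h2
  omega

/-- Byzantine elements of `R` are exchanged for honest elements of `U`, which are at least as large.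
There are enough of these, since `R` and `U` together contain at most `f = |U|` Byzantine nodes. -/
theorem sum_le_sum_of_dominated (hH : H.card + f = n) (hU : U.card = f) (hRU : Disjoint R U)
    (hle : ∀ k ∈ R, ∀ l ∈ U, a k ≤ a l) (h0 : ∀ k ∈ H, 0 ≤ a k) :
    ∑ k ∈ R, a k ≤ ∑ k ∈ H, a k := by
  classical
  have h1 : (R \ H).card + (U \ H).card ≤ f := by
    have h2 : (R \ H) ∪ (U \ H) ⊆ Hᶜ := by
      intro l hl
      rw [Finset.mem_compl]
      rcases Finset.mem_union.mp hl with hl | hl <;> exact (Finset.mem_sdiff.mp hl).2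
    have h3 := Finset.card_le_card h2
    rw [Finset.card_union_of_disjoint
      (hRU.mono Finset.sdiff_subset Finset.sdiff_subset), Finset.card_compl, Fintype.card_fin] at h3
    omega
  have h2 := Finset.card_inter_add_card_sdiff U H
  obtain ⟨V, hV, hVc⟩ := Finset.exists_subset_card_eq (s := U ∩ H) (n := (R \ H).card) (by omega)
  have h3 : ∑ k ∈ R \ H, a k ≤ ∑ k ∈ V, a k := by
    rcases (R \ H).eq_empty_or_nonempty with he | hne
    · rw [he] at hVc ⊢
      rw [Finset.card_empty, Finset.card_eq_zero] at hVc
      rw [hVc]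
    · obtain ⟨m, hm, hmax⟩ := Finset.exists_max_image (R \ H) a hne
      refine (Finset.sum_le_card_nsmul _ _ _ hmax).trans ?_
      rw [← hVc]
      exact Finset.card_nsmul_le_sum _ _ _ fun l hl =>
        hle m (Finset.mem_sdiff.mp hm).1 l (Finset.mem_inter.mp (hV hl)).1
  have h4 : Disjoint (R ∩ H) V :=
    hRU.mono Finset.inter_subset_left (hV.trans Finset.inter_subset_left)
  calc ∑ k ∈ R, a k = ∑ k ∈ R ∩ H, a k + ∑ k ∈ R \ H, a k := (Finset.sum_inter_add_sum_sdiff _ _ _).symm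
    _ ≤ ∑ k ∈ R ∩ H, a k + ∑ k ∈ V, a k := by gcongr
    _ = ∑ k ∈ (R ∩ H) ∪ V, a k := (Finset.sum_union h4).symm
    _ ≤ ∑ k ∈ H, a k := Finset.sum_le_sum_of_subset_of_nonneg
        (Finset.union_subset Finset.inter_subset_right (hV.trans Finset.inter_subset_right))
        fun k hk _ => h0 k hk

/-- With `τ` the average over `R`, the exchange lemma for `a - lo` gives `|R| (τ - lo) ≤ ∑ k ∈ H, (a
k - lo)`. Replacing `|R|` by `|H|` on the left costs at most `2 f (hi - lo)`. -/
theorem avg_sub_avg_le (hH : H.card + f = n) (hU : U.card = f) (hRU : Disjoint R U)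
    (hle : ∀ k ∈ R, ∀ l ∈ U, a k ≤ a l) {lo hi : ℝ} (hlo : ∀ k ∈ H, lo ≤ a k)
    (hhi : ∀ k ∈ H, a k ≤ hi) (hR : 0 < R.card) (hRH : H.card ≤ R.card + 2 * f) (hlh : lo ≤ hi) :
    (∑ k ∈ R, a k) / R.card - (∑ k ∈ H, a k) / H.card ≤ 2 * f / H.card * (hi - lo) := by
  have hRr : (0 : ℝ) < R.card := by exact_mod_cast hR
  have hsum := sum_le_sum_of_dominated (a := fun k => a k - lo) hH hU hRU
    (fun k hk l hl => sub_le_sub_right (hle k hk l hl) lo) (fun k hk => sub_nonneg.mpr (hlo k hk))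
  simp only [Finset.sum_sub_distrib, Finset.sum_const, nsmul_eq_mul] at hsum
  have hRhi : ∑ k ∈ R, a k ≤ R.card * hi := by
    rw [← nsmul_eq_mul]
    refine Finset.sum_le_card_nsmul _ _ _ fun k hk => ?_
    obtain ⟨l, hl, h⟩ := exists_le_of_dominated hH hU hRU hle hk
    exact h.trans (hhi l hl)
  have hHr : (0 : ℝ) < H.card := by
    obtain ⟨k, hk⟩ := Finset.card_pos.mp hR
    obtain ⟨l, hl, -⟩ := exists_le_of_dominated hH hU hRU hle hk
    exact_mod_cast Finset.card_pos.mpr ⟨l, hl⟩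
  have hRHr : (H.card : ℝ) ≤ R.card + 2 * f := by exact_mod_cast hRH
  have hRHr' : (R.card : ℝ) ≤ R.card + 2 * f := by
    have : (0 : ℝ) ≤ f := Nat.cast_nonneg f
    linarith
  set A := ∑ k ∈ R, a k
  set B := ∑ k ∈ H, a k
  set τ := A / R.card with hτ
  have hA : A = τ * R.card := by rw [hτ]; field_simp
  have hτhi : τ ≤ hi := by rw [hτ, div_le_iff₀ hRr]; linarith
  rw [hA] at hsum
  rw [sub_le_iff_le_add, ← sub_le_iff_le_add', div_mul_eq_mul_div, le_div_iff₀ hHr, sub_mul,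
    div_mul_cancel₀ _ hHr.ne']
  -- `R` is controlled only from above here. If `τ < lo`, then `τ` is already below the honest
  -- average.
  by_cases hτlo : lo ≤ τ
  · have hf0 : (0 : ℝ) ≤ f := Nat.cast_nonneg f
    nlinarith [mul_le_mul_of_nonneg_right (sub_le_iff_le_add'.mpr hRHr) (sub_nonneg.mpr hτlo),
      mul_le_mul_of_nonneg_left (sub_le_sub_right hτhi lo) (mul_nonneg (zero_le_two (α := ℝ)) hf0)]
  · have h1 : H.card * lo ≤ B := by
      rw [← nsmul_eq_mul]
      exact Finset.card_nsmul_le_sum _ _ _ hlo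
    have h2 : (0 : ℝ) ≤ 2 * f * (hi - lo) :=
      mul_nonneg (by positivity) (sub_nonneg.mpr hlh)
    nlinarith [mul_pos hHr (sub_pos.mpr (not_le.mp hτlo))]

/-- In the worst case `R` adds to `M` exactly `f` values `hi`, and `R'` adds `f` values `lo`. The
contributions of `M` then cancel. -/
theorem avg_sub_avg_le_of_common {M R' : Finset (Fin n)} (hM : M ⊆ R) (hM' : M ⊆ R')
    (hR : R.card ≤ M.card + f) (hR' : R'.card ≤ M.card + f) (hM0 : 0 < M.card) {lo hi : ℝ}
    (hlo : ∀ k ∈ R', lo ≤ a k) (hhi : ∀ k ∈ R, a k ≤ hi) :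
    (∑ k ∈ R, a k) / R.card - (∑ k ∈ R', a k) / R'.card ≤ f / (M.card + f) * (hi - lo) := by
  classical
  have hMr : (0 : ℝ) < M.card := by exact_mod_cast hM0
  have hMR : (M.card : ℝ) ≤ R.card := by exact_mod_cast Finset.card_le_card hM
  have hMR' : (M.card : ℝ) ≤ R'.card := by exact_mod_cast Finset.card_le_card hM'
  have hRr : (R.card : ℝ) ≤ M.card + f := by exact_mod_cast hR
  have hRr' : (R'.card : ℝ) ≤ M.card + f := by exact_mod_cast hR'
  set S := ∑ k ∈ M, a k with hS
  have hS1 : S ≤ M.card * hi := by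
    rw [← nsmul_eq_mul]
    exact Finset.sum_le_card_nsmul _ _ _ fun k hk => hhi k (hM hk)
  have hS2 : M.card * lo ≤ S := by
    rw [← nsmul_eq_mul]
    exact Finset.card_nsmul_le_sum _ _ _ fun k hk => hlo k (hM' hk)
  have h1 : ∑ k ∈ R, a k ≤ S + (R.card - M.card) * hi := by
    rw [← Finset.sum_sdiff hM, add_comm]
    gcongr
    rw [← Nat.cast_sub (Finset.card_le_card hM), ← Finset.card_sdiff_of_subset hM, ← nsmul_eq_mul]
    exact Finset.sum_le_card_nsmul _ _ _ fun k hk => hhi k (Finset.mem_sdiff.mp hk).1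
  have h2 : S + (R'.card - M.card) * lo ≤ ∑ k ∈ R', a k := by
    rw [← Finset.sum_sdiff hM', add_comm]
    gcongr
    rw [← Nat.cast_sub (Finset.card_le_card hM'), ← Finset.card_sdiff_of_subset hM',
      ← nsmul_eq_mul]
    exact Finset.card_nsmul_le_sum _ _ _ fun k hk => hlo k (Finset.mem_sdiff.mp hk).1
  set m : ℝ := (M.card : ℝ)
  have hmf : 0 < m + f := by positivity
  have h3 : (∑ k ∈ R, a k) / R.card ≤ (S + f * hi) / (m + f) := by
    rw [div_le_div_iff₀ (hMr.trans_le hMR) hmf]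
    nlinarith [mul_nonneg (sub_nonneg.mpr hS1) (sub_nonneg.mpr hRr),
      mul_le_mul_of_nonneg_right h1 hmf.le]
  have h4 : (S + f * lo) / (m + f) ≤ (∑ k ∈ R', a k) / R'.card := by
    rw [div_le_div_iff₀ hmf (hMr.trans_le hMR')]
    nlinarith [mul_nonneg (sub_nonneg.mpr hS2) (sub_nonneg.mpr hRr'),
      mul_le_mul_of_nonneg_right h2 hmf.le]
  calc _ ≤ (S + f * hi) / (m + f) - (S + f * lo) / (m + f) := sub_le_sub h3 h4
    _ = f / (m + f) * (hi - lo) := by field_simp; ring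

/-- The trimmed mean of the numbers `a k`, `k ∈ Q`. -/
noncomputable def scalarTrimmedMean (f : ℕ) (Q : Finset (Fin n)) (a : Fin n → ℝ) : ℝ :=
  (∑ k ∈ trim f Q a, a k) / ((Q.card : ℝ) - 2 * (f : ℝ))

theorem trimmedMean_apply {d : ℕ} (f : ℕ) (Q : Finset (Fin n)) (w : Fin n → Vec d) (i : Fin d) :
    trimmedMean f Q w i = scalarTrimmedMean f Q fun k => w k i := rfl

theorem scalarTrimmedMean_eq (hQ : 2 * f ≤ Q.card) :
    scalarTrimmedMean f Q a = (∑ k ∈ trim f Q a, a k) / (trim f Q a).card := by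
  have h : ((trim f Q a).card : ℝ) + 2 * f = Q.card := by exact_mod_cast card_trim (a := a) hQ
  rw [scalarTrimmedMean, ← h, add_sub_cancel_right]

variable (hH : H.card + f = n) (hf : 3 * f < n) (hQ : n - f ≤ Q.card) {lo hi : ℝ}
  (hlo : ∀ k ∈ H, lo ≤ a k) (hhi : ∀ k ∈ H, a k ≤ hi)
include hH hf hQ

include hhi in
theorem le_of_mem_trim {k : Fin n} (hk : k ∈ trim f Q a) : a k ≤ hi := by
  obtain ⟨U, hU, hd, hle⟩ := exists_upper (a := a) (f := f) (Q := Q) (by omega)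
  obtain ⟨l, hl, h⟩ := exists_le_of_dominated hH hU hd hle hk
  exact h.trans (hhi l hl)

include hlo in
theorem ge_of_mem_trim {k : Fin n} (hk : k ∈ trim f Q a) : lo ≤ a k := by
  obtain ⟨D, hD, hd, hle⟩ := exists_lower (a := a) (f := f) (Q := Q) (by omega)
  obtain ⟨l, hl, h⟩ := exists_le_of_dominated (a := fun k => -a k) hH hD hd
    (fun k hk l hl => neg_le_neg (hle k hk l hl)) hk
  exact (hlo l hl).trans (neg_le_neg_iff.mp h)

omit hH in
theorem card_trim_pos : 0 < (trim f Q a).card := by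
  have := card_trim (f := f) (Q := Q) (a := a) (by omega)
  omega

include hhi in
theorem scalarTrimmedMean_le : scalarTrimmedMean f Q a ≤ hi := by
  rw [scalarTrimmedMean_eq (by omega), div_le_iff₀ (by exact_mod_cast card_trim_pos hf hQ),
    mul_comm, ← nsmul_eq_mul]
  exact Finset.sum_le_card_nsmul _ _ _ fun k hk => le_of_mem_trim hH hf hQ hhi hk

include hlo in
theorem le_scalarTrimmedMean : lo ≤ scalarTrimmedMean f Q a := by
  rw [scalarTrimmedMean_eq (by omega), le_div_iff₀ (by exact_mod_cast card_trim_pos hf hQ),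
    mul_comm, ← nsmul_eq_mul]
  exact Finset.card_nsmul_le_sum _ _ _ fun k hk => ge_of_mem_trim hH hf hQ hlo hk

include hlo hhi in
theorem abs_scalarTrimmedMean_sub_mean_le (hlh : lo ≤ hi) :
    |scalarTrimmedMean f Q a - (∑ k ∈ H, a k) / H.card| ≤ 2 * f / H.card * (hi - lo) := by
  have hc := card_trim (f := f) (Q := Q) (a := a) (by omega)
  rw [scalarTrimmedMean_eq (by omega), abs_sub_le_iff]
  constructor
  · obtain ⟨U, hU, hd, hle⟩ := exists_upper (a := a) (f := f) (Q := Q) (by omega)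
    exact avg_sub_avg_le hH hU hd hle hlo hhi (by omega) (by omega) hlh
  · obtain ⟨D, hD, hd, hle⟩ := exists_lower (a := a) (f := f) (Q := Q) (by omega)
    -- The reverse bound follows by changing signs, which turns the smallest values into the
    -- largest.
    have := avg_sub_avg_le (a := fun k => -a k) hH hD hd
      (fun k hk l hl => neg_le_neg (hle k hk l hl)) (fun k hk => neg_le_neg (hhi k hk))
      (fun k hk => neg_le_neg (hlo k hk)) (by omega) (by omega) (neg_le_neg hlh)
    simp only [Finset.sum_neg_distrib, neg_div] at this
    linarith

include hlo hhi in
theorem scalarTrimmedMean_sub_le (hQQ : n - f ≤ (Q ∩ Q').card) (hlh : lo ≤ hi) :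
    scalarTrimmedMean f Q a - scalarTrimmedMean f Q' a ≤ f / ((n : ℝ) - 2 * f) * (hi - lo) := by
  classical
  have hQ' : n - f ≤ Q'.card := hQQ.trans (Finset.card_le_card Finset.inter_subset_right)
  have hcI := card_trim (f := f) (Q := Q ∩ Q') (a := a) (by omega)
  have hc := card_trim (f := f) (Q := Q) (a := a) (by omega)
  have hc' := card_trim (f := f) (Q := Q') (a := a) (by omega)
  have hn : Q.card ≤ n := by simpa using Finset.card_le_univ Q
  have hn' : Q'.card ≤ n := by simpa using Finset.card_le_univ Q'
  rw [scalarTrimmedMean_eq (by omega), scalarTrimmedMean_eq (by omega)]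
  refine (avg_sub_avg_le_of_common (f := f) (trim_mono Finset.inter_subset_left)
    (trim_mono Finset.inter_subset_right) (by omega) (by omega) (by omega)
    (fun k hk => ge_of_mem_trim hH hf hQ' hlo hk)
    (fun k hk => le_of_mem_trim hH hf hQ hhi hk)).trans ?_
  -- The common part has `|Q ∩ Q'| - 2 f ≥ n - 3 f` elements.
  have h1 : (n : ℝ) - 2 * f ≤ (trim f (Q ∩ Q') a).card + f := by
    have : n ≤ (trim f (Q ∩ Q') a).card + f + 2 * f := by omega
    have : (n : ℝ) ≤ (trim f (Q ∩ Q') a).card + f + 2 * f := by exact_mod_cast this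
    linarith
  have h2 : (0 : ℝ) < (n : ℝ) - 2 * f := by
    have : 2 * f < n := by omega
    have : (2 : ℝ) * f < n := by exact_mod_cast this
    linarith
  have h3 : 0 ≤ hi - lo := sub_nonneg.mpr hlh
  gcongr

end Trim

end ByzAvg

namespace ByzAvg

/-! ### Iterated trimmed means -/

/-- The vectors of the honest nodes in `T` iterations of the trimmed mean, in each of which any two
honest nodes collect at least `n - f` common vectors. -/
structure Trajectory {n d : ℕ} (H : Finset (Fin n)) (f T : ℕ) (X : ℕ → H → Vec d) : Prop where
  next : ∀ r < T, ∃ (w : Fin n → Vec d) (Q : H → Finset (Fin n)), (∀ k : H, w k = X r k) ∧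
    (∀ j, X (r + 1) j = trimmedMean f (Q j) w) ∧ ∀ j k, n - f ≤ (Q j ∩ Q k).card

namespace Trajectory

variable {n d : ℕ} {H : Finset (Fin n)} {f T : ℕ} {X : ℕ → H → Vec d}

section Coordinates

variable (h : Trajectory H f T X) (hH : H.card + f = n) (hf : 3 * f < n) (i : Fin d)
include h hH hf

theorem mem_Icc_succ {r : ℕ} (hr : r < T) {lo hi : ℝ} (hX : ∀ j, X r j i ∈ Set.Icc lo hi) (j : H) :
    X (r + 1) j i ∈ Set.Icc lo hi := by
  obtain ⟨w, Q, hw, hQ, hc⟩ := h.next r hr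
  have hcj := hc j j
  rw [Finset.inter_self] at hcj
  have hwX : ∀ k ∈ H, w k i ∈ Set.Icc lo hi := fun k hk => by rw [hw ⟨k, hk⟩]; exact hX _
  rw [hQ j, trimmedMean_apply]
  exact ⟨le_scalarTrimmedMean hH hf hcj fun k hk => (hwX k hk).1,
    scalarTrimmedMean_le hH hf hcj fun k hk => (hwX k hk).2⟩

theorem mem_Icc {r s : ℕ} (hrs : r ≤ s) (hs : s ≤ T) {lo hi : ℝ}
    (hX : ∀ j, X r j i ∈ Set.Icc lo hi) : ∀ j, X s j i ∈ Set.Icc lo hi := by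
  induction s, hrs using Nat.le_induction with
  | base => exact hX
  | succ s _ ih => exact h.mem_Icc_succ hH hf i hs (ih (Nat.le_of_succ_le hs))

omit h hH hf in
theorem exists_Icc (r : ℕ) (j₀ : H) {D : ℝ} (hD : ∀ j k, X r j i - X r k i ≤ D) :
    ∃ lo hi, (∀ j, X r j i ∈ Set.Icc lo hi) ∧ lo ≤ hi ∧ hi - lo ≤ D := by
  have : Nonempty H := ⟨j₀⟩
  obtain ⟨a, ha⟩ := Finite.exists_min fun j => X r j i
  obtain ⟨b, hb⟩ := Finite.exists_max fun j => X r j i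
  exact ⟨X r a i, X r b i, fun j => ⟨ha j, hb j⟩, ha b, hD b a⟩

/-- One iteration contracts the range of each coordinate, because any two honest nodes share `n - f`
collected vectors. -/
theorem sub_le_of_succ {r : ℕ} (hr : r < T) {D : ℝ} (hD : ∀ j k, X r j i - X r k i ≤ D) (j k : H) :
    X (r + 1) j i - X (r + 1) k i ≤ f / ((n : ℝ) - 2 * f) * D := by
  obtain ⟨lo, hi, hX, hlh, hDh⟩ := exists_Icc (X := X) i r j hD
  obtain ⟨w, Q, hw, hQ, hc⟩ := h.next r hr
  have hcj := hc j j
  rw [Finset.inter_self] at hcj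
  have hwX : ∀ k ∈ H, w k i ∈ Set.Icc lo hi := fun k hk => by rw [hw ⟨k, hk⟩]; exact hX _
  rw [hQ j, hQ k, trimmedMean_apply, trimmedMean_apply]
  refine (scalarTrimmedMean_sub_le hH hf hcj (fun k hk => (hwX k hk).1)
    (fun k hk => (hwX k hk).2) (hc j k) hlh).trans ?_
  have h2 : (0 : ℝ) < (n : ℝ) - 2 * f := by
    have : 2 * f < n := by omega
    have : (2 : ℝ) * f < n := by exact_mod_cast this
    linarith
  gcongr

theorem sub_le {r : ℕ} (hr : r ≤ T) {D : ℝ} (hD : ∀ j k, X 0 j i - X 0 k i ≤ D) (j k : H) :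
    X r j i - X r k i ≤ (f / ((n : ℝ) - 2 * f)) ^ r * D := by
  induction r generalizing j k with
  | zero => simpa using hD j k
  | succ r ih =>
    rw [pow_succ', mul_assoc]
    exact h.sub_le_of_succ hH hf i hr (ih (Nat.le_of_succ_le hr)) j k

/-- After one iteration all honest values lie in an interval around the initial mean, which later
iterations do not leave. Hence the bound does not depend on `T`. -/
theorem abs_sub_mean_le (hT : 0 < T) {D : ℝ} (hD : ∀ j k, X 0 j i - X 0 k i ≤ D) (j : H) :
    |X T j i - (∑ k, X 0 k i) / H.card| ≤ 2 * f / H.card * D := by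
  obtain ⟨lo, hi, hX, hlh, hDh⟩ := exists_Icc (X := X) i 0 j hD
  have hD' : 2 * f / H.card * (hi - lo) ≤ 2 * f / H.card * D := by gcongr
  refine le_trans ?_ hD'
  rw [abs_sub_le_iff, sub_le_iff_le_add', sub_le_comm]
  obtain ⟨w, Q, hw, hQ, hc⟩ := h.next 0 hT
  have hwX : ∀ k ∈ H, w k i ∈ Set.Icc lo hi := fun k hk => by rw [hw ⟨k, hk⟩]; exact hX _
  have hsum : ∑ k ∈ H, w k i = ∑ k, X 0 k i := by
    rw [← Finset.sum_coe_sort]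
    exact Finset.sum_congr rfl fun k _ => by rw [hw k]
  have h1 : ∀ j, X 1 j i ∈ Set.Icc ((∑ k, X 0 k i) / H.card - 2 * f / H.card * (hi - lo))
      ((∑ k, X 0 k i) / H.card + 2 * f / H.card * (hi - lo)) := by
    intro j
    have hcj := hc j j
    rw [Finset.inter_self] at hcj
    have := abs_scalarTrimmedMean_sub_mean_le hH hf hcj (fun k hk => (hwX k hk).1)
      (fun k hk => (hwX k hk).2) hlh
    rw [hsum, abs_sub_le_iff, sub_le_iff_le_add', sub_le_comm] at this
    rw [zero_add] at hQ
    rw [hQ j, trimmedMean_apply]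
    exact ⟨this.2, this.1⟩
  exact (h.mem_Icc hH hf i hT le_rfl h1 j).symm

end Coordinates

theorem _root_.ByzAvg.dist_le_diam₂ {ι : Type*} [Finite ι] (x : ι → Vec d) (j k : ι) :
    dist (x j) (x k) ≤ diam₂ x :=
  Metric.dist_le_diam_of_mem (Set.finite_range x).isBounded (Set.mem_range_self j)
    (Set.mem_range_self k)

theorem _root_.ByzAvg.diam₂_nonneg {ι : Type*} (x : ι → Vec d) : 0 ≤ diam₂ x := Metric.diam_nonneg

theorem _root_.ByzAvg.diam₂_sq_le {ι : Type*} {x : ι → Vec d} {c : ℝ} (hc : 0 ≤ c)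
    (h : ∀ j k, dist (x j) (x k) ^ 2 ≤ c) : diam₂ x ^ 2 ≤ c := by
  have h1 : diam₂ x ≤ √c := by
    refine Metric.diam_le_of_forall_dist_le (Real.sqrt_nonneg c) ?_
    rintro _ ⟨j, rfl⟩ _ ⟨k, rfl⟩
    exact Real.le_sqrt_of_sq_le (h j k)
  calc diam₂ x ^ 2 ≤ √c ^ 2 := pow_le_pow_left₀ (diam₂_nonneg x) h1 2
    _ = c := Real.sq_sqrt hc

/-- A bound on the range of the `i`-th coordinate. -/
noncomputable def coordBound {ι : Type*} [Fintype ι] (x : ι → Vec d) (j₀ : ι) (i : Fin d) : ℝ :=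
  2 * √(∑ j, (x j i - x j₀ i) ^ 2)

theorem sub_le_coordBound {ι : Type*} [Fintype ι] (x : ι → Vec d) (j₀ : ι) (i : Fin d) (j k : ι) :
    x j i - x k i ≤ coordBound x j₀ i := by
  have h : ∀ j, |x j i - x j₀ i| ≤ √(∑ j, (x j i - x j₀ i) ^ 2) := fun j =>
    Real.abs_le_sqrt (Finset.single_le_sum (f := fun j => (x j i - x j₀ i) ^ 2)
      (fun _ _ => sq_nonneg _) (Finset.mem_univ j))
  have h1 := (abs_le.mp (h j)).2
  have h2 := (abs_le.mp (h k)).1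
  unfold coordBound
  linarith

/-- Exchanging the sums over coordinates and nodes turns the inner sum into a squared distance to `x
j₀`. The loss is a factor in the number of nodes, and none in the dimension. -/
theorem sum_coordBound_sq_le {ι : Type*} [Fintype ι] (x : ι → Vec d) (j₀ : ι) :
    ∑ i, coordBound x j₀ i ^ 2 ≤ 4 * Fintype.card ι * diam₂ x ^ 2 := by
  have h1 : ∀ i, coordBound x j₀ i ^ 2 = 4 * ∑ j, (x j i - x j₀ i) ^ 2 := by
    intro i
    rw [coordBound, mul_pow, Real.sq_sqrt (Finset.sum_nonneg fun _ _ => sq_nonneg _)]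
    norm_num
  simp_rw [h1]
  rw [← Finset.mul_sum, Finset.sum_comm, mul_assoc]
  gcongr
  rw [← nsmul_eq_mul, ← Finset.card_univ]
  refine Finset.sum_le_card_nsmul _ _ _ fun j _ => ?_
  have h2 : ∑ i, (x j i - x j₀ i) ^ 2 = dist (x j) (x j₀) ^ 2 := by
    rw [EuclideanSpace.dist_eq, Real.sq_sqrt (Finset.sum_nonneg fun _ _ => sq_nonneg _)]
    simp [Real.dist_eq, sq_abs]
  rw [h2]
  exact pow_le_pow_left₀ dist_nonneg (dist_le_diam₂ x j j₀) 2

variable (h : Trajectory H f T X) (hH : H.card + f = n) (hf : 3 * f < n)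
include h hH hf

theorem diam₂_sq_le (j₀ : H) :
    diam₂ (X T) ^ 2 ≤
      ((f / ((n : ℝ) - 2 * f)) ^ T) ^ 2 * (4 * H.card * diam₂ (X 0) ^ 2) := by
  refine ByzAvg.diam₂_sq_le (by positivity) fun j k => ?_
  rw [EuclideanSpace.dist_eq, Real.sq_sqrt (Finset.sum_nonneg fun _ _ => sq_nonneg _)]
  have h1 : ∀ i, dist (X T j i) (X T k i) ^ 2 ≤
      ((f / ((n : ℝ) - 2 * f)) ^ T) ^ 2 * coordBound (X 0) j₀ i ^ 2 := by
    intro i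
    rw [← mul_pow, Real.dist_eq]
    refine pow_le_pow_left₀ (abs_nonneg _) (abs_sub_le_iff.mpr ⟨?_, ?_⟩) 2 <;>
      exact h.sub_le hH hf i le_rfl (sub_le_coordBound (X 0) j₀ i) _ _
  refine (Finset.sum_le_sum fun i _ => h1 i).trans ?_
  rw [← Finset.mul_sum]
  gcongr
  simpa using sum_coordBound_sq_le (X 0) j₀

theorem norm_mean_sub_sq_le (hT : 0 < T) (j₀ : H) :
    ‖mean (X T) - mean (X 0)‖ ^ 2 ≤
      (2 * f / H.card) ^ 2 * (4 * H.card * diam₂ (X 0) ^ 2) := by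
  have hc : (0 : ℝ) < H.card := Nat.cast_pos.mpr (Finset.card_pos.mpr ⟨j₀, j₀.2⟩)
  rw [EuclideanSpace.norm_eq, Real.sq_sqrt (Finset.sum_nonneg fun _ _ => sq_nonneg _)]
  have h1 : ∀ i, ‖(mean (X T) - mean (X 0)) i‖ ^ 2 ≤
      (2 * f / H.card) ^ 2 * coordBound (X 0) j₀ i ^ 2 := by
    intro i
    rw [← mul_pow, Real.norm_eq_abs]
    refine pow_le_pow_left₀ (abs_nonneg _) ?_ 2
    set m := (∑ k, X 0 k i) / H.card with hm
    set b := 2 * f / H.card * coordBound (X 0) j₀ i with hb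
    have h2 : ∀ j, |X T j i - m| ≤ b := fun j =>
      h.abs_sub_mean_le hH hf i hT (sub_le_coordBound (X 0) j₀ i) j
    have h3 : (mean (X T) - mean (X 0)) i = (H.card : ℝ)⁻¹ * ∑ j, (X T j i - m) := by
      simp only [mean, PiLp.sub_apply, PiLp.smul_apply, WithLp.ofLp_sum, Finset.sum_apply,
        smul_eq_mul, Fintype.card_coe, Finset.sum_sub_distrib, Finset.sum_const, Finset.card_univ,
        nsmul_eq_mul, hm]
      field_simp
    rw [h3, abs_mul, abs_of_pos (inv_pos.mpr hc), inv_mul_le_iff₀ hc]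
    refine (Finset.abs_sum_le_sum_abs _ _).trans ?_
    refine (Finset.sum_le_card_nsmul _ _ _ fun j _ => h2 j).trans ?_
    rw [nsmul_eq_mul, Finset.card_univ, Fintype.card_coe]
  refine (Finset.sum_le_sum fun i _ => h1 i).trans ?_
  rw [← Finset.mul_sum]
  gcongr
  simpa using sum_coordBound_sq_le (X 0) j₀

end Trajectory

/-! ### The guarantees of RB-TM -/

theorem expectation_const {Ω : Type*} [MeasurableSpace Ω] [Subsingleton Ω] (P : Measure Ω)
    [IsProbabilityMeasure P] (X : Ω → ℝ≥0∞) (ω : Ω) : expectation P X = X ω := by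
  have hX : X = fun _ => X ω := funext fun ω' => by rw [Subsingleton.elim ω' ω]
  refine le_antisymm ?_ ?_
  · refine (iInf₂_le (fun _ => X ω) measurable_const).trans ((iInf_le _ hX.le).trans ?_)
    simp
  · refine le_iInf₂ fun g hg => le_iInf fun hXg => ?_
    calc X ω = ∫⁻ _, X ω ∂P := by simp
      _ ≤ ∫⁻ ω, g ω ∂P := lintegral_mono fun ω' => by
        rw [Subsingleton.elim ω ω']; exact hXg ω'

instance {n d : ℕ} (A : Protocol.{u} n d) (H : Finset (Fin n)) :
    IsProbabilityMeasure (A.tapeLaw H) := by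
  unfold Protocol.tapeLaw; infer_instance

/-- The hypothesis says that `n - 2 f ≥ (1 + ε) f`. -/
theorem contraction_le {n f : ℕ} {ε : ℝ} (hε : 0 < ε) (hn : 3 * f < n)
    (h : (3 + ε) * (f : ℝ) ≤ n) : f / ((n : ℝ) - 2 * f) ≤ 1 - ε / (1 + ε) := by
  have h2 : (0 : ℝ) < (n : ℝ) - 2 * f := by
    have : 2 * f < n := by omega
    have : (2 : ℝ) * f < n := by exact_mod_cast this
    linarith
  have h3 : 1 - ε / (1 + ε) = 1 / (1 + ε) := by field_simp; ring
  rw [h3, div_le_div_iff₀ h2 (by linarith)]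
  linarith

/-- From `1 - δ ≤ exp (-δ)`. The number of iterations is chosen so that the square of the right side
cancels the factor `4 h` of `Trajectory.diam₂_sq_le` and leaves `1 / 4 ^ N`. -/
theorem pow_iterations_le {n f : ℕ} {ε : ℝ} (hε : 0 < ε) (hf : f < n) (N : ℕ) :
    (1 - ε / (1 + ε)) ^ RBTM.iterations n f ε N ≤ 1 / (2 ^ (N + 1) * √((n : ℝ) - f)) := by
  have hh : (0 : ℝ) < (n : ℝ) - f := by
    have : (f : ℝ) < n := by exact_mod_cast hf
    linarith
  have hδ : 0 < ε / (1 + ε) := by positivity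
  have hδ1 : ε / (1 + ε) ≤ 1 := by rw [div_le_one (by linarith)]; linarith
  set δ := ε / (1 + ε)
  have hT := Nat.le_ceil ((((N : ℝ) + 1) * Real.log 2 + Real.log √((n : ℝ) - (f : ℝ))) / δ)
  change _ ≤ (RBTM.iterations n f ε N : ℝ) at hT
  rw [div_le_iff₀ hδ] at hT
  set T := RBTM.iterations n f ε N
  calc (1 - δ) ^ T ≤ Real.exp (-δ) ^ T :=
        pow_le_pow_left₀ (by linarith) (by linarith [Real.add_one_le_exp (-δ)]) T
    _ = Real.exp (-(T * δ)) := by rw [← Real.exp_nat_mul]; ring_nf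
    _ ≤ Real.exp (-(((N : ℝ) + 1) * Real.log 2 + Real.log √((n : ℝ) - (f : ℝ)))) := by
        gcongr
    _ = 1 / (2 ^ (N + 1) * √((n : ℝ) - f)) := by
        rw [Real.exp_neg, Real.exp_add, Real.exp_log (Real.sqrt_pos.mpr hh), one_div]
        congr 2
        rw [mul_comm, Real.exp_mul, Real.exp_log (by norm_num)]
        exact_mod_cast rfl

theorem iterations_pos {n f : ℕ} {ε : ℝ} (hε : 0 < ε) (hf : f < n) (N : ℕ) :
    0 < RBTM.iterations n f ε N := by
  have hh : (1 : ℝ) ≤ (n : ℝ) - f := by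
    have : (f : ℝ) + 1 ≤ n := by exact_mod_cast hf
    linarith
  refine Nat.ceil_pos.mpr (div_pos (add_pos_of_pos_of_nonneg ?_ ?_) (by positivity))
  · exact mul_pos (by positivity) (Real.log_pos (by norm_num))
  · exact Real.log_nonneg (Real.one_le_sqrt.mpr hh)

theorem rbtm_achieves (n f d : ℕ) (ε : ℝ) (hn : 0 < n) (hε : 0 < ε)
    (hnf : (3 + ε) * (f : ℝ) ≤ (n : ℝ)) :
    AchievesAveragingAgreement f (rbtm n f d ε) (4 * (f : ℝ) / √((n : ℝ) - (f : ℝ))) := by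
  have hf : 3 * f < n := by
    -- The strict inequality comes from `ε f > 0`, or from `n > 0` when there are no Byzantine
    -- nodes.
    rcases Nat.eq_zero_or_pos f with rfl | hf0
    · simpa using hn
    · have hf0 : (0 : ℝ) < f := by exact_mod_cast hf0
      have : (3 : ℝ) * f < n := by nlinarith
      exact_mod_cast this
  intro N H hH x byz hfair
  set T := RBTM.iterations n f ε N
  -- With a single tape, almost sure fairness is fairness on that tape, and expectations are values.
  have hsub : Subsingleton ((rbtm n f d ε N).Tapes H) :=
    inferInstanceAs (Subsingleton (H → ℕ → Unit))
  obtain ⟨ω, hω⟩ := hfair.exists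
  obtain ⟨X, hX0, hnext, hdec⟩ := RBTM.exists_trajectory_of_fair (T := T) x byz ω hH hf hω
  have hX : Trajectory H f T X := ⟨hnext⟩
  have hout : (rbtm n f d ε N).outputs x byz ω = X T :=
    funext fun j => (rbtm n f d ε N).outputs_eq (hdec j)
  obtain ⟨j₀, hj₀⟩ : H.Nonempty := Finset.card_pos.mp (by omega)
  have hcard : (H.card : ℝ) = (n : ℝ) - f := by
    have : (H.card : ℝ) + f = n := by exact_mod_cast hH
    linarith
  have hh : (0 : ℝ) < (n : ℝ) - f := by
    rw [← hcard]; exact_mod_cast Finset.card_pos.mpr ⟨j₀, hj₀⟩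
  refine ⟨?_, ?_, ?_⟩
  · refine Filter.Eventually.of_forall fun ω' j => ?_
    rw [Subsingleton.elim ω' ω]
    exact ⟨_, hdec j⟩
  · rw [expectation_const _ _ ω, hout]
    refine ENNReal.ofReal_le_ofReal ((hX.diam₂_sq_le hH hf ⟨j₀, hj₀⟩).trans ?_)
    rw [hX0, hcard]
    have h2 : (0 : ℝ) < (n : ℝ) - 2 * f := by
      have : 2 * f < n := by omega
      have : (2 : ℝ) * f < n := by exact_mod_cast this
      linarith
    have h1 : (f / ((n : ℝ) - 2 * f)) ^ T ≤ 1 / (2 ^ (N + 1) * √((n : ℝ) - f)) :=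
      (pow_le_pow_left₀ (by positivity) (contraction_le hε hf hnf) T).trans
        (pow_iterations_le hε (by omega) N)
    calc ((f / ((n : ℝ) - 2 * f)) ^ T) ^ 2 * (4 * ((n : ℝ) - f) * diam₂ x ^ 2)
        ≤ (1 / (2 ^ (N + 1) * √((n : ℝ) - f))) ^ 2 * (4 * ((n : ℝ) - f) * diam₂ x ^ 2) := by
          gcongr
      _ = diam₂ x ^ 2 / 4 ^ N := by
          rw [div_pow, mul_pow, Real.sq_sqrt hh.le, one_pow, ← pow_mul, mul_comm (N + 1) 2, pow_mul,
            pow_succ]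
          norm_num
          field_simp
  · rw [expectation_const _ _ ω, hout]
    refine ENNReal.ofReal_le_ofReal ?_
    have h1 := hX.norm_mean_sub_sq_le hH hf (iterations_pos hε (by omega) N) ⟨j₀, hj₀⟩
    rw [hX0, hcard] at h1
    refine h1.trans (le_of_eq ?_)
    rw [div_pow, div_pow, Real.sq_sqrt hh.le]
    field_simp
    ring

end ByzAvg

namespace ByzAvg

namespace Protocol

variable {n d : ℕ} (A : Protocol.{u} n d) {H K : Finset (Fin n)}

/-! ### Delivery in order of sending -/

/-- The `k`-th message sent is `p`, its destination is honest, and it has not been delivered. -/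
structure Pending (c : A.Config H) (k : ℕ) (p : Packet n A.Msg) : Prop where
  get : c.sent[k]? = some p
  dst_mem : p.dst ∈ H
  notMem : k ∉ c.delivered

open Classical in
/-- The first pending message. -/
noncomputable def nextPacket (c : A.Config H) : Option (ℕ × Packet n A.Msg) :=
  if h : ∃ q : ℕ × Packet n A.Msg, A.Pending c q.1 q.2 ∧ ∀ k p, A.Pending c k p → q.1 ≤ k
  then some h.choose else none

theorem nextPacket_spec {c : A.Config H} {k : ℕ} {p : Packet n A.Msg}
    (h : A.nextPacket c = some (k, p)) :
    A.Pending c k p ∧ ∀ k' p', A.Pending c k' p' → k ≤ k' := by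
  unfold nextPacket at h
  split_ifs at h with h'
  have := h'.choose_spec
  rw [Option.some.inj h] at this
  exact this

theorem exists_nextPacket {c : A.Config H} {k : ℕ} {p : Packet n A.Msg} (h : A.Pending c k p) :
    ∃ q, A.nextPacket c = some q := by
  classical
  have h1 : ∃ k p, A.Pending c k p := ⟨k, p, h⟩
  obtain ⟨p', hp'⟩ := Nat.find_spec h1
  have h2 : ∃ q : ℕ × Packet n A.Msg, A.Pending c q.1 q.2 ∧
      ∀ k p, A.Pending c k p → q.1 ≤ k :=
    ⟨(Nat.find h1, p'), hp', fun k p hk => Nat.find_min' h1 ⟨p, hk⟩⟩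
  exact ⟨_, dif_pos h2⟩

/-- Deliver the first pending message. -/
noncomputable def fairAction (c : A.Config H) : A.Action :=
  match A.nextPacket c with
  | some q => .deliver q.1
  | none => .idle

theorem fairAction_of_some {c : A.Config H} {q : ℕ × Packet n A.Msg}
    (h : A.nextPacket c = some q) : A.fairAction c = .deliver q.1 := by
  simp [fairAction, h]

theorem fairAction_of_none {c : A.Config H} (h : A.nextPacket c = none) :
    A.fairAction c = .idle := by
  simp [fairAction, h]

theorem perform_pending (ω : A.Tapes H) {c : A.Config H} {k : ℕ} {p : Packet n A.Msg}
    (h : A.Pending c k p) : A.perform ω c (.deliver k) =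
      { A.receive ω c ⟨p.dst, h.dst_mem⟩ p.src p.msg with delivered := insert k c.delivered } :=
  A.perform_deliver ω c h.get h.dst_mem h.notMem

/-- The attack in which Byzantine nodes are silent and messages are delivered in order. -/
noncomputable def silentAttack : A.Attack H := fun c _ => A.fairAction c

/-- While position `k` is pending, each step delivers a new position that is at most `k`. This can
happen at most `k + 1` times. -/
theorem fair_of_eventually_fairAction (x : H → Vec d) (byz : A.Attack H) (ω : A.Tapes H) (t₀ : ℕ)
    (h : ∀ t ≥ t₀, A.actionAt x byz ω t = A.fairAction (A.run x byz ω t)) :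
    A.Fair x byz ω := by
  classical
  intro t k p hp hd
  by_contra! hcon
  have hpend : ∀ m, A.Pending (A.run x byz ω (max t t₀ + m)) k p := fun m =>
    ⟨A.run_sent_getElem? x byz ω (by omega) hp, hd, hcon _⟩
  have hcard : ∀ m, m ≤
      ((Finset.range (k + 1)).filter (· ∈ (A.run x byz ω (max t t₀ + m)).delivered)).card := by
    intro m
    induction m with
    | zero => exact Nat.zero_le _
    | succ m ih =>
      refine Nat.succ_le_of_lt (ih.trans_lt (Finset.card_lt_card ?_))
      obtain ⟨⟨k', p'⟩, hq⟩ := A.exists_nextPacket (hpend m)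
      obtain ⟨h1, h2⟩ := A.nextPacket_spec hq
      have h3 : (A.run x byz ω (max t t₀ + (m + 1))).delivered =
          insert k' (A.run x byz ω (max t t₀ + m)).delivered := by
        rw [← add_assoc, run_succ, h _ (by omega), A.fairAction_of_some hq,
          A.perform_pending ω h1]
      rw [h3]
      refine ⟨fun i hi => ?_, fun hsub => ?_⟩
      · rw [Finset.mem_filter] at hi ⊢
        exact ⟨hi.1, Finset.mem_insert_of_mem hi.2⟩
      · have h4 : k' ≤ k := h2 k p (hpend m)
        have h5 := hsub (Finset.mem_filter.mpr
          ⟨Finset.mem_range.mpr (Nat.lt_succ_of_le h4), Finset.mem_insert_self _ _⟩)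
        exact h1.notMem (Finset.mem_filter.mp h5).2
  have h1 := (hcard (k + 2)).trans (Finset.card_filter_le _ _)
  rw [Finset.card_range] at h1
  omega

theorem silentAttack_fair (x : H → Vec d) (ω : A.Tapes H) : A.Fair x A.silentAttack ω :=
  A.fair_of_eventually_fairAction x _ ω 0 fun _ _ => rfl

/-! ### Simulation of another system -/

/-- The messages from nodes of `H` in the list `L` occur in the list `L'`, at positions given by an
injection `e`. -/
structure Embeds (H : Finset (Fin n)) (e : ℕ → ℕ) (L L' : List (Packet n A.Msg)) : Prop where
  get : ∀ k p, L[k]? = some p → p.src ∈ H → L'[e k]? = some p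
  inj : ∀ k k' p p', L[k]? = some p → L[k']? = some p' → p.src ∈ H → p'.src ∈ H →
    e k = e k' → k = k'

theorem Embeds.of_forall_notMem {L L' : List (Packet n A.Msg)} (h : ∀ p ∈ L, p.src ∉ H)
    (e : ℕ → ℕ) : A.Embeds H e L L' :=
  ⟨fun _ p hp hs => absurd hs (h p (List.mem_of_getElem? hp)),
    fun _ _ p _ hp _ hs => absurd hs (h p (List.mem_of_getElem? hp))⟩

theorem Embeds.refl (L : List (Packet n A.Msg)) : A.Embeds H id L L :=
  ⟨fun _ _ h _ => h, fun _ _ _ _ _ _ _ _ h => h⟩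

/-- The map of positions for concatenated lists. -/
def glue (e e' : ℕ → ℕ) (l l' : ℕ) (k : ℕ) : ℕ := if k < l then e k else l' + e' (k - l)

theorem Embeds.append {e e' : ℕ → ℕ} {L L' M M' : List (Packet n A.Msg)} (h : A.Embeds H e L L')
    (h' : A.Embeds H e' M M') :
    A.Embeds H (glue e e' L.length L'.length) (L ++ M) (L' ++ M') := by
  have hlt : ∀ k p, L[k]? = some p → p.src ∈ H → e k < L'.length := fun k p hp hs =>
    (List.getElem?_eq_some_iff.mp (h.get k p hp hs)).1
  refine ⟨fun k p hp hs => ?_, fun k k' p p' hp hp' hs hs' he => ?_⟩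
  · by_cases hk : k < L.length
    · rw [List.getElem?_append_left hk] at hp
      simp only [glue, hk, if_true]
      rw [List.getElem?_append_left (hlt k p hp hs)]
      exact h.get k p hp hs
    · rw [List.getElem?_append_right (not_lt.mp hk)] at hp
      simp only [glue, hk, if_false]
      rw [List.getElem?_append_right (Nat.le_add_right _ _), Nat.add_sub_cancel_left]
      exact h'.get _ p hp hs
  · by_cases hk : k < L.length <;> by_cases hk' : k' < L.length <;>
      simp only [glue, hk, hk', if_true, if_false] at he
    · rw [List.getElem?_append_left hk] at hp
      rw [List.getElem?_append_left hk'] at hp'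
      exact h.inj _ _ _ _ hp hp' hs hs' he
    · rw [List.getElem?_append_left hk] at hp
      have := hlt k p hp hs
      omega
    · rw [List.getElem?_append_left hk'] at hp'
      have := hlt k' p' hp' hs'
      omega
    · rw [List.getElem?_append_right (not_lt.mp hk)] at hp
      rw [List.getElem?_append_right (not_lt.mp hk')] at hp'
      have := h'.inj _ _ _ _ hp hp' hs hs' (by omega)
      omega

/-- The configuration `W`, with honest nodes `K`, agrees with the configuration `c`, with honest
nodes `H`, on the common honest nodes and on the messages that they have sent. -/
structure Mirrors (W : A.Config K) (c : A.Config H) (e : ℕ → ℕ) : Prop where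
  loc : ∀ (j : Fin n) (hK : j ∈ K) (hH : j ∈ H), W.loc ⟨j, hK⟩ = c.loc ⟨j, hH⟩
  embeds : A.Embeds H e W.sent c.sent
  delivered : ∀ k p, W.sent[k]? = some p → p.src ∈ H → e k ∈ c.delivered → k ∈ W.delivered
  src_mem : ∀ p ∈ W.sent, p.src ∈ K

open Classical in
/-- The action by which the next step of the simulated system is mirrored. -/
noncomputable def mirrorAction (W : A.Config K) (c : A.Config H) : A.Action :=
  match A.nextPacket W with
  | some q =>
      if q.2.dst ∈ H then
        if q.2.src ∈ H then
          if h : ∃ e, A.Mirrors W c e then .deliver (h.choose q.1) else .idle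
        else .inject q.2.src q.2.dst q.2.msg
      else .idle
  | none => .idle

open Classical in
/-- The next configuration of the simulated system, found from the configurations `c` and `c'` of
the real one before and after the step, and the coins of the simulated nodes. -/
noncomputable def mirrorNext (ρ : A.Tapes K) (W : A.Config K) (c c' : A.Config H) : A.Config K :=
  match A.nextPacket W with
  | some q =>
      if h : q.2.dst ∈ H ∧ q.2.dst ∈ K then
        { loc := Function.update W.loc ⟨q.2.dst, h.2⟩ (c'.loc ⟨q.2.dst, h.1⟩)
          sent := W.sent ++ c'.sent.drop c.sent.length
          delivered := insert q.1 W.delivered }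
      else A.perform ρ W (.deliver q.1)
  | none => W

theorem receive_congr {ω ω' : A.Tapes H} (c : A.Config H) {j : H} (h : ω j = ω' j) (src : Fin n)
    (m : A.Msg) : A.receive ω c j src m = A.receive ω' c j src m := by
  simp only [receive, h]

/-- The coins of the nodes of `H`. -/
def restrict (H : Finset (Fin n)) (Ω : Fin n → ℕ → A.Coin) : A.Tapes H := fun j => Ω j

/-- The messages that `j` sends on receipt of `m` from `src`. -/
def newPackets (ω : A.Tapes H) (c : A.Config H) (j : H) (src : Fin n) (m : A.Msg) :
    List (Packet n A.Msg) :=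
  A.packets j (A.step j (c.loc j).state src m (ω j (c.loc j).clock)).2

theorem src_of_mem_newPackets {ω : A.Tapes H} {c : A.Config H} {j : H} {src : Fin n} {m : A.Msg}
    {p : Packet n A.Msg} (h : p ∈ A.newPackets ω c j src m) : p.src = j := (A.mem_packets.mp h).1

theorem receive_sent (ω : A.Tapes H) (c : A.Config H) (j : H) (src : Fin n) (m : A.Msg) :
    (A.receive ω c j src m).sent = c.sent ++ A.newPackets ω c j src m := rfl

section Step

variable {ρ Ω : Fin n → ℕ → A.Coin} {W : A.Config K} {c : A.Config H}

/-- The recipient is honest in both systems, with the same state and coins, so it reacts equally in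
both. Its new state and packets can be read off the real configuration, without knowledge of its
coins. -/
theorem mirrors_common_step {e : ℕ → ℕ} (hM : A.Mirrors W c e)
    (hc : ∀ k ∈ c.delivered, k < c.sent.length) {k : ℕ} {p : Packet n A.Msg}
    (hp : A.Pending W k p) (hd : p.dst ∈ H) {c' : A.Config H}
    (hloc : c'.loc = (A.receive (A.restrict H Ω) c ⟨p.dst, hd⟩ p.src p.msg).loc)
    (hsent : c'.sent = (A.receive (A.restrict H Ω) c ⟨p.dst, hd⟩ p.src p.msg).sent)
    (hdel : ∀ i ∈ c'.delivered, i ∈ c.delivered ∨ p.src ∈ H ∧ i = e k) :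
    ({ loc := Function.update W.loc ⟨p.dst, hp.dst_mem⟩ (c'.loc ⟨p.dst, hd⟩)
       sent := W.sent ++ c'.sent.drop c.sent.length
       delivered := insert k W.delivered } : A.Config K) =
      A.perform (A.restrict K Ω) W (.deliver k) ∧
    ∃ e', A.Mirrors (A.perform (A.restrict K Ω) W (.deliver k)) c' e' := by
  have hl : W.loc ⟨p.dst, hp.dst_mem⟩ = c.loc ⟨p.dst, hd⟩ := hM.loc _ _ _
  have hN : A.newPackets (A.restrict K Ω) W ⟨p.dst, hp.dst_mem⟩ p.src p.msg =
      A.newPackets (A.restrict H Ω) c ⟨p.dst, hd⟩ p.src p.msg := by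
    unfold newPackets restrict
    rw [hl]
  have hlocs : (A.receive (A.restrict K Ω) W ⟨p.dst, hp.dst_mem⟩ p.src p.msg).loc ⟨p.dst, hp.dst_mem⟩ =
      c'.loc ⟨p.dst, hd⟩ := by
    rw [hloc, receive_loc_self, receive_loc_self, hl]
    rfl
  have hpk := hM.embeds.get k p hp.1
  rw [A.perform_pending _ hp]
  set e' := glue e id W.sent.length c.sent.length with he'
  rw [receive_sent] at hsent
  refine ⟨?_, e', ?_, ?_, ?_, ?_⟩
  · rw [hsent, List.drop_left, ← hN, ← hlocs, receive_loc_self]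
    rfl
  · intro j hK hH
    by_cases hj : j = p.dst
    · subst hj; exact hlocs
    · rw [hloc, A.receive_loc_of_ne _ c (fun h => hj (congrArg Subtype.val h))]
      refine Eq.trans ?_ (hM.loc j hK hH)
      exact A.receive_loc_of_ne _ W (fun h => hj (congrArg Subtype.val h)) _ _
  · rw [receive_sent, hsent, hN]
    exact hM.embeds.append A (Embeds.refl A _)
  · intro k₁ p₁ hp₁ hs₁ hdel₁
    rw [receive_sent] at hp₁
    by_cases hk₁ : k₁ < W.sent.length
    · rw [List.getElem?_append_left hk₁] at hp₁
      simp only [he', glue, hk₁, if_true] at hdel₁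
      rcases hdel _ hdel₁ with h | ⟨h1, h2⟩
      · exact Finset.mem_insert_of_mem (hM.delivered _ _ hp₁ hs₁ h)
      · rw [hM.embeds.inj _ _ _ _ hp₁ hp.get hs₁ h1 h2]
        exact Finset.mem_insert_self _ _
    · simp only [he', glue, hk₁, if_false, id] at hdel₁
      -- New packets correspond to positions past the end of `c.sent`, while every delivered
      -- position lies within it.
      exfalso
      rcases hdel _ hdel₁ with h | ⟨h1, h2⟩
      · have := hc _ h
        omega
      · have := (List.getElem?_eq_some_iff.mp (hpk h1)).1
        omega
  · intro p₁ hp₁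
    rw [receive_sent] at hp₁
    rcases List.mem_append.mp hp₁ with h | h
    · exact hM.src_mem _ h
    · rw [A.src_of_mem_newPackets h]
      exact hp.dst_mem

theorem mirrorAction_cases (hM : ∃ e, A.Mirrors W c e) :
    (A.mirrorAction W c = .idle ∧ ∀ q, A.nextPacket W = some q → q.2.dst ∉ H) ∨
    ∃ q e, A.nextPacket W = some q ∧ q.2.dst ∈ H ∧ A.Mirrors W c e ∧
      (q.2.src ∈ H ∧ A.mirrorAction W c = .deliver (e q.1) ∨
        q.2.src ∉ H ∧ A.mirrorAction W c = .inject q.2.src q.2.dst q.2.msg) := by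
  unfold mirrorAction
  cases h : A.nextPacket W with
  | none => left; simp
  | some q =>
    by_cases hd : q.2.dst ∈ H
    · right
      refine ⟨q, hM.choose, rfl, hd, hM.choose_spec, ?_⟩
      by_cases hs : q.2.src ∈ H
      · left; simp [hd, hs, hM]
      · right; simp [hd, hs]
    · left; simp [hd]

/-- A simulated delivery to a real honest node is a real delivery or an injection, according to the
sender. A delivery to a simulated Byzantine node is computed internally with the fixed coins `ρ`,
and the real system idles. -/
theorem mirror_step (hΩ : ∀ j ∉ H, Ω j = ρ j) (hM : ∃ e, A.Mirrors W c e)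
    (hc : ∀ k ∈ c.delivered, k < c.sent.length) :
    A.mirrorNext (A.restrict K ρ) W c (A.perform (A.restrict H Ω) c (A.mirrorAction W c)) =
      A.perform (A.restrict K Ω) W (A.fairAction W) ∧
    ∃ e, A.Mirrors (A.perform (A.restrict K Ω) W (A.fairAction W))
      (A.perform (A.restrict H Ω) c (A.mirrorAction W c)) e := by
  rcases A.mirrorAction_cases hM with ⟨ha, hd⟩ | ⟨⟨k, p⟩, e, hq, hd, he, h⟩
  · rw [ha]
    change A.mirrorNext (A.restrict K ρ) W c c = _ ∧ ∃ e, A.Mirrors _ c e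
    cases hq : A.nextPacket W with
    | none =>
      rw [A.fairAction_of_none hq]
      refine ⟨?_, hM⟩
      simp only [mirrorNext, hq]
      rfl
    | some q =>
      obtain ⟨k, p⟩ := q
      have hpd : p.dst ∉ H := hd _ hq
      obtain ⟨hp, -⟩ := A.nextPacket_spec hq
      have heq : A.perform (A.restrict K ρ) W (.deliver k) =
          A.perform (A.restrict K Ω) W (.deliver k) := by
        rw [A.perform_pending _ hp, A.perform_pending _ hp,
          A.receive_congr (ω := A.restrict K ρ) (ω' := A.restrict K Ω) W
            (j := ⟨p.dst, hp.dst_mem⟩) (hΩ _ hpd).symm]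
      rw [A.fairAction_of_some hq]
      refine ⟨?_, ?_⟩
      · simp only [mirrorNext, hq]
        rw [dif_neg (fun h => hpd h.1)]
        exact heq
      · obtain ⟨e, he⟩ := hM
        rw [A.perform_pending _ hp]
        refine ⟨glue e id W.sent.length c.sent.length, ?_, ?_, ?_, ?_⟩
        · intro j hK hH
          refine Eq.trans ?_ (he.loc j hK hH)
          refine A.receive_loc_of_ne _ W (fun h => ?_) _ _
          have hj : j = p.dst := congrArg Subtype.val h
          exact hpd (hj ▸ hH)
        · have h1 := he.embeds.append A (Embeds.of_forall_notMem A (L' := [])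
            (L := A.newPackets (A.restrict K Ω) W ⟨p.dst, hp.dst_mem⟩ p.src p.msg)
            (fun p' hp' => by rw [A.src_of_mem_newPackets hp']; exact hpd) id)
          rwa [List.append_nil] at h1
        · intro k₁ p₁ hp₁ hs₁ hdel₁
          rw [receive_sent] at hp₁
          by_cases hk₁ : k₁ < W.sent.length
          · rw [List.getElem?_append_left hk₁] at hp₁
            simp only [glue, hk₁, if_true] at hdel₁
            exact Finset.mem_insert_of_mem (he.delivered _ _ hp₁ hs₁ hdel₁)
          · rw [List.getElem?_append_right (not_lt.mp hk₁)] at hp₁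
            rw [A.src_of_mem_newPackets (List.mem_of_getElem? hp₁)] at hs₁
            exact absurd hs₁ hpd
        · intro p₁ hp₁
          rw [receive_sent] at hp₁
          rcases List.mem_append.mp hp₁ with h | h
          · exact he.src_mem _ h
          · rw [A.src_of_mem_newPackets h]
            exact hp.dst_mem
  · obtain ⟨hp, -⟩ := A.nextPacket_spec hq
    have key : ∀ c' : A.Config H,
        c'.loc = (A.receive (A.restrict H Ω) c ⟨p.dst, hd⟩ p.src p.msg).loc →
        c'.sent = (A.receive (A.restrict H Ω) c ⟨p.dst, hd⟩ p.src p.msg).sent →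
        (∀ i ∈ c'.delivered, i ∈ c.delivered ∨ p.src ∈ H ∧ i = e k) →
        A.mirrorNext (A.restrict K ρ) W c c' =
          A.perform (A.restrict K Ω) W (A.fairAction W) ∧
        ∃ e, A.Mirrors (A.perform (A.restrict K Ω) W (A.fairAction W)) c' e := by
      intro c' h1 h2 h3
      rw [A.fairAction_of_some hq]
      obtain ⟨h4, h5⟩ := A.mirrors_common_step he hc hp hd h1 h2 h3
      refine ⟨?_, h5⟩
      rw [← h4]
      simp only [mirrorNext, hq]
      rw [dif_pos ⟨hd, hp.dst_mem⟩]
    rcases h with ⟨hs, ha⟩ | ⟨hs, ha⟩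
    · rw [ha]
      have hpc : A.Pending c (e k) p := ⟨he.embeds.get k p hp.get hs, hd, fun hdel =>
        hp.notMem (he.delivered k p hp.get hs hdel)⟩
      refine key _ ?_ ?_ ?_
      · rw [A.perform_pending _ hpc]
      · rw [A.perform_pending _ hpc]
      · rw [A.perform_pending _ hpc]
        intro i hi
        rcases Finset.mem_insert.mp hi with h | h
        · exact Or.inr ⟨hs, h⟩
        · exact Or.inl h
    · rw [ha]
      have hi := A.perform_inject (A.restrict H Ω) c p.msg hd hs
      refine key _ ?_ ?_ ?_
      · rw [hi]
      · rw [hi]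
      · rw [hi]
        exact fun i hi => Or.inl hi

/-- A step that mirrors one simulated system does not affect another one, with no common nodes. -/
theorem mirror_step_other {K' : Finset (Fin n)} {W' : A.Config K'}
    (hM : ∃ e, A.Mirrors W c e) (hKK : ∀ j ∈ H, j ∈ K → j ∉ K') {e' : ℕ → ℕ}
    (hM' : A.Mirrors W' c e') :
    A.Mirrors W' (A.perform (A.restrict H Ω) c (A.mirrorAction W c)) e' := by
  rcases A.mirrorAction_cases hM with ⟨ha, hd⟩ | ⟨⟨k, p⟩, e, hq, hd, he, h⟩
  · rw [ha]; exact hM'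
  · obtain ⟨hp, -⟩ := A.nextPacket_spec hq
    have key : ∀ c' : A.Config H,
        c'.loc = (A.receive (A.restrict H Ω) c ⟨p.dst, hd⟩ p.src p.msg).loc →
        c'.sent = (A.receive (A.restrict H Ω) c ⟨p.dst, hd⟩ p.src p.msg).sent →
        (∀ i ∈ c'.delivered, i ∈ c.delivered ∨ p.src ∈ H ∧ i = e k) →
        A.Mirrors W' c' e' := by
      intro c' h1 h2 h3
      refine ⟨fun j hK hH => ?_, ⟨fun k₁ p₁ hp₁ hs₁ => ?_, hM'.embeds.inj⟩,
        fun k₁ p₁ hp₁ hs₁ hdel₁ => ?_, hM'.src_mem⟩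
      · rw [h1, hM'.loc j hK hH]
        refine (A.receive_loc_of_ne _ c (fun h => ?_) _ _).symm
        have hj : j = p.dst := congrArg Subtype.val h
        exact hKK _ hd hp.dst_mem (hj ▸ hK)
      · have h4 := hM'.embeds.get k₁ p₁ hp₁ hs₁
        rw [h2, receive_sent, List.getElem?_append_left (List.getElem?_eq_some_iff.mp h4).1, h4]
      · rcases h3 _ hdel₁ with h | ⟨hs, h⟩
        · exact hM'.delivered _ _ hp₁ hs₁ h
        · exfalso
          have h4 := hM'.embeds.get k₁ p₁ hp₁ hs₁
          rw [h, he.embeds.get k p hp.get hs] at h4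
          obtain rfl := Option.some.inj h4
          exact hKK _ hs (he.src_mem _ (List.mem_of_getElem? hp.get))
            (hM'.src_mem _ (List.mem_of_getElem? hp₁))
    rcases h with ⟨hs, ha⟩ | ⟨hs, ha⟩
    · rw [ha]
      have hpc : A.Pending c (e k) p := ⟨he.embeds.get k p hp.get hs, hd, fun hdel =>
        hp.notMem (he.delivered k p hp.get hs hdel)⟩
      refine key _ ?_ ?_ ?_
      · rw [A.perform_pending _ hpc]
      · rw [A.perform_pending _ hpc]
      · rw [A.perform_pending _ hpc]
        intro i hi
        rcases Finset.mem_insert.mp hi with h | h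
        · exact Or.inr ⟨hs, h⟩
        · exact Or.inl h
    · rw [ha]
      have hi := A.perform_inject (A.restrict H Ω) c p.msg hd hs
      refine key _ ?_ ?_ ?_
      · rw [hi]
      · rw [hi]
      · rw [hi]
        exact fun i hi => Or.inl hi

end Step

end Protocol

end ByzAvg

/-! ### The attack that shows different worlds to two groups of honest nodes. -/

namespace ByzAvg

namespace Protocol

variable {n d : ℕ} (A : Protocol.{u} n d) {H K K₁ K₂ : Finset (Fin n)}

/-- The initial configuration of the simulated system, found from that of the real system and the
coins of the simulated nodes. -/
noncomputable def mirrorInit (ρ : A.Tapes K) (x : K → Vec d) (c : A.Config H) : A.Config K where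
  loc j := if h : (j : Fin n) ∈ H then c.loc ⟨j, h⟩ else (A.initialConfig x ρ).loc j
  sent := (List.finRange n).flatMap fun j =>
    if hK : j ∈ K then
      if j ∈ H then c.sent.filter fun p => p.src = j else A.packets j (A.start x ρ ⟨j, hK⟩).2
    else []
  delivered := ∅

/-- The attack sees only the joint list of initial packets. Filtering by sender recovers what each
honest node sent, without its coins. -/
theorem filter_flatMap_src {g : Fin n → List (Packet n A.Msg)} (hg : ∀ j, ∀ p ∈ g j, p.src = j)
    (j : Fin n) {L : List (Fin n)} (hL : L.Nodup) :
    (L.flatMap g).filter (fun p => p.src = j) = if j ∈ L then g j else [] := by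
  induction L with
  | nil => simp
  | cons i L ih =>
    obtain ⟨hi, hL⟩ := List.nodup_cons.mp hL
    rw [List.flatMap_cons, List.filter_append, ih hL]
    by_cases hj : j = i
    · subst hj
      have : (g j).filter (fun p => p.src = j) = g j :=
        List.filter_eq_self.mpr fun p hp => by simpa using hg j p hp
      simp [hi, this]
    · have : (g i).filter (fun p => p.src = j) = [] :=
        List.filter_eq_nil_iff.mpr fun p hp => by
          rw [hg i p hp]; simpa using fun h => hj h.symm
      simp [hj, this]

theorem exists_embeds_flatMap {g g' : Fin n → List (Packet n A.Msg)}
    (hg : ∀ j, ∀ p ∈ g j, p.src = j) (hgg : ∀ j ∈ H, g j = [] ∨ g j = g' j) (L : List (Fin n)) :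
    ∃ e, A.Embeds H e (L.flatMap g) (L.flatMap g') := by
  induction L with
  | nil => exact ⟨id, Embeds.refl A _⟩
  | cons i L ih =>
    obtain ⟨e, he⟩ := ih
    have h : ∃ e, A.Embeds H e (g i) (g' i) := by
      by_cases hi : i ∈ H
      · rcases hgg i hi with h | h
        · exact ⟨id, Embeds.of_forall_notMem A (by simp [h]) _⟩
        · rw [h]; exact ⟨id, Embeds.refl A _⟩
      · exact ⟨id, Embeds.of_forall_notMem A (fun p hp => by rw [hg i p hp]; exact hi) _⟩
    obtain ⟨e', he'⟩ := h
    rw [List.flatMap_cons, List.flatMap_cons]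
    exact ⟨_, he'.append A he⟩

section Init

variable {ρ Ω : Fin n → ℕ → A.Coin} {x : H → Vec d} {y : K → Vec d}

/-- The messages sent by node `j` when it starts. -/
def startPackets (x : H → Vec d) (ω : A.Tapes H) (j : Fin n) : List (Packet n A.Msg) :=
  if hj : j ∈ H then A.packets j (A.start x ω ⟨j, hj⟩).2 else []

theorem src_of_mem_startPackets {ω : A.Tapes H} {j : Fin n} {p : Packet n A.Msg}
    (hp : p ∈ A.startPackets x ω j) : p.src = j := by
  unfold startPackets at hp
  split_ifs at hp
  · exact (A.mem_packets.mp hp).1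
  · simp at hp

theorem start_congr (hxy : ∀ j (hK : j ∈ K) (hH : j ∈ H), y ⟨j, hK⟩ = x ⟨j, hH⟩) {j : Fin n}
    (hK : j ∈ K) (hH : j ∈ H) :
    A.start y (A.restrict K Ω) ⟨j, hK⟩ = A.start x (A.restrict H Ω) ⟨j, hH⟩ := by
  simp only [start, restrict, hxy j hK hH]

theorem mirrorInit_eq (hΩ : ∀ j ∉ H, Ω j = ρ j)
    (hxy : ∀ j (hK : j ∈ K) (hH : j ∈ H), y ⟨j, hK⟩ = x ⟨j, hH⟩) :
    A.mirrorInit (A.restrict K ρ) y (A.initialConfig x (A.restrict H Ω)) =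
      A.initialConfig y (A.restrict K Ω) := by
  have hs : ∀ j (hK : j ∈ K), j ∉ H →
      A.start y (A.restrict K ρ) ⟨j, hK⟩ = A.start y (A.restrict K Ω) ⟨j, hK⟩ := fun j hK hH => by
    simp only [start, restrict, hΩ j hH]
  unfold mirrorInit
  conv_rhs => unfold initialConfig
  congr 1
  · funext ⟨j, hK⟩
    by_cases hH : j ∈ H
    · simp only [hH, dif_pos, initialConfig, A.start_congr hxy hK hH]
    · simp only [hH, dif_neg, not_false_eq_true, initialConfig, hs j hK hH]
  · congr 1
    funext j
    by_cases hK : j ∈ K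
    · by_cases hH : j ∈ H
      · simp only [hK, hH, dif_pos, if_true]
        have := A.filter_flatMap_src (g := A.startPackets x (A.restrict H Ω))
          (fun j p hp => A.src_of_mem_startPackets hp) j (List.nodup_finRange n)
        refine this.trans ?_
        simp [startPackets, hH, A.start_congr hxy hK hH]
      · simp only [hK, hH, dif_pos, if_false, hs j hK hH]
    · simp only [hK, dif_neg, not_false_eq_true]

theorem mirrors_initial (hxy : ∀ j (hK : j ∈ K) (hH : j ∈ H), y ⟨j, hK⟩ = x ⟨j, hH⟩) :
    ∃ e, A.Mirrors (A.initialConfig y (A.restrict K Ω))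
      (A.initialConfig x (A.restrict H Ω)) e := by
  obtain ⟨e, he⟩ := A.exists_embeds_flatMap (H := H)
    (g := A.startPackets y (A.restrict K Ω)) (g' := A.startPackets x (A.restrict H Ω))
    (fun j p hp => A.src_of_mem_startPackets hp) (fun j hH => by
      by_cases hK : j ∈ K
      · right; simp only [startPackets, hK, hH, dif_pos, A.start_congr hxy hK hH]
      · left; simp only [startPackets, hK, dif_neg, not_false_eq_true]) (List.finRange n)
  refine ⟨e, fun j hK hH => ?_, he, ?_, ?_⟩
  · simp only [initialConfig, A.start_congr hxy hK hH]
  · intro k p _ _ h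
    simp [initialConfig] at h
  · intro p hp
    exact (A.mem_initial_sent y _).mp hp |>.1

end Init

/-- Some node of `K` has not output anything. -/
def Undecided (K : Finset (Fin n)) (c : A.Config H) : Prop :=
  ∃ j : H, (j : Fin n) ∈ K ∧ (c.loc j).decided = none

open Classical in
/-- The configurations of the two simulated systems. -/
noncomputable def simulate (ρ₁ : A.Tapes K₁) (ρ₂ : A.Tapes K₂) (x₁ : K₁ → Vec d)
    (x₂ : K₂ → Vec d) : A.Config H → List (A.Config H) → A.Config K₁ × A.Config K₂
  | c, [] => (A.mirrorInit ρ₁ x₁ c, A.mirrorInit ρ₂ x₂ c)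
  | c, c' :: l =>
      if A.Undecided K₁ c' then
        (A.mirrorNext ρ₁ (simulate ρ₁ ρ₂ x₁ x₂ c' l).1 c' c, (simulate ρ₁ ρ₂ x₁ x₂ c' l).2)
      else if A.Undecided K₂ c' then
        ((simulate ρ₁ ρ₂ x₁ x₂ c' l).1, A.mirrorNext ρ₂ (simulate ρ₁ ρ₂ x₁ x₂ c' l).2 c' c)
      else simulate ρ₁ ρ₂ x₁ x₂ c' l

open Classical in
/-- The attack that shows one simulated system to the honest nodes of `K₁` and another one to those
of `K₂`, until all of them have output a vector. -/
noncomputable def splitAttack (ρ₁ : A.Tapes K₁) (ρ₂ : A.Tapes K₂) (x₁ : K₁ → Vec d)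
    (x₂ : K₂ → Vec d) : A.Attack H := fun c l =>
  if A.Undecided K₁ c then A.mirrorAction (A.simulate ρ₁ ρ₂ x₁ x₂ c l).1 c
  else if A.Undecided K₂ c then A.mirrorAction (A.simulate ρ₁ ρ₂ x₁ x₂ c l).2 c
  else A.fairAction c

section Split

variable {ρ Ω : Fin n → ℕ → A.Coin} {x : H → Vec d} {x₁ : K₁ → Vec d} {x₂ : K₂ → Vec d}

/-- Mirrored nodes have decided in the real system exactly when they have in the simulated one, and
there they all have by time `τ`. So the attack stops playing this world after at most `τ` steps. -/
theorem lt_of_undecided {c : A.Config H} {s τ : ℕ} {e : ℕ → ℕ}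
    (hM : A.Mirrors (A.run x₁ A.silentAttack (A.restrict K₁ Ω) s) c e) (hU : A.Undecided K₁ c)
    (hτ : ∀ j, ∃ v, ((A.run x₁ A.silentAttack (A.restrict K₁ Ω) τ).loc j).decided = some v) :
    s < τ := by
  by_contra hcon
  obtain ⟨⟨j, hH⟩, hK, hj⟩ := hU
  obtain ⟨v, hv⟩ := hτ ⟨j, hK⟩
  have h1 := A.run_decided_mono x₁ _ _ (not_lt.mp hcon) hv
  rw [hM.loc j hK hH, hj] at h1
  cases h1

/-- Up to time `t` the attack has shown the first steps of the two simulated systems. -/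
def Synced (ρ Ω : Fin n → ℕ → A.Coin) (x : H → Vec d) (x₁ : K₁ → Vec d) (x₂ : K₂ → Vec d)
    (t t₁ t₂ : ℕ) : Prop :=
  let h := A.history x (A.splitAttack (A.restrict K₁ ρ) (A.restrict K₂ ρ) x₁ x₂) (A.restrict H Ω) t
  A.simulate (A.restrict K₁ ρ) (A.restrict K₂ ρ) x₁ x₂ h.1 h.2 =
      (A.run x₁ A.silentAttack (A.restrict K₁ Ω) t₁,
        A.run x₂ A.silentAttack (A.restrict K₂ Ω) t₂) ∧
    (∃ e, A.Mirrors (A.run x₁ A.silentAttack (A.restrict K₁ Ω) t₁) h.1 e) ∧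
    (∃ e, A.Mirrors (A.run x₂ A.silentAttack (A.restrict K₂ Ω) t₂) h.1 e)

theorem synced_zero (hΩ : ∀ j ∉ H, Ω j = ρ j)
    (hx₁ : ∀ j (hK : j ∈ K₁) (hH : j ∈ H), x₁ ⟨j, hK⟩ = x ⟨j, hH⟩)
    (hx₂ : ∀ j (hK : j ∈ K₂) (hH : j ∈ H), x₂ ⟨j, hK⟩ = x ⟨j, hH⟩) :
    A.Synced ρ Ω x x₁ x₂ 0 0 0 :=
  ⟨Prod.ext (A.mirrorInit_eq hΩ hx₁) (A.mirrorInit_eq hΩ hx₂), A.mirrors_initial hx₁,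
    A.mirrors_initial hx₂⟩

/-- Each step moves one world forward by `mirror_step`. The other is unaffected by
`mirror_step_other`, since the two share no real honest node. -/
theorem synced_succ (hΩ : ∀ j ∉ H, Ω j = ρ j) (hK : ∀ j ∈ H, j ∈ K₁ → j ∉ K₂) {t t₁ t₂ : ℕ}
    (hS : A.Synced ρ Ω x x₁ x₂ t t₁ t₂) :
    (A.Undecided K₁ (A.run x (A.splitAttack (A.restrict K₁ ρ) (A.restrict K₂ ρ) x₁ x₂)
        (A.restrict H Ω) t) → A.Synced ρ Ω x x₁ x₂ (t + 1) (t₁ + 1) t₂) ∧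
    (¬ A.Undecided K₁ (A.run x (A.splitAttack (A.restrict K₁ ρ) (A.restrict K₂ ρ) x₁ x₂)
        (A.restrict H Ω) t) →
      A.Undecided K₂ (A.run x (A.splitAttack (A.restrict K₁ ρ) (A.restrict K₂ ρ) x₁ x₂)
        (A.restrict H Ω) t) → A.Synced ρ Ω x x₁ x₂ (t + 1) t₁ (t₂ + 1)) := by
  obtain ⟨h1, h2, h3⟩ := hS
  set byz : A.Attack H := A.splitAttack (A.restrict K₁ ρ) (A.restrict K₂ ρ) x₁ x₂ with hbyz
  have hlt := A.run_delivered_lt x byz (A.restrict H Ω) t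
  have hact : A.actionAt x byz (A.restrict H Ω) t = _ := rfl
  conv_rhs at hact => simp only [actionAt, hbyz, splitAttack]
  unfold Synced
  change A.simulate _ _ _ _ (A.history x byz (A.restrict H Ω) t).1
    (A.history x byz (A.restrict H Ω) t).2 = _ at h1
  rw [← hbyz, h1] at hact
  have hhist : A.history x byz (A.restrict H Ω) (t + 1) =
    (A.perform (A.restrict H Ω) (A.run x byz (A.restrict H Ω) t)
      (A.actionAt x byz (A.restrict H Ω) t),
      (A.history x byz (A.restrict H Ω) t).1 :: (A.history x byz (A.restrict H Ω) t).2) := rfl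
  have hr : (A.history x byz (A.restrict H Ω) t).1 = A.run x byz (A.restrict H Ω) t := rfl
  rw [← hbyz, hhist]
  simp only [simulate, h1]
  rw [run_succ, run_succ, hr]
  rw [hr] at hact h2 h3
  constructor
  · intro hU
    rw [if_pos hU] at hact
    rw [if_pos hU, hact]
    obtain ⟨h4, h5⟩ := A.mirror_step hΩ h2 hlt
    exact ⟨Prod.ext h4 rfl, h5, h3.imp fun e he => A.mirror_step_other h2 hK he⟩
  · intro hU hU₂
    rw [if_neg hU, if_pos hU₂] at hact
    rw [if_neg hU, if_pos hU₂, hact]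
    obtain ⟨h4, h5⟩ := A.mirror_step hΩ h3 hlt
    exact ⟨Prod.ext rfl h4,
      h2.imp fun e he => A.mirror_step_other h3 (fun j hj h h' => hK j hj h' h) he, h5⟩

/-- Under this attack, the honest nodes of `K₁` and those of `K₂` output what they output in the two
simulated systems. -/
theorem splitAttack_decides (hΩ : ∀ j ∉ H, Ω j = ρ j) (hK : ∀ j ∈ H, j ∈ K₁ → j ∉ K₂)
    (hx₁ : ∀ j (hK : j ∈ K₁) (hH : j ∈ H), x₁ ⟨j, hK⟩ = x ⟨j, hH⟩)
    (hx₂ : ∀ j (hK : j ∈ K₂) (hH : j ∈ H), x₂ ⟨j, hK⟩ = x ⟨j, hH⟩) {y₁ : K₁ → Vec d}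
    {y₂ : K₂ → Vec d} (hy₁ : ∀ j, A.Decides x₁ A.silentAttack (A.restrict K₁ Ω) j (y₁ j))
    (hy₂ : ∀ j, A.Decides x₂ A.silentAttack (A.restrict K₂ Ω) j (y₂ j)) :
    A.Fair x (A.splitAttack (A.restrict K₁ ρ) (A.restrict K₂ ρ) x₁ x₂) (A.restrict H Ω) ∧
    (∀ j (hK : j ∈ K₁) (hH : j ∈ H), A.Decides x
      (A.splitAttack (A.restrict K₁ ρ) (A.restrict K₂ ρ) x₁ x₂) (A.restrict H Ω) ⟨j, hH⟩
      (y₁ ⟨j, hK⟩)) ∧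
    (∀ j (hK : j ∈ K₂) (hH : j ∈ H), A.Decides x
      (A.splitAttack (A.restrict K₁ ρ) (A.restrict K₂ ρ) x₁ x₂) (A.restrict H Ω) ⟨j, hH⟩
      (y₂ ⟨j, hK⟩)) := by
  classical
  choose s₁ hs₁ using hy₁
  choose s₂ hs₂ using hy₂
  set τ₁ := Finset.univ.sup s₁
  set τ₂ := Finset.univ.sup s₂
  have hτ₁ : ∀ j, ((A.run x₁ A.silentAttack (A.restrict K₁ Ω) τ₁).loc j).decided = some (y₁ j) :=
    fun j => A.run_decided_mono x₁ _ _ (Finset.le_sup (Finset.mem_univ j)) (hs₁ j)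
  have hτ₂ : ∀ j, ((A.run x₂ A.silentAttack (A.restrict K₂ Ω) τ₂).loc j).decided = some (y₂ j) :=
    fun j => A.run_decided_mono x₂ _ _ (Finset.le_sup (Finset.mem_univ j)) (hs₂ j)
  set byz : A.Attack H := A.splitAttack (A.restrict K₁ ρ) (A.restrict K₂ ρ) x₁ x₂ with hbyz
  let U : ℕ → Prop := fun t => A.Undecided K₁ (A.run x byz (A.restrict H Ω) t) ∨
    A.Undecided K₂ (A.run x byz (A.restrict H Ω) t)
  have hbound : ∀ t t₁ t₂, A.Synced ρ Ω x x₁ x₂ t t₁ t₂ → t₁ ≤ τ₁ → t₂ ≤ τ₂ → U t →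
      ∃ t₁' ≤ τ₁, ∃ t₂' ≤ τ₂, t₁' + t₂' = t₁ + t₂ + 1 ∧
        A.Synced ρ Ω x x₁ x₂ (t + 1) t₁' t₂' := by
    intro t t₁ t₂ hS h1 h2 hU
    obtain ⟨g1, g2⟩ := A.synced_succ hΩ hK hS
    obtain ⟨-, ⟨e₁, he₁⟩, ⟨e₂, he₂⟩⟩ := hS
    by_cases hU₁ : A.Undecided K₁ (A.run x byz (A.restrict H Ω) t)
    · have := A.lt_of_undecided he₁ hU₁ (fun j => ⟨_, hτ₁ j⟩)
      exact ⟨t₁ + 1, this, t₂, h2, by omega, g1 hU₁⟩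
    · have hU₂ := hU.resolve_left hU₁
      have := A.lt_of_undecided he₂ hU₂ (fun j => ⟨_, hτ₂ j⟩)
      exact ⟨t₁, h1, t₂ + 1, this, by omega, g2 hU₁ hU₂⟩
  -- The real clock is the sum of the two simulated ones, so some node can be undecided for at most
  -- `τ₁ + τ₂` steps.
  have hsync : ∀ t, (∀ s < t, U s) → ∃ t₁ ≤ τ₁, ∃ t₂ ≤ τ₂, t₁ + t₂ = t ∧
      A.Synced ρ Ω x x₁ x₂ t t₁ t₂ := by
    intro t
    induction t with
    | zero => exact fun _ => ⟨0, Nat.zero_le _, 0, Nat.zero_le _, rfl, A.synced_zero hΩ hx₁ hx₂⟩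
    | succ t ih =>
      intro hU
      obtain ⟨t₁, h1, t₂, h2, h3, hS⟩ := ih fun s hs => hU s (Nat.lt_succ_of_lt hs)
      obtain ⟨t₁', h1', t₂', h2', h3', hS'⟩ := hbound t t₁ t₂ hS h1 h2 (hU t (Nat.lt_succ_self t))
      exact ⟨t₁', h1', t₂', h2', by omega, hS'⟩
  have hex : ∃ t, ¬ U t := by
    by_contra! hcon
    obtain ⟨t₁, h1, t₂, h2, h3, -⟩ := hsync (τ₁ + τ₂ + 1) fun s _ => hcon s
    omega
  obtain ⟨t₁, h1, t₂, h2, -, -, ⟨e₁, he₁⟩, ⟨e₂, he₂⟩⟩ :=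
    hsync (Nat.find hex) fun s hs => not_not.mp (Nat.find_min hex hs)
  have hdone := Nat.find_spec hex
  set t := Nat.find hex
  have hdec : ∀ (K : Finset (Fin n)), ¬ A.Undecided K (A.run x byz (A.restrict H Ω) t) →
      ∀ j (_ : j ∈ K) (hH : j ∈ H),
        ∃ v, ((A.run x byz (A.restrict H Ω) t).loc ⟨j, hH⟩).decided = some v := by
    intro K hU j hK hH
    rw [← Option.ne_none_iff_exists']
    exact fun h => hU ⟨⟨j, hH⟩, hK, h⟩
  have hstay : ∀ (K : Finset (Fin n)), ¬ A.Undecided K (A.run x byz (A.restrict H Ω) t) →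
      ∀ s ≥ t, ¬ A.Undecided K (A.run x byz (A.restrict H Ω) s) := by
    rintro K hU s hs ⟨⟨j, hH⟩, hK, h⟩
    obtain ⟨v, hv⟩ := hdec K hU j hK hH
    rw [A.run_decided_mono x byz _ hs hv] at h
    cases h
  have hU₁ := fun h => hdone (Or.inl h)
  have hU₂ := fun h => hdone (Or.inr h)
  refine ⟨A.fair_of_eventually_fairAction x byz _ t fun s hs => ?_, ?_, ?_⟩
  -- From time `t` on everything withheld is delivered in order, which makes the attack fair.
  · exact (if_neg (hstay K₁ hU₁ s hs)).trans (if_neg (hstay K₂ hU₂ s hs))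
  · intro j hK hH
    obtain ⟨v, hv⟩ := hdec K₁ hU₁ j hK hH
    have h3 := hv
    change ((A.history x byz (A.restrict H Ω) t).1.loc ⟨j, hH⟩).decided = some v at h3
    rw [← he₁.loc j hK hH] at h3
    rw [Decides.unique A ⟨_, hτ₁ ⟨j, hK⟩⟩ ⟨_, h3⟩]
    exact ⟨t, hv⟩
  · intro j hK hH
    obtain ⟨v, hv⟩ := hdec K₂ hU₂ j hK hH
    have h3 := hv
    change ((A.history x byz (A.restrict H Ω) t).1.loc ⟨j, hH⟩).decided = some v at h3
    rw [← he₂.loc j hK hH] at h3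
    rw [Decides.unique A ⟨_, hτ₂ ⟨j, hK⟩⟩ ⟨_, h3⟩]
    exact ⟨t, hv⟩

end Split

end Protocol

end ByzAvg

namespace ByzAvg

/-! ### Impossibility -/

/-- `X` need not be measurable. The infimum of a sequence of measurable majorants with integrals
tending to `0` still is, and it vanishes almost everywhere. -/
theorem ae_eq_zero_of_expectation {Ω : Type*} [MeasurableSpace Ω] {P : Measure Ω}
    {X : Ω → ℝ≥0∞} (h : expectation P X ≤ 0) : ∀ᵐ ω ∂P, X ω = 0 := by
  have h1 : ∀ k : ℕ, ∃ g : Ω → ℝ≥0∞, Measurable g ∧ X ≤ g ∧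
      ∫⁻ ω, g ω ∂P < ((k : ℝ≥0∞) + 1)⁻¹ := by
    intro k
    have h2 : expectation P X < ((k : ℝ≥0∞) + 1)⁻¹ :=
      h.trans_lt (ENNReal.inv_pos.mpr (by finiteness))
    unfold expectation at h2
    simp only [iInf_lt_iff] at h2
    obtain ⟨g, hg, hX, hlt⟩ := h2
    exact ⟨g, hg, hX, hlt⟩
  choose g hg hX hlt using h1
  have hm : Measurable fun ω => ⨅ k, g k ω := Measurable.iInf hg
  have h3 : ∫⁻ ω, ⨅ k, g k ω ∂P = 0 := by
    refine le_antisymm (ENNReal.le_of_forall_pos_le_add fun ε hε _ => ?_) zero_le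
    obtain ⟨k, hk⟩ := ENNReal.exists_inv_nat_lt (a := (ε : ℝ≥0∞)) (by exact_mod_cast hε.ne')
    rw [zero_add]
    calc ∫⁻ ω, ⨅ k, g k ω ∂P ≤ ∫⁻ ω, g k ω ∂P := lintegral_mono fun ω => iInf_le _ k
      _ ≤ ((k : ℝ≥0∞) + 1)⁻¹ := (hlt k).le
      _ ≤ (k : ℝ≥0∞)⁻¹ := ENNReal.inv_le_inv.mpr le_self_add
      _ ≤ ε := hk.le
  filter_upwards [(lintegral_eq_zero_iff hm).mp h3] with ω hω
  exact le_antisymm ((le_iInf fun k => hX k ω).trans hω.le) zero_le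

theorem le_expectation {Ω : Type*} [MeasurableSpace Ω] {P : Measure Ω} [IsProbabilityMeasure P]
    {X : Ω → ℝ≥0∞} {c : ℝ≥0∞} (h : ∀ᵐ ω ∂P, c ≤ X ω) : c ≤ expectation P X := by
  refine le_iInf₂ fun g hg => le_iInf fun hX => ?_
  calc c = ∫⁻ _, c ∂P := by simp
    _ ≤ ∫⁻ ω, g ω ∂P := lintegral_mono_ae (h.mono fun ω hω => hω.trans (hX ω))

namespace Protocol

variable {n d : ℕ} (A : Protocol.{u} n d)

/-- The law of the coins of all nodes. -/
noncomputable def fullLaw : Measure (Fin n → ℕ → A.Coin) :=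
  Measure.pi fun _ => Measure.infinitePi fun _ : ℕ => (A.coinLaw : Measure A.Coin)

/-- This puts the two simulated worlds and the real one on one probability space. Only their
marginal laws matter, so worlds that share nodes do no harm. -/
theorem measurePreserving_restrict (H : Finset (Fin n)) :
    MeasurePreserving (A.restrict H) A.fullLaw (A.tapeLaw H) := by
  classical
  have h := measurePreserving_piEquivPiSubtypeProd
    (fun _ : Fin n => Measure.infinitePi fun _ : ℕ => (A.coinLaw : Measure A.Coin)) (· ∈ H)
  have h2 := measurePreserving_fst.comp h
  convert! h2 using 1
  unfold tapeLaw
  congr!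

/-- By Fubini, almost every choice of the coins outside `H` is good for almost all coins of `H`. One
such choice is built into the attack, which is deterministic. -/
theorem exists_tape_off (H : Finset (Fin n)) {p : (Fin n → ℕ → A.Coin) → Prop}
    (hp : ∀ᵐ Ω ∂A.fullLaw, p Ω) : ∃ ρ : Fin n → ℕ → A.Coin, ∀ᵐ ω ∂A.tapeLaw H,
      ∃ Ω, A.restrict H Ω = ω ∧ (∀ j ∉ H, Ω j = ρ j) ∧ p Ω := by
  classical
  have h := measurePreserving_piEquivPiSubtypeProd
    (fun _ : Fin n => Measure.infinitePi fun _ : ℕ => (A.coinLaw : Measure A.Coin)) (· ∈ H)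
  set e := MeasurableEquiv.piEquivPiSubtypeProd (fun _ : Fin n => ℕ → A.Coin) (· ∈ H) with he
  set ν := Measure.pi fun _ : {j // ¬ j ∈ H} =>
    Measure.infinitePi fun _ : ℕ => (A.coinLaw : Measure A.Coin) with hν
  have h1 : ∀ᵐ q ∂(A.tapeLaw H).prod ν, p (e.symm q) := by
    convert! (h.symm e).quasiMeasurePreserving.ae hp using 3
    unfold tapeLaw
    congr!
  have h2 := (Measure.measurePreserving_swap (μ := ν)
    (ν := A.tapeLaw H)).quasiMeasurePreserving.ae h1
  obtain ⟨ρ', hρ'⟩ := (Measure.ae_ae_of_ae_prod h2).exists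
  -- Arbitrary coins on `H`, needed only to make `ρ` a total function.
  have hne : Nonempty (∀ j : {j // j ∈ H}, ℕ → A.Coin) := by
    obtain ⟨q, -⟩ := h1.exists
    exact ⟨q.1⟩
  obtain ⟨ω₀⟩ := hne
  refine ⟨e.symm (ω₀, ρ'), ?_⟩
  filter_upwards [hρ'] with ω hω
  refine ⟨e.symm (ω, ρ'), ?_, fun j hj => ?_, hω⟩
  · funext j
    change (Equiv.piEquivPiSubtypeProd (· ∈ H) fun _ : Fin n => ℕ → A.Coin).symm (ω, ρ') j = ω j
    simp [Equiv.piEquivPiSubtypeProd]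
  · change (Equiv.piEquivPiSubtypeProd (· ∈ H) fun _ : Fin n => ℕ → A.Coin).symm (ω, ρ') j =
      (Equiv.piEquivPiSubtypeProd (· ∈ H) fun _ : Fin n => ℕ → A.Coin).symm (ω₀, ρ') j
    simp [Equiv.piEquivPiSubtypeProd, hj]

end Protocol

/-- For equal inputs both bounds are `0`, whatever `C` is. So the outputs almost surely coincide and
equal their mean, which is `v`. -/
theorem decides_const {n d f : ℕ} {A : Algorithm.{u} n d} {C : ℝ}
    (h : AchievesAveragingAgreement f A C) (N : ℕ) {K : Finset (Fin n)} (hK : K.card + f = n)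
    (v : Vec d) : ∀ᵐ ω ∂(A N).tapeLaw K, ∀ j : K,
      (A N).Decides (fun _ => v) (A N).silentAttack ω j v := by
  obtain ⟨h1, h2, h3⟩ := h N K hK (fun _ => v) (A N).silentAttack
    (Filter.Eventually.of_forall fun ω => (A N).silentAttack_fair _ ω)
  have hd : diam₂ (fun _ : K => v) = 0 :=
    Metric.diam_subsingleton (Set.subsingleton_of_subset_singleton (a := v)
      (by rintro _ ⟨j, rfl⟩; rfl))
  rw [hd] at h2 h3
  simp only [ne_eq, OfNat.ofNat_ne_zero, not_false_eq_true, zero_pow, zero_div, mul_zero,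
    ENNReal.ofReal_zero] at h2 h3
  filter_upwards [h1, ae_eq_zero_of_expectation h2, ae_eq_zero_of_expectation h3] with ω g1 g2 g3 j
  set y := (A N).outputs (fun _ => v) (A N).silentAttack ω with hy
  obtain ⟨w, hw⟩ := g1 j
  have hyj : y j = w := (A N).outputs_eq hw
  rw [ENNReal.ofReal_eq_zero] at g2 g3
  have hdiam : diam₂ y = 0 := pow_eq_zero_iff (two_ne_zero) |>.mp (le_antisymm g2 (sq_nonneg _))
  have hconst : ∀ k, y k = w := fun k => by
    rw [← hyj]
    exact dist_le_zero.mp ((dist_le_diam₂ y k j).trans hdiam.le)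
  have hc : (Fintype.card K : ℝ) ≠ 0 := by
    have : 0 < Fintype.card K := Fintype.card_pos_iff.mpr ⟨j⟩
    positivity
  have hmean : ∀ u : Vec d, mean (fun _ : K => u) = u := fun u => by
    simp only [mean, Finset.sum_const, Finset.card_univ, ← Nat.cast_smul_eq_nsmul ℝ, smul_smul,
      inv_mul_cancel₀ hc, one_smul]
  have hyw : y = fun _ => w := funext hconst
  rw [hyw, hmean, hmean] at g3
  have : ‖w - v‖ = 0 := pow_eq_zero_iff (two_ne_zero) |>.mp (le_antisymm g3 (sq_nonneg _))
  have hwv : w = v := sub_eq_zero.mp (norm_eq_zero.mp this)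
  rwa [hwv] at hw

theorem exists_worlds {n f : ℕ} (hn : f + 2 ≤ n) (hf : n ≤ 3 * f) :
    ∃ H K₁ K₂ : Finset (Fin n), H.card + f = n ∧ K₁.card + f = n ∧ K₂.card + f = n ∧
      (∀ j ∈ H, j ∈ K₁ ↔ j ∉ K₂) ∧ (∃ j ∈ H, j ∈ K₁) ∧ ∃ j ∈ H, j ∈ K₂ := by
  classical
  obtain ⟨a, b, hab, ha, hb, haf, hbf⟩ :
      ∃ a b, a + b + f = n ∧ 0 < a ∧ 0 < b ∧ a ≤ f ∧ b ≤ f :=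
    -- The cap `n - f - 1` leaves at least one element for `b`, and `b ≤ f` because `n - f ≤ 2 f`.
    ⟨min f (n - f - 1), n - f - min f (n - f - 1), by omega, by omega, by omega, by omega,
      by omega⟩
  obtain ⟨P, -, hP⟩ := Finset.exists_subset_card_eq (s := (Finset.univ : Finset (Fin n))) (n := a)
    (by rw [Finset.card_univ, Fintype.card_fin]; omega)
  obtain ⟨Q, hQP, hQ⟩ := Finset.exists_subset_card_eq (s := Pᶜ) (n := b)
    (by rw [Finset.card_compl, Fintype.card_fin]; omega)
  have hPQ : Disjoint P Q := Finset.disjoint_of_subset_right hQP disjoint_compl_right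
  have hR : (P ∪ Q)ᶜ.card = f := by
    rw [Finset.card_compl, Finset.card_union_of_disjoint hPQ, Fintype.card_fin]
    omega
  -- The sizes complete `P` and `Q` to `n - f` nodes each. `R₁` and `R₂` may overlap, since a
  -- Byzantine node can play a role in both worlds.
  obtain ⟨R₁, hR₁, hc₁⟩ := Finset.exists_subset_card_eq (s := (P ∪ Q)ᶜ) (n := b) (by omega)
  obtain ⟨R₂, hR₂, hc₂⟩ := Finset.exists_subset_card_eq (s := (P ∪ Q)ᶜ) (n := a) (by omega)
  have hd₁ : ∀ j ∈ P ∪ Q, j ∉ R₁ := fun j hj hj' => Finset.mem_compl.mp (hR₁ hj') hj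
  have hd₂ : ∀ j ∈ P ∪ Q, j ∉ R₂ := fun j hj hj' => Finset.mem_compl.mp (hR₂ hj') hj
  refine ⟨P ∪ Q, P ∪ R₁, Q ∪ R₂, ?_, ?_, ?_, ?_, ?_, ?_⟩
  · rw [Finset.card_union_of_disjoint hPQ]; omega
  · rw [Finset.card_union_of_disjoint (Finset.disjoint_left.mpr fun j hj =>
      hd₁ j (Finset.mem_union_left _ hj))]
    omega
  · rw [Finset.card_union_of_disjoint (Finset.disjoint_left.mpr fun j hj =>
      hd₂ j (Finset.mem_union_right _ hj))]
    omega
  · intro j hj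
    have h1 := hd₁ j hj
    have h2 := hd₂ j hj
    have h3 : j ∈ P → j ∉ Q := fun h => Finset.disjoint_left.mp hPQ h
    simp only [Finset.mem_union] at hj ⊢
    tauto
  · obtain ⟨j, hj⟩ := Finset.card_pos.mp (hP ▸ ha : 0 < P.card)
    exact ⟨j, Finset.mem_union_left _ hj, Finset.mem_union_left _ hj⟩
  · obtain ⟨j, hj⟩ := Finset.card_pos.mp (hQ ▸ hb : 0 < Q.card)
    exact ⟨j, Finset.mem_union_right _ hj, Finset.mem_union_left _ hj⟩

theorem not_solves (n f d : ℕ) (hd : 0 < d) (hn : f + 2 ≤ n) (hf : n ≤ 3 * f) :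
    ¬ ∃ A : Algorithm.{u} n d, SolvesAveragingAgreement f A := by
  classical
  rintro ⟨A, C, hA⟩
  obtain ⟨H, K₁, K₂, hH, hK₁, hK₂, hK, ⟨j₁, hj₁H, hj₁⟩, ⟨j₂, hj₂H, hj₂⟩⟩ := exists_worlds hn hf
  let v : Vec d := EuclideanSpace.single ⟨0, hd⟩ 1
  have hv : ‖v‖ = 1 := by simp [v]
  have hae := ((A 1).measurePreserving_restrict K₁).quasiMeasurePreserving.ae
    (decides_const hA 1 hK₁ 0)
  have hae' := ((A 1).measurePreserving_restrict K₂).quasiMeasurePreserving.ae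
    (decides_const hA 1 hK₂ v)
  obtain ⟨ρ, hρ⟩ := (A 1).exists_tape_off H (hae.and hae')
  let x : H → Vec d := fun j => if (j : Fin n) ∈ K₁ then 0 else v
  have hx₁ : ∀ j (_ : j ∈ K₁) (hH : j ∈ H), (0 : Vec d) = x ⟨j, hH⟩ := fun j hj hH => by
    simp [x, hj]
  have hx₂ : ∀ j (_ : j ∈ K₂) (hH : j ∈ H), v = x ⟨j, hH⟩ := fun j hj hH => by
    have : j ∉ K₁ := fun h => (hK j hH).mp h hj
    simp [x, this]
  set byz : (A 1).Attack H := (A 1).splitAttack ((A 1).restrict K₁ ρ) ((A 1).restrict K₂ ρ)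
    (fun _ => 0) (fun _ => v) with hbyz
  have hrun : ∀ᵐ ω ∂(A 1).tapeLaw H, (A 1).Fair x byz ω ∧
      (A 1).Decides x byz ω ⟨j₁, hj₁H⟩ 0 ∧ (A 1).Decides x byz ω ⟨j₂, hj₂H⟩ v := by
    filter_upwards [hρ] with ω hω
    obtain ⟨Ω, rfl, hΩ, hd₁, hd₂⟩ := hω
    obtain ⟨g1, g2, g3⟩ := (A 1).splitAttack_decides hΩ (fun j hj h => (hK j hj).mp h)
      hx₁ hx₂ hd₁ hd₂
    exact ⟨g1, g2 j₁ hj₁ hj₁H, g3 j₂ hj₂ hj₂H⟩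
  obtain ⟨-, h2, -⟩ := hA 1 H hH x byz (hrun.mono fun ω h => h.1)
  have hxd : diam₂ x ^ 2 ≤ 1 := by
    refine diam₂_sq_le zero_le_one fun j k => ?_
    have hcase : ∀ i, x i = 0 ∨ x i = v := fun i => by
      by_cases hi : (i : Fin n) ∈ K₁ <;> simp [x, hi]
    rcases hcase j with h | h <;> rcases hcase k with h' | h' <;> simp [h, h', hv]
  have hlow : ENNReal.ofReal 1 ≤ expectation ((A 1).tapeLaw H)
      (fun ω => ENNReal.ofReal (diam₂ ((A 1).outputs x byz ω) ^ 2)) := by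
    refine le_expectation (hrun.mono fun ω hω => ENNReal.ofReal_le_ofReal ?_)
    have h3 := dist_le_diam₂ ((A 1).outputs x byz ω) ⟨j₁, hj₁H⟩ ⟨j₂, hj₂H⟩
    rw [(A 1).outputs_eq hω.2.1, (A 1).outputs_eq hω.2.2, dist_zero_left, hv] at h3
    exact one_le_pow₀ h3
  -- For `N = 1` the bound is at most `1 / 4`, while the outputs `0` and `v` are at distance `1`.
  have h4 := (ENNReal.ofReal_le_ofReal_iff (by positivity)).mp (hlow.trans h2)
  norm_num at h4
  linarith

end ByzAvg

theorem mainTheorem6 :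
    (∀ (n f d : ℕ) (ε : ℝ), 0 < n → 0 < ε → (3 + ε) * (f : ℝ) ≤ (n : ℝ) →
      ByzAvg.AchievesAveragingAgreement f (ByzAvg.rbtm n f d ε)
        (4 * (f : ℝ) / √((n : ℝ) - (f : ℝ)))) ∧
    (∀ n f d : ℕ, 0 < d → f + 2 ≤ n → n ≤ 3 * f →
      ¬ ∃ A : ByzAvg.Algorithm.{u} n d, ByzAvg.SolvesAveragingAgreement f A) := by
  exact ⟨ByzAvg.rbtm_achieves, ByzAvg.not_solves⟩
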